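/- **Theorem.** Let $d\ge 1$, $a_1,\dots,a_d>0$, $A=(a_1,\dots,a_d)$, $K_d(A)=[0,a_1]\times\cdots\times[0,a_d]$, and let $N=N(u)=(n_1(u),\dots,n_d(u))$ be $d$-tuples of positive integers with $n_i(u)/u\to a_i$ as $u\to\infty$. Let $L_d(N)$ be the lattice hypercube, that is, the graph with vertex set $\prod_{i=1}^d\{0,1,\dots,n_i\}$ in which two vertices are adjacent when they differ by $1$ in exactly one coordinate and agree in all others; its boundary consists of the vertices having some coordinate $x_i\in\{0,n_i\}$. Let $\Delta_{L_d(N)}$ be the discrete Dirichlet Laplacian, i.e. the operator $f\mapsto\bigl(x\mapsto\sum_{y\sim x}(f(x)-f(y))\bigr)$, evaluated at the interior vertices $x$, on the functions $f$ that vanish on the boundary. Let $\Delta_{K_d(A)}=-\sum_i\partial_i^2$ with Dirichlet boundary condition on $K_d(A)$, and let $\theta(t)=\sum_\lambda e^{-\lambda t}$, the sum being over its eigenvalues counted with multiplicity. The zeta function $\zeta_{K_d(A)}(s)=\frac1{\Gamma(s)}\int_0^\infty\theta(t)\,t^{s}\,\frac{dt}{t}$, defined for $\operatorname{Re}s>d/2$,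 has a meromorphic continuation to $\mathbb C$ that is holomorphic at $0$; put $\log\det_\zeta\Delta_{K_d(A)}=-\zeta_{K_d(A)}'(0)$. For $1\le i\le d$ let $$V_i^{d,N}=\frac1{2^{d-i}}\sum_{1\le j_1<\cdots<j_i\le d}n_{j_1}\cdots n_{j_i},$$ $$\mathcal L_i^d(0)=-\int_0^\infty\Bigl((-1-e^{-4t})^{d-i}e^{-2it}I_0(2t)^i-(-2)^{d-i}e^{-t}\Bigr)\frac{dt}{t},$$ where $I_0(x)=\sum_{k\ge0}(x/2)^{2k}/(k!)^2$ is the modified Bessel function; these integrals converge absolutely. Then, as $u\to\infty$, $$\log\det\Delta_{L_d(N)}=\sum_{i=1}^dV_i^{d,N}\mathcal L_i^d(0)-\frac{(-1)^d}{2^d}\log(u^2)+\log{\det}_\zeta\Delta_{K_d(A)}+\frac{(-1)^d}{2^d}\sum_{i=1}^d\binom di\log(4i)+o(1).$$ -/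

import Mathlib

open scoped ContDiff

noncomputable section

namespace DirichletBox

/-! ### The discrete side -/

/-- The discrete hypercube `L_d(N)`, `N = (n_1, …, n_d)`: the Cartesian product of `d` path graphs,
the `i`-th one with vertices `0, 1, …, n_i` and `n_i` edges. Two vertices are joined when they
differ in exactly one coordinate and are neighbours in the corresponding path. -/
def latticeGraph {d : ℕ} (n : Fin d → ℕ) : SimpleGraph ((i : Fin d) → Fin (n i + 1)) where
  Adj x y := ∃ i, (SimpleGraph.pathGraph (n i + 1)).Adj (x i) (y i) ∧ ∀ j, j ≠ i → x j = y j
  symm := ⟨fun _ _ ⟨i, h, h'⟩ => ⟨i, h.symm, fun j hj => (h' j hj).symm⟩⟩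
  loopless := ⟨fun _ ⟨_, h, _⟩ => h.ne rfl⟩

instance {d : ℕ} (n : Fin d → ℕ) : DecidableRel (latticeGraph n).Adj := Classical.decRel _

/-- The vertices of `L_d(N)` not on its boundary: no coordinate is an end point of its path. -/
abbrev InteriorVertex {d : ℕ} (n : Fin d → ℕ) : Type :=
  {x : (i : Fin d) → Fin (n i + 1) // ∀ i, 0 < x i ∧ x i < Fin.last (n i)}

/-- The discrete Laplacian `f ↦ ∑_{y ∼ x} (f x - f y)` of `L_d(N)` with Dirichlet boundary
condition: the graph Laplacian, restricted to the functions that vanish on the boundary (such a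
function is given by its values on the interior vertices) and evaluated at interior vertices. -/
def discreteDirichletLaplacian {d : ℕ} (n : Fin d → ℕ) :
    Matrix (InteriorVertex n) (InteriorVertex n) ℝ :=
  ((latticeGraph n).lapMatrix ℝ).submatrix Subtype.val Subtype.val

/-- `V_k^{d,N} = 2^{-(d-k)} ∑_{i_1 < ⋯ < i_k} n_{i_1} ⋯ n_{i_k}`. -/
def faceVolume {d : ℕ} (n : Fin d → ℕ) (k : ℕ) : ℝ :=
  1 / 2 ^ (d - k) * ∑ S ∈ Finset.powersetCard k (Finset.univ : Finset (Fin d)), ∏ j ∈ S, (n j : ℝ)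

/-- The modified Bessel function of the first kind of order zero,
`I_0(x) = ∑_k (x/2)^{2k} / (k!)^2`. -/
def besselI0 (x : ℝ) : ℝ := ∑' k : ℕ, (x / 2) ^ (2 * k) / (k.factorial : ℝ) ^ 2

/-- The integrand of `L_i^d(s)`, the factor `1/t` of the measure `dt/t` included. -/
def bulkIntegrand (d i : ℕ) (s t : ℝ) : ℝ :=
  ((-1 - Real.exp (-4 * t)) ^ (d - i) * Real.exp (-s ^ 2 * t) * Real.exp (-2 * i * t)
      * besselI0 (2 * t) ^ i - (-2) ^ (d - i) * Real.exp (-t)) / t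

/-- `L_i^d(s) = -∫_0^∞ ((-1-e^{-4t})^{d-i} e^{-s²t} e^{-2it} I_0(2t)^i - (-2)^{d-i} e^{-t}) dt/t`. -/
def bulkConstant (d i : ℕ) (s : ℝ) : ℝ := -∫ t in Set.Ioi (0 : ℝ), bulkIntegrand d i s t

/-! ### The continuum side -/

/-- The closed hypercube `K_d(A) = [0, a_1] × ⋯ × [0, a_d]`. -/
def closedBox {d : ℕ} (a : Fin d → ℝ) : Set (EuclideanSpace ℝ (Fin d)) :=
  {x | ∀ i, 0 ≤ x i ∧ x i ≤ a i}

/-- The interior of `K_d(A)`. -/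
def openBox {d : ℕ} (a : Fin d → ℝ) : Set (EuclideanSpace ℝ (Fin d)) :=
  {x | ∀ i, 0 < x i ∧ x i < a i}

theorem isOpen_openBox {d : ℕ} (a : Fin d → ℝ) : IsOpen (openBox a) := by
  have h : openBox a = ⋂ i, {x : EuclideanSpace ℝ (Fin d) | 0 < x i ∧ x i < a i} := by
    ext x; simp [openBox]
  rw [h]
  refine isOpen_iInter_of_finite fun i => ?_
  have hc : Continuous fun x : EuclideanSpace ℝ (Fin d) => x i := by fun_prop
  exact (isOpen_lt continuous_const hc).inter (isOpen_lt hc continuous_const)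

theorem contDiffAt_of_mem_openBox {d : ℕ} {a : Fin d → ℝ} {f : EuclideanSpace ℝ (Fin d) → ℝ}
    (hf : ContDiffOn ℝ ∞ f (closedBox a)) {x : EuclideanSpace ℝ (Fin d)} (hx : x ∈ openBox a) :
    ContDiffAt ℝ 2 f x := by
  have h : closedBox a ∈ nhds x :=
    Filter.mem_of_superset ((isOpen_openBox a).mem_nhds hx)
      fun y hy i => ⟨(hy i).1.le, (hy i).2.le⟩
  exact (hf.contDiffAt h).of_le (WithTop.coe_le_coe.2 le_top)

/-- The eigenspace `{f : -Δ f = μ f}` of the Laplacian on `K_d(A)` with Dirichlet boundary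
condition. A function on `K_d(A)` vanishing on the boundary is represented by its extension by zero,
so that `f = 0` off the open box; it is smooth on the closed box (up to the boundary). -/
def dirichletEigenspace {d : ℕ} (a : Fin d → ℝ) (μ : ℝ) :
    Submodule ℝ (EuclideanSpace ℝ (Fin d) → ℝ) where
  carrier := {f | ContDiffOn ℝ ∞ f (closedBox a) ∧ (∀ x, x ∉ openBox a → f x = 0) ∧
    ∀ x ∈ openBox a, -(Laplacian.laplacian f x) = μ * f x}
  zero_mem' := by
    refine ⟨contDiffOn_const, fun _ _ => rfl, fun x _ => ?_⟩
    have h := InnerProductSpace.laplacian_smul (0 : ℝ)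
      (f := fun _ : EuclideanSpace ℝ (Fin d) => (0 : ℝ)) (x := x) contDiffAt_const
    rw [zero_smul, zero_smul] at h
    simp [h]
  add_mem' := by
    rintro f g ⟨hf, hf0, hfe⟩ ⟨hg, hg0, hge⟩
    refine ⟨hf.add hg, fun x hx => by simp [hf0 x hx, hg0 x hx], fun x hx => ?_⟩
    rw [(contDiffAt_of_mem_openBox hf hx).laplacian_add (contDiffAt_of_mem_openBox hg hx),
      neg_add, hfe x hx, hge x hx, Pi.add_apply, mul_add]
  smul_mem' := by
    rintro c f ⟨hf, hf0, hfe⟩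
    refine ⟨contDiffOn_const.smul hf, fun x hx => by simp [hf0 x hx], fun x hx => ?_⟩
    rw [InnerProductSpace.laplacian_smul c (contDiffAt_of_mem_openBox hf hx), Pi.smul_apply,
      smul_eq_mul, smul_eq_mul, ← mul_neg, hfe x hx]
    ring

/-- Multiplicity of `μ` as an eigenvalue of the Dirichlet Laplacian (`0` if it is not one). -/
def dirichletMultiplicity {d : ℕ} (a : Fin d → ℝ) (μ : ℝ) : ℕ :=
  Module.finrank ℝ (dirichletEigenspace a μ)

/-- The theta function `θ(t) = ∑_μ e^{-μ t}`, the sum over the eigenvalues of the Dirichlet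
Laplacian on `K_d(A)` counted with multiplicity. -/
def theta {d : ℕ} (a : Fin d → ℝ) (t : ℝ) : ℝ :=
  ∑' μ : ℝ, (dirichletMultiplicity a μ : ℝ) * Real.exp (-μ * t)

/-- `log det_ζ` of the Dirichlet Laplacian on `K_d(A)` exists and equals `L`: the zeta function
`ζ(s) = Γ(s)⁻¹ ∫_0^∞ θ(t) t^s dt/t`, `Re s > d/2`, has a meromorphic continuation `Z` to the complex
plane that is holomorphic at `0`, and `L = -Z'(0)`. The first three fields say that `θ` and `ζ` are
well defined. -/
structure HasLogZetaDet {d : ℕ} (a : Fin d → ℝ) (L : ℝ) : Prop where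
  finiteDimensional : ∀ μ : ℝ, FiniteDimensional ℝ (dirichletEigenspace a μ)
  summable_theta : ∀ t : ℝ, 0 < t →
    Summable fun μ : ℝ => (dirichletMultiplicity a μ : ℝ) * Real.exp (-μ * t)
  mellinConvergent : ∀ s : ℂ, (d : ℝ) / 2 < s.re →
    MellinConvergent (fun t => (theta a t : ℂ)) s
  exists_continuation : ∃ Z : ℂ → ℂ, Meromorphic Z ∧ AnalyticAt ℂ Z 0 ∧
    (∀ s : ℂ, (d : ℝ) / 2 < s.re →
      Z s = (Complex.Gamma s)⁻¹ * mellin (fun t => (theta a t : ℂ)) s) ∧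
    deriv Z 0 = -(L : ℂ)

end DirichletBox

end

/-! Both determinants are read off heat traces. On the lattice, Frullani's integral `log λ = ∫
(e^{-t} - e^{-λt}) dt/t`, summed over the spectrum, writes `-log det` as an integral of the heat
trace, and separation of variables makes that trace a product of one-dimensional traces `pathTheta`.
Unfolding the path to a cycle of length `2n` and filtering by roots of unity gives `pathTheta n t =
-(1 + e^{-4t})/2 + n e^{-2t} ∑_{j ∈ ℤ} I_{2nj}(2t)`. The term `j = 0` gives `pathMain`. The others
are nonnegative, and a Chernoff-type bound (`pathTheta_sub_pathMain_le`) makes them tiny when `t` is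
much smaller than `n ^ 2`.

The product of the `pathMain` expands in face volumes. Terms of degree `i ≥ 1` in the sides, with
their `e^{-t}` counterterms, integrate to `faceVolume n i * bulkConstant d i 0`. The term of degree
0 is `(-1/2)^d (1 + e^{-4t})^d`: its exponentials `e^{-4it}` give the numbers `log (4i)` by
Frullani, and its constant part, which has no decay at infinity, is balanced by `1 - e^{-t/u²}` at
the cost of `log (u²)`. The resulting formula `log_det_eq` is exact, with one integral left over.
Since `dt/t` is scale invariant, `t = u² τ` turns this integral into one whose integrand converges
pointwise to `limitIntegrand`; uniform bounds near zero and infinity allow dominated convergence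
(`tendsto_integral_remainder`).

On the continuum side, Green's identity and completeness of the sine products show that `theta` is
the product `boxHeat` of Gaussian sums. Its difference from `boxMain` is `O(τ^K)` for every `K` as
`τ → 0`, so subtracting `boxMain` on `(0, 1]` continues the zeta function explicitly, and `ζ'(0)` is
the integral of `limitIntegrand` (`hasDerivAt_boxZeta`). Uniqueness of meromorphic continuation
handles an arbitrary `Z` in `HasLogZetaDet`. -/

noncomputable section

namespace DirichletBox

open Real Finset Filter Topology

/-! ### The heat trace of a path and its Bessel approximation -/

/-- The heat kernel `e^{-2t} I_0(2t)` of `ℤ` on the diagonal. -/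
def besselKernel (t : ℝ) : ℝ := exp (-2 * t) * besselI0 (2 * t)

/-- The heat trace of the path with `n` edges with Dirichlet boundary condition. -/
def pathTheta (n : ℕ) (t : ℝ) : ℝ :=
  ∑ k ∈ Ico 1 n, exp (-(2 - 2 * cos (π * k / n)) * t)

/-- The approximation of `pathTheta n t` for `t` much smaller than `n ^ 2`. -/
def pathMain (n : ℕ) (t : ℝ) : ℝ := (-1 - exp (-4 * t)) / 2 + n * besselKernel t

/-- The reflection `k ↦ 2n - k` preserves the cosine and fixes only the end points `0` and `n`. It
turns the Dirichlet sum into a full sum over the `2n`-th roots of unity. -/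
theorem sum_range_two_mul_cos (F : ℝ → ℝ) {n : ℕ} (hn : 1 ≤ n) :
    ∑ k ∈ range (2 * n), F (cos (π * k / n)) =
      F 1 + F (-1) + 2 * ∑ k ∈ Ico 1 n, F (cos (π * k / n)) := by
  have hn0 : (n : ℝ) ≠ 0 := by positivity
  have h1 : ∑ k ∈ range n, F (cos (π * k / n)) = F 1 + ∑ k ∈ Ico 1 n, F (cos (π * k / n)) := by
    rw [range_eq_Ico, sum_eq_sum_Ico_succ_bot (by lia)]
    simp
  have h2 : ∑ k ∈ Ico n (2 * n), F (cos (π * k / n)) =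
      F (-1) + ∑ k ∈ Ico 1 n, F (cos (π * k / n)) := by
    rw [sum_eq_sum_Ico_succ_bot (by lia), mul_div_assoc, div_self hn0, mul_one, cos_pi]
    congr 1
    refine sum_bij' (fun k _ => 2 * n - k) (fun k _ => 2 * n - k) ?_ ?_ ?_ ?_ ?_
    · intro k hk; simp only [mem_Ico] at hk ⊢; lia
    · intro k hk; simp only [mem_Ico] at hk ⊢; lia
    · intro k hk; simp only [mem_Ico] at hk; lia
    · intro k hk; simp only [mem_Ico] at hk; lia
    · intro k hk
      simp only [mem_Ico] at hk
      rw [Nat.cast_sub (by lia), ← cos_two_pi_sub (π * k / n)]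
      congr 2
      push_cast
      field_simp
  rw [range_eq_Ico, ← sum_Ico_consecutive _ (Nat.zero_le n) (by lia), ← range_eq_Ico, h1, h2]
  ring

theorem exp_add_exp_add_pathTheta {n : ℕ} (hn : 1 ≤ n) (t : ℝ) :
    ∑ k ∈ range (2 * n), exp (-(2 - 2 * cos (π * k / n)) * t) =
      1 + exp (-4 * t) + 2 * pathTheta n t := by
  rw [sum_range_two_mul_cos (fun c => exp (-(2 - 2 * c) * t)) hn, pathTheta]
  norm_num

theorem pathTheta_nonneg (n : ℕ) (t : ℝ) : 0 ≤ pathTheta n t :=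
  sum_nonneg fun _ _ => (exp_pos _).le

/-! ### Root-of-unity filter: lattice sums as series over pairs of exponents -/

/-- The terms of the expansion of `exp (t * z) * exp (t / z)`, at `z = r`. -/
def expTerm (t r : ℝ) (p : ℕ × ℕ) : ℝ :=
  (t * r) ^ p.1 / p.1.factorial * ((t * r⁻¹) ^ p.2 / p.2.factorial)

theorem expTerm_nonneg {t r : ℝ} (ht : 0 ≤ t) (hr : 0 ≤ r) (p : ℕ × ℕ) : 0 ≤ expTerm t r p := by
  unfold expTerm; positivity

theorem Complex.hasSum_exp_mul_exp (z w : ℂ) :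
    HasSum (fun p : ℕ × ℕ => z ^ p.1 / p.1.factorial * (w ^ p.2 / p.2.factorial))
      (Complex.exp (z + w)) := by
  have hz := NormedSpace.expSeries_div_hasSum_exp z
  have hw := NormedSpace.expSeries_div_hasSum_exp w
  rw [← Complex.exp_eq_exp_ℂ] at hz hw
  have hzn := NormedSpace.norm_expSeries_div_summable z
  have hwn := NormedSpace.norm_expSeries_div_summable w
  have h := (summable_mul_of_summable_norm hzn hwn).hasSum
  rwa [← tsum_mul_tsum_of_summable_norm hzn hwn, hz.tsum_eq, hw.tsum_eq, ← Complex.exp_add] at h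

/-- The indicator function of the pairs with difference divisible by `m`. -/
def dvdWeight (m : ℕ) (p : ℕ × ℕ) : ℝ := if (m : ℤ) ∣ (p.1 : ℤ) - p.2 then 1 else 0

theorem sum_pow_mul_inv_pow_of_isPrimitiveRoot {ζ : ℂ} {m : ℕ} (hm : m ≠ 0)
    (hζ : IsPrimitiveRoot ζ m) (p : ℕ × ℕ) :
    ∑ k ∈ range m, (ζ ^ k) ^ p.1 * ((ζ ^ k)⁻¹) ^ p.2 = m * dvdWeight m p := by
  have hζ0 : ζ ≠ 0 := hζ.ne_zero hm
  have hk : ∀ k : ℕ, (ζ ^ k) ^ p.1 * ((ζ ^ k)⁻¹) ^ p.2 = (ζ ^ ((p.1 : ℤ) - p.2)) ^ k := by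
    intro k
    rw [zpow_sub₀ hζ0, zpow_natCast, zpow_natCast, div_pow, inv_pow, ← pow_mul, ← pow_mul,
      ← pow_mul, ← pow_mul, mul_comm k, mul_comm k, div_eq_mul_inv]
  simp only [hk, dvdWeight]
  split_ifs with h
  · rw [(hζ.zpow_eq_one_iff_dvd _).2 h]; simp
  · have h1 : ζ ^ ((p.1 : ℤ) - p.2) ≠ 1 := fun h' => h ((hζ.zpow_eq_one_iff_dvd _).1 h')
    have h2 : (ζ ^ ((p.1 : ℤ) - p.2)) ^ m = 1 := by
      rw [← zpow_natCast, ← zpow_mul, mul_comm, zpow_mul, zpow_natCast, hζ.pow_eq_one, one_zpow]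
    have h3 := geom_sum_mul (ζ ^ ((p.1 : ℤ) - p.2)) m
    rw [h2, sub_self] at h3
    simpa using (mul_eq_zero.1 h3).resolve_right (sub_ne_zero.2 h1)

/-- The average of `exp (t * z + t / z)` over `z = r ζ`, `ζ ^ m = 1`. -/
def rootAverage (m : ℕ) (t r : ℝ) : ℝ :=
  (m : ℝ)⁻¹ * ∑ k ∈ range m,
    exp (t * (r + r⁻¹) * cos (2 * π * k / m)) * cos (t * (r - r⁻¹) * sin (2 * π * k / m))

/-- Expanding `e^{tz} e^{t/z}` at `z = r ζ^k` and averaging over `k` keeps exactly the monomials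
`z^{p.1 - p.2}` whose exponent is divisible by `m`. The radius `r` is left free for the later tail
estimate. -/
theorem hasSum_dvdWeight_mul_expTerm {m : ℕ} (hm : m ≠ 0) (t : ℝ) (r : ℝ) :
    HasSum (fun p => dvdWeight m p * expTerm t r p) (rootAverage m t r) := by
  have hm' : (m : ℂ) ≠ 0 := by exact_mod_cast hm
  set ζ := Complex.exp (2 * π * Complex.I / m) with hζdef
  have hζ : IsPrimitiveRoot ζ m := Complex.isPrimitiveRoot_exp m hm
  have h := (hasSum_sum (s := range m) fun k _ =>
    Complex.hasSum_exp_mul_exp (t * (r * ζ ^ k)) (t * (r * ζ ^ k)⁻¹)).mul_left ((m : ℂ)⁻¹)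
  have hre := Complex.hasSum_re h
  convert hre using 1
  · ext p
    have : (m : ℂ)⁻¹ * ∑ k ∈ range m, ((t : ℂ) * (r * ζ ^ k)) ^ p.1 / (p.1.factorial : ℂ) *
        ((t * (r * ζ ^ k)⁻¹) ^ p.2 / p.2.factorial) = ((dvdWeight m p * expTerm t r p : ℝ) : ℂ) := by
      have h1 : ∀ k : ℕ, ((t : ℂ) * (r * ζ ^ k)) ^ p.1 / (p.1.factorial : ℂ) *
        ((t * (r * ζ ^ k)⁻¹) ^ p.2 / p.2.factorial) =
          (expTerm t r p : ℂ) * ((ζ ^ k) ^ p.1 * ((ζ ^ k)⁻¹) ^ p.2) := by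
        intro k
        simp only [expTerm, mul_pow, mul_inv]
        push_cast
        ring
      rw [sum_congr rfl fun k _ => h1 k, ← mul_sum,
        sum_pow_mul_inv_pow_of_isPrimitiveRoot hm hζ p]
      push_cast
      field_simp
    rw [this, Complex.ofReal_re]
  · rw [rootAverage]
    have hsum : ∀ k : ℕ, Complex.exp (t * (r * ζ ^ k) + t * (r * ζ ^ k)⁻¹) =
        Complex.exp (((t * (r + r⁻¹) * cos (2 * π * k / m) : ℝ) : ℂ) +
          ((t * (r - r⁻¹) * sin (2 * π * k / m) : ℝ) : ℂ) * Complex.I) := by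
      intro k
      have h1 : ζ ^ k = Complex.exp ((2 * π * k / m : ℝ) * Complex.I) := by
        rw [hζdef, ← Complex.exp_nat_mul]; congr 1; push_cast; ring
      have h2 : (ζ ^ k)⁻¹ = Complex.exp (-(2 * π * k / m : ℝ) * Complex.I) := by
        rw [h1, ← Complex.exp_neg]; congr 1; push_cast; ring
      rw [mul_inv, h2, h1, Complex.exp_mul_I, Complex.exp_mul_I, Complex.cos_neg, Complex.sin_neg]
      congr 1
      push_cast
      ring
    rw [← Complex.ofReal_natCast, ← Complex.ofReal_inv, Complex.re_ofReal_mul, Complex.re_sum]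
    congr 1
    refine sum_congr rfl fun k _ => ?_
    rw [hsum k, Complex.exp_re]
    simp only [Complex.add_re, Complex.add_im, Complex.ofReal_re, Complex.ofReal_im,
      Complex.re_ofReal_mul, Complex.im_ofReal_mul, Complex.I_re, Complex.I_im, mul_zero, mul_one,
      add_zero, zero_add]

theorem rootAverage_le {m : ℕ} (t r : ℝ) :
    rootAverage m t r ≤
      (m : ℝ)⁻¹ * ∑ k ∈ range m, exp (t * (r + r⁻¹) * cos (2 * π * k / m)) := by
  unfold rootAverage
  gcongr with k
  exact mul_le_of_le_one_right (exp_pos _).le (cos_le_one _)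

theorem rootAverage_one {m : ℕ} (t : ℝ) :
    rootAverage m t 1 = (m : ℝ)⁻¹ * ∑ k ∈ range m, exp (t * 2 * cos (2 * π * k / m)) := by
  simp only [rootAverage, inv_one, sub_self, mul_zero, zero_mul, cos_zero, mul_one]
  norm_num

/-- The diagonal of the double exponential series is the Bessel series, so `I_0` and the root
averages become sums of the same terms with different weights. -/
theorem hasSum_besselI0 (t : ℝ) :
    HasSum (fun p : ℕ × ℕ => (if p.1 = p.2 then 1 else 0) * expTerm t 1 p) (besselI0 (2 * t)) := by
  have hs : Summable fun p : ℕ × ℕ => ‖expTerm t 1 p‖ := by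
    have h1 := NormedSpace.norm_expSeries_div_summable t
    refine (h1.mul_norm h1).congr fun p => ?_
    simp [expTerm]
  have hs' : Summable fun p : ℕ × ℕ => (if p.1 = p.2 then 1 else 0) * expTerm t 1 p := by
    refine Summable.of_norm_bounded hs fun p => ?_
    split_ifs <;> simp
  have hinj : Function.Injective fun k : ℕ => (k, k) := fun a b h => (Prod.ext_iff.1 h).1
  have h2 := (hinj.hasSum_iff (f := fun p : ℕ × ℕ => (if p.1 = p.2 then 1 else 0) * expTerm t 1 p)
    (a := besselI0 (2 * t)) ?_).1
  · refine h2 ?_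
    have h3 := (hs'.comp_injective hinj).hasSum
    have h4 : besselI0 (2 * t) = ∑' k : ℕ, ((fun p : ℕ × ℕ =>
        (if p.1 = p.2 then 1 else 0) * expTerm t 1 p) ∘ fun k : ℕ => (k, k)) k := by
      refine tsum_congr fun k => ?_
      simp only [Function.comp, expTerm, if_true, inv_one, mul_one, one_mul]
      rw [mul_div_cancel_left₀ _ two_ne_zero, pow_mul']
      ring
    rwa [h4]
  · rintro ⟨x, y⟩ hxy
    have : x ≠ y := by rintro rfl; exact hxy ⟨x, rfl⟩
    simp [this]

theorem one_le_besselI0 (t : ℝ) : 1 ≤ besselI0 (2 * t) := by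
  have hs := (hasSum_besselI0 t)
  have h0 := hs.summable.sum_le_tsum {((0 : ℕ), (0 : ℕ))} (fun p _ => ?_)
  · rw [hs.tsum_eq] at h0
    simpa [expTerm] using h0
  · split_ifs with hp
    · rw [expTerm, hp, one_mul, inv_one, mul_one]; exact mul_self_nonneg _
    · simp

theorem besselI0_le_exp {t : ℝ} (ht : 0 ≤ t) : besselI0 (2 * t) ≤ exp (2 * t) := by
  -- With `m = 1` every pair has weight one, so the whole double series dominates its diagonal.
  have h1 := hasSum_dvdWeight_mul_expTerm one_ne_zero t 1
  have h2 : rootAverage 1 t 1 = exp (2 * t) := by rw [rootAverage_one]; simp [mul_comm]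
  rw [h2] at h1
  refine hasSum_le (fun p => ?_) (hasSum_besselI0 t) h1
  refine mul_le_mul_of_nonneg_right ?_ (expTerm_nonneg ht zero_le_one p)
  simp only [dvdWeight, Nat.cast_one, one_dvd, if_true]
  split_ifs <;> norm_num

theorem besselKernel_nonneg (t : ℝ) : 0 ≤ besselKernel t :=
  mul_nonneg (exp_pos _).le (zero_le_one.trans (one_le_besselI0 t))

theorem besselKernel_le_one {t : ℝ} (ht : 0 ≤ t) : besselKernel t ≤ 1 := by
  have := mul_le_mul_of_nonneg_left (besselI0_le_exp ht) (exp_pos (-2 * t)).le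
  rwa [← exp_add, show -2 * t + 2 * t = 0 by ring, exp_zero] at this

theorem one_sub_two_mul_le_besselKernel (t : ℝ) : 1 - 2 * t ≤ besselKernel t := by
  have h1 := add_one_le_exp (-2 * t)
  have h2 := mul_le_mul_of_nonneg_left (one_le_besselI0 t) (exp_pos (-2 * t)).le
  rw [besselKernel]; linarith

/-! ### Comparison of the path heat trace with its Bessel approximation -/

theorem pathTheta_sub_pathMain {n : ℕ} (hn : 1 ≤ n) (t : ℝ) :
    pathTheta n t - pathMain n t =
      n * exp (-2 * t) * (rootAverage (2 * n) t 1 - besselI0 (2 * t)) := by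
  have hn0 : (n : ℝ) ≠ 0 := by positivity
  have h := exp_add_exp_add_pathTheta hn t
  have h2 : ∑ k ∈ range (2 * n), exp (-(2 - 2 * cos (π * k / n)) * t) =
      2 * n * exp (-2 * t) * rootAverage (2 * n) t 1 := by
    rw [rootAverage_one, mul_sum, mul_sum]
    refine sum_congr rfl fun k _ => ?_
    have h3 : 2 * π * k / ((2 * n : ℕ) : ℝ) = π * k / n := by push_cast; field_simp
    rw [h3, show -(2 - 2 * cos (π * k / n)) * t = -2 * t + t * 2 * cos (π * k / n) by ring, exp_add]
    push_cast
    field_simp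
  rw [pathMain, besselKernel]
  linear_combination (h2 - h) / 2

/-- The difference is a sum of nonnegative terms over the off-diagonal pairs with `2n ∣ p.1 - p.2`.
-/
theorem pathMain_le_pathTheta {n : ℕ} (hn : 1 ≤ n) {t : ℝ} (ht : 0 ≤ t) :
    pathMain n t ≤ pathTheta n t := by
  rw [← sub_nonneg, pathTheta_sub_pathMain hn]
  refine mul_nonneg (by positivity) (sub_nonneg.2 ?_)
  refine hasSum_le (fun p => ?_) (hasSum_besselI0 t)
    (hasSum_dvdWeight_mul_expTerm (by lia : 2 * n ≠ 0) t 1)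
  refine mul_le_mul_of_nonneg_right ?_ (expTerm_nonneg ht zero_le_one p)
  rw [dvdWeight]
  split_ifs with h1 h2
  · rfl
  · simp [h1] at h2
  · exact zero_le_one
  · rfl

/-- Chernoff's trick: a pair off the diagonal has `|p.1 - p.2| ≥ 2n`, so moving from the unit circle
to radius `r` or `r⁻¹`, according to the sign of the difference, gains a factor at least `r ^ (2n)`.
-/
theorem weight_sub_mul_expTerm_le {n : ℕ} {t r : ℝ} (ht : 0 ≤ t) (hr : 1 ≤ r) (p : ℕ × ℕ) :
    dvdWeight (2 * n) p * expTerm t 1 p - (if p.1 = p.2 then 1 else 0) * expTerm t 1 p ≤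
      (r ^ (2 * n))⁻¹ * (dvdWeight (2 * n) p * expTerm t r p +
        dvdWeight (2 * n) p * expTerm t r⁻¹ p) := by
  have hr0 : 0 < r := by linarith
  have e1 := expTerm_nonneg ht hr0.le p
  have e2 := expTerm_nonneg ht (inv_pos.2 hr0).le p
  have e0 := expTerm_nonneg ht zero_le_one p
  rw [dvdWeight]
  split_ifs with h1 h2 h2
  · simp only [one_mul, sub_self]; positivity
  · rw [one_mul, zero_mul, sub_zero, one_mul, one_mul, inv_mul_eq_div, le_div_iff₀ (by positivity)]
    have key : ∀ {a b : ℕ}, a + 2 * n ≤ b → r ^ (2 * n) ≤ r ^ b * r⁻¹ ^ a := by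
      intro a b hab
      rw [inv_pow, ← div_eq_mul_inv, le_div_iff₀ (by positivity), ← pow_add]
      exact pow_le_pow_right₀ hr (by lia)
    have f1 : expTerm t r p = expTerm t 1 p * (r ^ p.1 * r⁻¹ ^ p.2) := by
      simp only [expTerm, mul_pow, inv_one, one_pow]; ring
    have f2 : expTerm t r⁻¹ p = expTerm t 1 p * (r ^ p.2 * r⁻¹ ^ p.1) := by
      simp only [expTerm, mul_pow, inv_one, one_pow, inv_inv]; ring
    obtain ⟨c, hc⟩ := h1
    have hc0 : c ≠ 0 := by rintro rfl; apply h2; lia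
    rcases lt_or_gt_of_ne hc0 with hc1 | hc1
    · have : p.1 + 2 * n ≤ p.2 := by zify; push_cast at hc; nlinarith
      have := mul_le_mul_of_nonneg_left (key this) e0
      rw [f2]; linarith
    · have : p.2 + 2 * n ≤ p.1 := by zify; push_cast at hc; nlinarith
      have := mul_le_mul_of_nonneg_left (key this) e0
      rw [f1]; linarith
  · exact absurd (by simp [h2]) h1
  · simp

/-- The gain `r^{-2n}` is paid for by enlarging the exponent `2t cos` to `t (r + r⁻¹) cos`. The
radius is optimised separately for large and for small `t`. -/
theorem pathTheta_sub_pathMain_le {n : ℕ} (hn : 1 ≤ n) {t r : ℝ} (ht : 0 ≤ t) (hr : 1 ≤ r) :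
    pathTheta n t - pathMain n t ≤
      (r ^ (2 * n))⁻¹ * exp (t * (r + r⁻¹ - 2)) * (1 + exp (-4 * t) + 2 * pathTheta n t) := by
  have hr0 : 0 < r := by linarith
  have hn0 : (n : ℝ) ≠ 0 := by positivity
  have hm : 2 * n ≠ 0 := by lia
  have hle := hasSum_le (weight_sub_mul_expTerm_le (n := n) ht hr)
    ((hasSum_dvdWeight_mul_expTerm hm t 1).sub (hasSum_besselI0 t))
    (((hasSum_dvdWeight_mul_expTerm hm t r).add
      (hasSum_dvdWeight_mul_expTerm hm t r⁻¹)).mul_left _)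
  set S := ∑ k ∈ range (2 * n), exp (t * (r + r⁻¹) * cos (π * k / n)) with hS
  have hangle : ∀ k : ℕ, 2 * π * k / ((2 * n : ℕ) : ℝ) = π * k / n := fun k => by
    push_cast; field_simp
  have h1 : rootAverage (2 * n) t r ≤ (2 * n : ℝ)⁻¹ * S := by
    have := rootAverage_le (m := 2 * n) t r
    simp only [hangle] at this
    simpa using this
  have h2 : rootAverage (2 * n) t r⁻¹ ≤ (2 * n : ℝ)⁻¹ * S := by
    have := rootAverage_le (m := 2 * n) t r⁻¹
    simp only [hangle, inv_inv, add_comm r⁻¹ r] at this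
    simpa using this
  have hrr : 2 ≤ r + r⁻¹ := by
    have : r * r⁻¹ = 1 := mul_inv_cancel₀ hr0.ne'
    have := inv_pos.2 hr0
    nlinarith [sq_nonneg (r - 1)]
  have h3 : exp (-2 * t) * S ≤
      exp (t * (r + r⁻¹ - 2)) * (1 + exp (-4 * t) + 2 * pathTheta n t) := by
    rw [← exp_add_exp_add_pathTheta hn t, hS, mul_sum, mul_sum]
    refine sum_le_sum fun k _ => ?_
    rw [← exp_add, ← exp_add, exp_le_exp]
    -- The comparison of exponents is `t (r + r⁻¹ - 2) (1 - cos) ≥ 0`.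
    have := mul_nonneg ht (mul_nonneg (sub_nonneg.2 hrr) (sub_nonneg.2 (cos_le_one (π * k / n))))
    linarith
  calc pathTheta n t - pathMain n t
      = n * exp (-2 * t) * (rootAverage (2 * n) t 1 - besselI0 (2 * t)) :=
        pathTheta_sub_pathMain hn t
    _ ≤ n * exp (-2 * t) * ((r ^ (2 * n))⁻¹ * ((2 * n : ℝ)⁻¹ * S + (2 * n : ℝ)⁻¹ * S)) := by
        gcongr
        refine hle.trans ?_
        gcongr
    _ = (r ^ (2 * n))⁻¹ * (exp (-2 * t) * S) := by field_simp; ring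
    _ ≤ _ := by rw [mul_assoc]; gcongr

end DirichletBox

end

noncomputable section

namespace DirichletBox

open Real Finset Filter Topology

/-! ### Gaussian sums -/

/-- `∑_{k ≥ 1} e^{-c k²}`. -/
def gaussSum (c : ℝ) : ℝ := ∑' k : ℕ, exp (-c * ((k : ℝ) + 1) ^ 2)

theorem hasSum_exp_neg_mul_add_one {c : ℝ} (hc : 0 < c) :
    HasSum (fun k : ℕ => exp (-c * ((k : ℝ) + 1))) (1 / (exp c - 1)) := by
  have h1 : exp (-c) < 1 := by
    rw [← exp_zero]; exact exp_lt_exp.2 (by linarith)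
  have h := (hasSum_geometric_of_lt_one (exp_pos (-c)).le h1).mul_left (exp (-c))
  have hne : exp c - 1 ≠ 0 := (sub_pos.2 (one_lt_exp_iff.2 hc)).ne'
  have e : exp (-c) * (1 - exp (-c))⁻¹ = 1 / (exp c - 1) := by
    rw [exp_neg] at h1 ⊢
    have := exp_pos c
    have h2 : 1 - (exp c)⁻¹ ≠ 0 := by linarith
    field_simp
  rw [e] at h
  have hf : (fun k : ℕ => exp (-c * ((k : ℝ) + 1))) = fun k => exp (-c) * exp (-c) ^ k := by
    funext k
    rw [← exp_nat_mul, ← exp_add]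
    congr 1
    ring
  rwa [hf]

theorem exp_neg_mul_sq_le {c : ℝ} (hc : 0 ≤ c) (k : ℕ) :
    exp (-c * ((k : ℝ) + 1) ^ 2) ≤ exp (-c * ((k : ℝ) + 1)) := by
  rw [exp_le_exp]
  have : (0 : ℝ) ≤ k := k.cast_nonneg
  nlinarith [mul_nonneg hc (mul_nonneg this (by linarith : (0 : ℝ) ≤ k + 1))]

theorem summable_gaussSum {c : ℝ} (hc : 0 < c) :
    Summable fun k : ℕ => exp (-c * ((k : ℝ) + 1) ^ 2) :=
  Summable.of_nonneg_of_le (fun _ => (exp_pos _).le) (exp_neg_mul_sq_le hc.le)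
    (hasSum_exp_neg_mul_add_one hc).summable

theorem gaussSum_nonneg (c : ℝ) : 0 ≤ gaussSum c := tsum_nonneg fun _ => (exp_pos _).le

theorem gaussSum_le {c : ℝ} (hc : 0 < c) : gaussSum c ≤ 1 / (exp c - 1) :=
  hasSum_le (exp_neg_mul_sq_le hc.le) (summable_gaussSum hc).hasSum (hasSum_exp_neg_mul_add_one hc)

theorem one_div_exp_sub_one_le {c : ℝ} (hc : 0 < c) {K : ℕ} (hK : 1 ≤ K) :
    1 / (exp c - 1) ≤ K.factorial / c ^ K := by
  have h : 1 + c ^ K / K.factorial ≤ exp c := by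
    have h1 := sum_le_exp_of_nonneg hc.le (K + 1)
    -- Of the exponential series only the terms `0` and `K` are kept; `K ≥ 1` makes them distinct.
    have h2 : ∑ i ∈ ({0, K} : Finset ℕ), c ^ i / (i.factorial : ℝ) ≤
        ∑ i ∈ range (K + 1), c ^ i / (i.factorial : ℝ) :=
      sum_le_sum_of_subset_of_nonneg (by intro i; simp; lia) fun _ _ _ => by positivity
    rw [sum_pair (by lia)] at h2
    simpa using h2.trans h1
  have h3 : 0 < c ^ K / K.factorial := by positivity
  calc 1 / (exp c - 1) ≤ 1 / (c ^ K / K.factorial) := by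
        apply one_div_le_one_div_of_le h3; linarith
    _ = _ := by rw [one_div_div]

theorem gaussSum_le_factorial_div {c : ℝ} (hc : 0 < c) {K : ℕ} (hK : 1 ≤ K) :
    gaussSum c ≤ K.factorial / c ^ K :=
  (gaussSum_le hc).trans (one_div_exp_sub_one_le hc hK)

theorem tsum_int_exp_neg_mul_sq {c : ℝ} (hc : 0 < c) :
    ∑' n : ℤ, exp (-c * (n : ℝ) ^ 2) = 1 + 2 * gaussSum c := by
  have h := (summable_gaussSum hc).hasSum
  have h0 : HasSum (fun k : ℕ => exp (-c * (((k : ℕ) : ℤ) : ℝ) ^ 2)) (1 + gaussSum c) := by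
    rw [← hasSum_nat_add_iff' 1]
    simpa [gaussSum] using h
  have h1 := HasSum.of_nat_of_neg_add_one (f := fun n : ℤ => exp (-c * (n : ℝ) ^ 2)) h0
    (m' := gaussSum c) (by
      have hf : (fun k : ℕ => exp (-c * ((-((k : ℤ) + 1) : ℤ) : ℝ) ^ 2)) =
          fun k : ℕ => exp (-c * ((k : ℝ) + 1) ^ 2) := by
        funext k
        push_cast
        rw [neg_sq]
      rw [hf]
      exact h)
  rw [h1.tsum_eq]; ring

/-- Poisson summation for the Gaussian. It is used to find the large-time behaviour of the Bessel
kernel. -/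
theorem one_add_two_mul_gaussSum {c : ℝ} (hc : 0 < c) :
    1 + 2 * gaussSum c = √(π / c) * (1 + 2 * gaussSum (π ^ 2 / c)) := by
  have h := Real.tsum_exp_neg_mul_int_sq (a := c / π) (by positivity)
  have e1 : -π * (c / π) = -c := by field_simp
  have e2 : -π / (c / π) = -(π ^ 2 / c) := by field_simp
  rw [e1, e2, tsum_int_exp_neg_mul_sq hc, tsum_int_exp_neg_mul_sq (by positivity)] at h
  rw [h, ← sqrt_eq_rpow, one_div, ← sqrt_inv, inv_div]

/-- The heat trace of the interval of length `a` with Dirichlet boundary condition. -/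
def intervalHeat (a τ : ℝ) : ℝ := gaussSum ((π / a) ^ 2 * τ)

theorem tendsto_gaussSum_atTop : Tendsto gaussSum atTop (𝓝 0) := by
  refine squeeze_zero' (Eventually.of_forall gaussSum_nonneg)
    (g := fun c => 1 / c) ?_ (by simpa using tendsto_inv_atTop_zero)
  filter_upwards [eventually_gt_atTop 0] with c hc
  simpa using gaussSum_le_factorial_div hc le_rfl

/-! ### The rescaled heat trace of a path -/

/-- Quadratic lower bound for `1 - cos` on `[-π, π]`. It bounds the trace by a geometric series that
depends only on `t / n ^ 2`. -/
theorem four_mul_sq_le_two_sub_cos {n k : ℕ} (hn : 1 ≤ n) (hk : k ≤ n) :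
    4 * ((k : ℝ) / n) ^ 2 ≤ 2 - 2 * cos (π * k / n) := by
  have hn0 : (0 : ℝ) < n := by exact_mod_cast hn
  have h1 : (k : ℝ) / n ≤ 1 := by rw [div_le_one hn0]; exact_mod_cast hk
  have h := cos_le_one_sub_mul_cos_sq (x := π * (k / n)) (by
    rw [abs_of_nonneg (by positivity)]; exact mul_le_of_le_one_right pi_pos.le h1)
  rw [mul_div_assoc]
  have e : 2 / π ^ 2 * (π * (k / n)) ^ 2 = 2 * ((k : ℝ) / n) ^ 2 := by field_simp
  linarith

/-- A range of summation independent of `n`, as dominated convergence requires. -/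
theorem pathTheta_eq_tsum (n : ℕ) (t : ℝ) :
    pathTheta n t = ∑' k : ℕ, if k + 1 < n then
      exp (-(2 - 2 * cos (π * ((k : ℝ) + 1) / n)) * t) else 0 := by
  rw [tsum_eq_sum (s := range (n - 1))]
  · rw [pathTheta, sum_Ico_eq_sum_range]
    refine sum_congr rfl fun k hk => ?_
    rw [if_pos (by have := mem_range.1 hk; lia)]
    push_cast
    rw [add_comm (1 : ℝ)]
  · intro k hk
    rw [if_neg (by simp only [mem_range] at hk; lia)]

theorem ite_exp_le {n : ℕ} {t : ℝ} (ht : 0 ≤ t) (k : ℕ) :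
    (if k + 1 < n then exp (-(2 - 2 * cos (π * ((k : ℝ) + 1) / n)) * t) else 0) ≤
      exp (-(4 * t / n ^ 2) * ((k : ℝ) + 1)) := by
  split_ifs with h
  · refine le_trans ?_ (exp_neg_mul_sq_le (by positivity) k)
    rw [exp_le_exp]
    have := mul_le_mul_of_nonneg_right
      (four_mul_sq_le_two_sub_cos (n := n) (k := k + 1) (by lia) h.le) ht
    push_cast at this
    have e : 4 * t / (n : ℝ) ^ 2 * ((k : ℝ) + 1) ^ 2 = 4 * (((k : ℝ) + 1) / n) ^ 2 * t := by
      field_simp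
    linarith
  · exact (exp_pos _).le

theorem pathTheta_le {n : ℕ} (hn : 1 ≤ n) {t : ℝ} (ht : 0 < t) :
    pathTheta n t ≤ 1 / (exp (4 * t / n ^ 2) - 1) := by
  have h := hasSum_exp_neg_mul_add_one (c := 4 * t / n ^ 2) (by positivity)
  rw [pathTheta_eq_tsum]
  refine hasSum_le (ite_exp_le ht.le) (Summable.hasSum ?_) h
  refine Summable.of_nonneg_of_le (fun k => ?_) (ite_exp_le ht.le) h.summable
  split_ifs
  exacts [(exp_pos _).le, le_rfl]

theorem pathTheta_le_natCast (n : ℕ) {t : ℝ} (ht : 0 ≤ t) : pathTheta n t ≤ n := by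
  calc pathTheta n t ≤ ∑ k ∈ Ico 1 n, (1 : ℝ) := by
        refine sum_le_sum fun k _ => exp_le_one_iff.2 ?_
        have := mul_nonneg (sub_nonneg.2 (cos_le_one (π * k / n))) ht
        linarith
    _ ≤ n := by simp

theorem tendsto_mul_sq_two_sub_cos {n : ℝ → ℕ} {a : ℝ} (ha : 0 < a)
    (hn : Tendsto (fun u : ℝ => (n u : ℝ) / u) atTop (𝓝 a)) (k : ℝ) :
    Tendsto (fun u => (2 - 2 * cos (π * k / n u)) * u ^ 2) atTop (𝓝 ((π * k / a) ^ 2)) := by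
  have hq : Tendsto (fun u : ℝ => u / n u) atTop (𝓝 a⁻¹) := by
    simpa using hn.inv₀ ha.ne'
  have hx : Tendsto (fun u : ℝ => π * k / (2 * n u)) atTop (𝓝 0) := by
    have h := (hq.mul tendsto_inv_atTop_zero).const_mul (π * k / 2)
    rw [mul_zero, mul_zero] at h
    refine h.congr' ?_
    filter_upwards [eventually_gt_atTop 0] with u hu
    field_simp
  -- By the half-angle formula, `2 - 2 cos x = (x sinc (x / 2)) ^ 2`.
  have hs : Tendsto (fun u : ℝ => sinc (π * k / (2 * n u))) atTop (𝓝 1) := by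
    have := (continuous_sinc.tendsto 0).comp hx
    rwa [sinc_zero] at this
  have h := (((hq.const_mul (π * k)).mul hs).pow 2)
  rw [mul_one, ← div_eq_mul_inv] at h
  refine h.congr fun u => ?_
  rcases eq_or_ne (π * k / (2 * n u)) 0 with h0 | h0
  · have h1 : π * k / n u = 0 := by
      rw [show π * k / n u = 2 * (π * k / (2 * n u)) by field_simp, h0, mul_zero]
    have h2 : π * k * (u / n u) = 0 := by
      rw [show π * k * (u / n u) = π * k / n u * u by ring, h1, zero_mul]
    rw [h1, h2]; simp
  · have hn0 : (n u : ℝ) ≠ 0 := by intro h; simp [h] at h0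
    rw [sinc_of_ne_zero h0]
    have h1 : cos (π * k / n u) = 1 - 2 * sin (π * k / (2 * n u)) ^ 2 := by
      rw [show π * k / n u = 2 * (π * k / (2 * n u)) by field_simp, cos_two_mul, cos_sq']
      ring
    have hpk : π * k ≠ 0 := by intro h; simp [h] at h0
    rw [h1]
    have : k ≠ 0 := right_ne_zero_of_mul hpk
    field_simp
    ring

/-- Dominated convergence over wave numbers: each lattice eigenvalue times `u ^ 2` tends to `(π k /
a) ^ 2`, and eventually `n u ≤ 2 a u` gives the geometric majorant with rate `τ / a ^ 2`. -/
theorem tendsto_pathTheta {n : ℝ → ℕ} {a : ℝ} (ha : 0 < a)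
    (hn : Tendsto (fun u : ℝ => (n u : ℝ) / u) atTop (𝓝 a)) {τ : ℝ} (hτ : 0 < τ) :
    Tendsto (fun u => pathTheta (n u) (u ^ 2 * τ)) atTop (𝓝 (intervalHeat a τ)) := by
  simp only [pathTheta_eq_tsum, intervalHeat, gaussSum]
  have hc : 0 < τ / a ^ 2 := by positivity
  refine tendsto_tsum_of_dominated_convergence (hasSum_exp_neg_mul_add_one hc).summable ?_ ?_
  · intro k
    have hlim : Tendsto (fun u => exp (-(2 - 2 * cos (π * ((k : ℝ) + 1) / n u)) * (u ^ 2 * τ)))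
        atTop (𝓝 (exp (-((π / a) ^ 2 * τ) * ((k : ℝ) + 1) ^ 2))) := by
      have h := ((tendsto_mul_sq_two_sub_cos ha hn (k + 1)).mul_const τ).neg.rexp
      convert h using 2
      · ring_nf
      · ring_nf
    refine hlim.congr' ?_
    have h1 : Tendsto (fun u : ℝ => (n u : ℝ)) atTop atTop := by
      have := hn.pos_mul_atTop ha tendsto_id
      refine this.congr' ?_
      filter_upwards [eventually_gt_atTop 0] with u hu
      simp only [id]; field_simp
    filter_upwards [h1.eventually_gt_atTop ((k + 1 : ℕ) : ℝ)] with u hu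
    rw [if_pos (by exact_mod_cast hu)]
  · filter_upwards [hn.eventually_lt_const (by linarith : a < 2 * a),
      hn.eventually_const_lt ha, eventually_gt_atTop 0] with u h1 h0 hu k
    have hn0 : (0 : ℝ) < n u := by
      have := mul_pos h0 hu
      rwa [div_mul_cancel₀ _ hu.ne'] at this
    have hnonneg : 0 ≤ (if k + 1 < n u then
        exp (-(2 - 2 * cos (π * ((k : ℝ) + 1) / n u)) * (u ^ 2 * τ)) else 0) := by
      split_ifs
      exacts [(exp_pos _).le, le_rfl]
    rw [norm_of_nonneg hnonneg]
    refine (ite_exp_le (by positivity) k).trans ?_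
    rw [exp_le_exp]
    have h2 : τ / a ^ 2 ≤ 4 * (u ^ 2 * τ) / n u ^ 2 := by
      rw [div_lt_iff₀ hu] at h1
      rw [div_le_div_iff₀ (by positivity) (by positivity)]
      have : (n u : ℝ) ^ 2 ≤ (2 * a * u) ^ 2 := by gcongr
      nlinarith
    nlinarith [mul_le_mul_of_nonneg_right h2 (by positivity : (0 : ℝ) ≤ k + 1)]

/-- The radius is `1 + u⁻¹`: then `t (r + r⁻¹ - 2)` stays at most `1` while `r ^ (2n)` is at least
`e^{n/u}`. -/
theorem pathTheta_sub_pathMain_le_exp {n : ℕ} (hn : 1 ≤ n) {u : ℝ} (hu : 1 ≤ u) :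
    pathTheta n (u ^ 2) - pathMain n (u ^ 2) ≤
      exp (1 - n / u) * (2 + 2 * pathTheta n (u ^ 2)) := by
  have hu0 : 0 < u := by linarith
  have hx1 : u⁻¹ ≤ 1 := inv_le_one_of_one_le₀ hu
  have hx0 : 0 < u⁻¹ := inv_pos.2 hu0
  have h := pathTheta_sub_pathMain_le hn (t := u ^ 2) (r := 1 + u⁻¹) (by positivity) (by linarith)
  have hθ := pathTheta_nonneg n (u ^ 2)
  have h1 : ((1 + u⁻¹) ^ (2 * n))⁻¹ ≤ exp (-(n / u)) := by
    rw [exp_neg]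
    apply inv_anti₀ (exp_pos _)
    rw [pow_mul, div_eq_mul_inv, exp_nat_mul]
    refine pow_le_pow_left₀ (exp_pos _).le ?_ n
    -- For `0 < x ≤ 1`, `e^x ≤ 1 + x + x² ≤ (1 + x)²`.
    have := abs_exp_sub_one_sub_id_le (x := u⁻¹) (by rwa [abs_of_pos hx0])
    nlinarith [(abs_le.1 this).2]
  have h2 : u ^ 2 * (1 + u⁻¹ + (1 + u⁻¹)⁻¹ - 2) ≤ 1 := by
    have : u ^ 2 * (1 + u⁻¹ + (1 + u⁻¹)⁻¹ - 2) = (1 + u⁻¹)⁻¹ := by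
      have : u + 1 ≠ 0 := by linarith
      field_simp
      ring
    rw [this]
    exact inv_le_one_of_one_le₀ (by linarith)
  have h3 : exp (-4 * u ^ 2) ≤ 1 := exp_le_one_iff.2 (by nlinarith)
  calc _ ≤ _ := h
    _ ≤ exp (-(n / u)) * exp 1 * (1 + 1 + 2 * pathTheta n (u ^ 2)) := by gcongr
    _ = _ := by rw [← exp_add]; ring_nf

/-- The radius is `2 / t`. Of the factor `(t / 2) ^ (2n)`, one power of `t` is kept for
integrability against `dt/t` and `4 ^ (-n)` for decay in `n`. -/
theorem pathTheta_sub_pathMain_le_of_le_one {n : ℕ} (hn : 1 ≤ n) {t : ℝ} (ht0 : 0 < t)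
    (ht1 : t ≤ 1) :
    pathTheta n t - pathMain n t ≤ t * (exp 3 * (4 ^ n)⁻¹ * (2 + 2 * n)) := by
  have h := pathTheta_sub_pathMain_le hn (t := t) (r := 2 / t) ht0.le
    (by rw [le_div_iff₀ ht0]; linarith)
  have hθ0 := pathTheta_nonneg n t
  have hθ := pathTheta_le_natCast n ht0.le
  have h1 : ((2 / t) ^ (2 * n))⁻¹ ≤ t * (4 ^ n)⁻¹ := by
    have : ((2 / t) ^ (2 * n))⁻¹ = t ^ (2 * n) * (4 ^ n)⁻¹ := by
      rw [div_pow, inv_div, pow_mul 2, div_eq_mul_inv]; norm_num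
    rw [this]
    gcongr
    calc t ^ (2 * n) ≤ t ^ 1 := pow_le_pow_of_le_one ht0.le ht1 (by lia)
      _ = t := pow_one t
  have h2 : t * (2 / t + (2 / t)⁻¹ - 2) ≤ 3 := by
    have : t * (2 / t + (2 / t)⁻¹ - 2) = 2 + t ^ 2 / 2 - 2 * t := by field_simp
    rw [this]; nlinarith
  have h3 : exp (-4 * t) ≤ 1 := exp_le_one_iff.2 (by linarith)
  calc _ ≤ _ := h
    _ ≤ t * (4 ^ n)⁻¹ * exp 3 * (1 + 1 + 2 * n) := by gcongr
    _ = _ := by ring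

/-! ### The heat kernel of `ℤ` for large time -/

/-- The classical `e^{-2t} I_0(2t) ~ 1 / (2 √(π t))`, here deduced from path traces. For a path with
about `A u` edges at time `u ^ 2`, `u * besselKernel (u ^ 2)` equals a trace quotient minus an
error. As `u → ∞` the quotient tends to `(1 + 2 * intervalHeat A 1) / (2 * A)`, which Poisson
summation sends to the constant as `A → ∞`, while the error is of order `e^{1 - A}`. -/
theorem tendsto_mul_besselKernel_sq :
    Tendsto (fun u => u * besselKernel (u ^ 2)) atTop (𝓝 (1 / (2 * √π))) := by
  set ℓ := 1 / (2 * √π) with hℓ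
  have hheat : ∀ A : ℝ, 0 < A →
      (1 + 2 * intervalHeat A 1) / (2 * A) = ℓ * (1 + 2 * gaussSum (A ^ 2)) := by
    intro A hA
    have h := one_add_two_mul_gaussSum (c := (π / A) ^ 2 * 1) (by positivity)
    rw [intervalHeat, h, hℓ]
    have e1 : π ^ 2 / ((π / A) ^ 2 * 1) = A ^ 2 := by field_simp
    have e2 : π / ((π / A) ^ 2 * 1) = A ^ 2 / π := by field_simp
    rw [e1, e2, sqrt_div (by positivity), sqrt_sq hA.le]
    field_simp
  have hsq : Tendsto (fun A : ℝ => gaussSum (A ^ 2)) atTop (𝓝 0) :=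
    tendsto_gaussSum_atTop.comp (tendsto_pow_atTop two_ne_zero)
  have hG : Tendsto (fun A : ℝ => (1 + 2 * intervalHeat A 1) / (2 * A)) atTop (𝓝 ℓ) := by
    have h := ((hsq.const_mul 2).const_add 1).const_mul ℓ
    simp only [mul_zero, add_zero, mul_one] at h
    refine h.congr' ?_
    filter_upwards [eventually_gt_atTop 0] with A hA using (hheat A hA).symm
  have hE : Tendsto (fun A : ℝ => 2 * (exp (1 - A) * (2 + 2 * intervalHeat A 1)) / (2 * A))
      atTop (𝓝 0) := by
    have h1 : Tendsto (fun A : ℝ => 1 / (2 * A) + (1 + 2 * intervalHeat A 1) / (2 * A)) atTop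
        (𝓝 (0 + ℓ)) := by
      refine Tendsto.add ?_ hG
      have := (tendsto_inv_atTop_zero (𝕜 := ℝ)).const_mul (1 / 2)
      rw [mul_zero] at this
      refine this.congr fun A => ?_
      rw [one_div, one_div, mul_inv]
    have h2 : Tendsto (fun A : ℝ => exp (1 - A)) atTop (𝓝 0) :=
      tendsto_exp_atBot.comp (tendsto_atBot_add_const_left _ 1 tendsto_neg_atTop_atBot)
    have h3 := (h2.mul h1).const_mul 2
    rw [zero_mul, mul_zero] at h3
    refine h3.congr fun A => ?_
    ring
  rw [Metric.tendsto_nhds]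
  intro ε hε
  -- `A` is fixed first so that both the Poisson correction and the limiting error are below `ε /
  -- 3`; only then does `u` grow.
  obtain ⟨A, hA0, hA1, hA2⟩ := ((eventually_gt_atTop 0).and
    (((Metric.tendsto_nhds.1 hG) (ε / 3) (by positivity)).and
      (hE.eventually_lt_const (show (0 : ℝ) < ε / 3 by positivity)))).exists
  have hfl : Tendsto (fun u : ℝ => ((⌊A * u⌋₊ : ℕ) : ℝ) / u) atTop (𝓝 A) :=
    tendsto_nat_floor_mul_div_atTop hA0.le
  have hth := tendsto_pathTheta hA0 hfl one_pos
  simp only [mul_one] at hth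
  have hexp : Tendsto (fun u : ℝ => exp (-4 * u ^ 2)) atTop (𝓝 0) := by
    refine tendsto_exp_atBot.comp ?_
    exact (tendsto_pow_atTop two_ne_zero).const_mul_atTop_of_neg (by norm_num)
  have hA2' : (2 * A) ≠ 0 := by positivity
  have t1 : Tendsto (fun u : ℝ => (1 + exp (-4 * u ^ 2) + 2 * pathTheta ⌊A * u⌋₊ (u ^ 2)) /
      (2 * ((⌊A * u⌋₊ : ℕ) / u))) atTop (𝓝 ((1 + 2 * intervalHeat A 1) / (2 * A))) := by
    have := ((hexp.const_add 1).add (hth.const_mul 2)).div (hfl.const_mul 2) hA2'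
    rw [add_zero] at this
    exact this
  have t2 : Tendsto (fun u : ℝ => 2 * (exp (1 - (⌊A * u⌋₊ : ℕ) / u) *
      (2 + 2 * pathTheta ⌊A * u⌋₊ (u ^ 2))) / (2 * ((⌊A * u⌋₊ : ℕ) / u))) atTop
      (𝓝 (2 * (exp (1 - A) * (2 + 2 * intervalHeat A 1)) / (2 * A))) :=
    (((hfl.const_sub 1).rexp.mul ((hth.const_mul 2).const_add 2)).const_mul 2).div
      (hfl.const_mul 2) hA2'
  filter_upwards [t2.eventually_lt_const hA2, (Metric.tendsto_nhds.1 t1) (ε / 3) (by positivity),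
    eventually_ge_atTop 1, hfl.eventually_const_lt hA0] with u h2 h1 hu hpos
  have hu0 : 0 < u := by linarith
  set m := ⌊A * u⌋₊ with hm
  have hm1 : 1 ≤ m := by
    rcases Nat.eq_zero_or_pos m with h | h
    · simp [h] at hpos
    · exact h
  have hq : (0 : ℝ) < 2 * ((m : ℝ) / u) := by positivity
  have b1 := pathTheta_sub_pathMain_le_exp hm1 hu
  have b0 := pathMain_le_pathTheta hm1 (t := u ^ 2) (by positivity)
  have key : u * besselKernel (u ^ 2) =
      (1 + exp (-4 * u ^ 2) + 2 * pathTheta m (u ^ 2)) / (2 * (m / u)) -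
        2 * (pathTheta m (u ^ 2) - pathMain m (u ^ 2)) / (2 * (m / u)) := by
    rw [← sub_div, eq_div_iff hq.ne', pathMain]
    field_simp
    ring
  have b2 : 2 * (pathTheta m (u ^ 2) - pathMain m (u ^ 2)) / (2 * (m / u)) < ε / 3 := by
    refine lt_of_le_of_lt ?_ h2
    gcongr
  have b3 : 0 ≤ 2 * (pathTheta m (u ^ 2) - pathMain m (u ^ 2)) / (2 * (m / u)) :=
    div_nonneg (by linarith) hq.le
  rw [dist_eq, abs_lt] at h1 hA1 ⊢
  rw [key]
  constructor <;> linarith [h1.1, h1.2, hA1.1, hA1.2]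

theorem tendsto_pathMain {n : ℝ → ℕ} {a : ℝ}
    (hn : Tendsto (fun u : ℝ => (n u : ℝ) / u) atTop (𝓝 a)) {τ : ℝ} (hτ : 0 < τ) :
    Tendsto (fun u => pathMain (n u) (u ^ 2 * τ)) atTop (𝓝 (a / (2 * √(π * τ)) - 1 / 2)) := by
  have hs : 0 < √τ := sqrt_pos.2 hτ
  have h1 : Tendsto (fun u : ℝ => u * √τ) atTop atTop := tendsto_id.atTop_mul_const hs
  have h2 := tendsto_mul_besselKernel_sq.comp h1
  have hexp : Tendsto (fun u : ℝ => exp (-4 * (u ^ 2 * τ))) atTop (𝓝 0) := by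
    refine tendsto_exp_atBot.comp ?_
    exact ((tendsto_pow_atTop two_ne_zero).atTop_mul_const hτ).const_mul_atTop_of_neg (by norm_num)
  have h3 := ((hexp.const_sub (-1)).div_const 2).add ((hn.mul h2).div_const √τ)
  have e : (-1 - 0) / 2 + a * (1 / (2 * √π)) / √τ = a / (2 * √(π * τ)) - 1 / 2 := by
    rw [sqrt_mul pi_pos.le]; field_simp; ring
  rw [e] at h3
  refine h3.congr' ?_
  filter_upwards [eventually_gt_atTop 0] with u hu
  simp only [Function.comp, pathMain, mul_pow, sq_sqrt hτ.le]
  field_simp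

end DirichletBox

end

noncomputable section

namespace DirichletBox

open Real Finset Filter Topology

/-! ### The spectrum of the discrete Dirichlet Laplacian -/

theorem sum_range_cos_mul_sub {m : ℕ} (hm : m ≠ 0) (p : ℕ × ℕ) :
    ∑ x ∈ range m, cos (2 * π * x / m * ((p.1 : ℝ) - p.2)) = m * dvdWeight m p := by
  have hm' : (m : ℂ) ≠ 0 := by exact_mod_cast hm
  have h := congrArg Complex.re
    (sum_pow_mul_inv_pow_of_isPrimitiveRoot hm (Complex.isPrimitiveRoot_exp m hm) p)
  rw [Complex.re_sum, ← Complex.ofReal_natCast, ← Complex.ofReal_mul, Complex.ofReal_re] at h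
  rw [← h]
  refine sum_congr rfl fun x _ => ?_
  rw [← Complex.exp_ofReal_mul_I_re]
  congr 1
  rw [← Complex.exp_nat_mul, ← Complex.exp_neg, ← Complex.exp_nat_mul, ← Complex.exp_nat_mul,
    ← Complex.exp_add]
  congr 1
  push_cast
  field_simp
  ring

/-- Discrete orthogonality: the sum over the path is half of a sum over the full `2n`-cycle, where
the cosines of `k - l` and `k + l` are filtered by divisibility by `2n`. -/
theorem sum_sin_mul_sin {n k l : ℕ} (hk : k ∈ Ico 1 n) (hl : l ∈ Ico 1 n) :
    ∑ x ∈ Ico 1 n, sin (π * x / n * k) * sin (π * x / n * l) = if k = l then (n : ℝ) / 2 else 0 := by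
  rw [mem_Ico] at hk hl
  have hn : 1 ≤ n := by lia
  have hn0 : (n : ℝ) ≠ 0 := by positivity
  -- The unfolding lemma needs a function of the cosine; Chebyshev polynomials express `sin (kθ) sin
  -- (lθ)` as one.
  set F : ℝ → ℝ := fun c => ((Polynomial.Chebyshev.T ℝ ((k : ℤ) - l)).eval c -
    (Polynomial.Chebyshev.T ℝ ((k : ℤ) + l)).eval c) / 2 with hF
  have hFc : ∀ θ : ℝ, F (cos θ) = (cos (θ * ((k : ℝ) - l)) - cos (θ * ((k : ℝ) + l))) / 2 := by
    intro θ
    simp only [hF, Polynomial.Chebyshev.T_real_cos]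
    push_cast
    rw [mul_comm θ, mul_comm θ]
  have hFs : ∀ θ : ℝ, F (cos θ) = sin (θ * k) * sin (θ * l) := by
    intro θ
    rw [hFc, mul_sub, mul_add, cos_sub, cos_add]
    ring
  have h1 : F 1 = 0 := by rw [← cos_zero, hFs]; simp
  have h2 : F (-1) = 0 := by
    rw [← cos_pi, hFs, mul_comm π, sin_nat_mul_pi, zero_mul]
  have h := sum_range_two_mul_cos F hn
  rw [h1, h2, zero_add, zero_add] at h
  have hd := sum_range_cos_mul_sub (m := 2 * n) (by lia) (k, l)
  have ha := sum_range_cos_mul_sub (m := 2 * n) (by lia) (k + l, 0)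
  have hleft : ∑ x ∈ range (2 * n), F (cos (π * x / n)) =
      ((2 * n : ℕ) * dvdWeight (2 * n) (k, l) - (2 * n : ℕ) * dvdWeight (2 * n) (k + l, 0)) / 2 := by
    rw [← hd, ← ha, ← sum_sub_distrib, sum_div]
    refine sum_congr rfl fun x _ => ?_
    rw [hFc, show 2 * π * x / ((2 * n : ℕ) : ℝ) = π * x / n by push_cast; field_simp]
    push_cast
    rw [sub_zero]
  have w2 : dvdWeight (2 * n) (k + l, 0) = 0 := by
    rw [dvdWeight, if_neg]
    rintro ⟨c, hc⟩
    push_cast at hc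
    have hc0 : 0 < c := by
      by_contra! hc'
      nlinarith
    have : c < 1 := by
      by_contra! hc'
      nlinarith
    lia
  have w1 : dvdWeight (2 * n) (k, l) = if k = l then 1 else 0 := by
    rw [dvdWeight]
    congr 1
    refine propext ⟨?_, fun h => by simp [h]⟩
    rintro ⟨c, hc⟩
    push_cast at hc
    have : c < 1 := by
      by_contra! hc'
      nlinarith
    have : -1 < c := by
      by_contra! hc'
      nlinarith
    have : c = 0 := by lia
    rw [this] at hc
    lia
  simp only [hFs] at h hleft
  rw [hleft, w1, w2] at h
  split_ifs at h ⊢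
  · push_cast at h; linarith
  · push_cast at h; linarith

/-! ### Diagonalisation of the lattice Laplacian -/

section

variable {d : ℕ} {n : Fin d → ℕ}

theorem map_univ_interiorVertex (n : Fin d → ℕ) :
    (univ : Finset (InteriorVertex n)).map
      ⟨fun x i => (x.1 i : ℕ), fun _ _ h => Subtype.ext (funext fun i => Fin.ext (congrFun h i))⟩ =
      Fintype.piFinset fun i => Ico 1 (n i) := by
  ext k
  simp only [Finset.mem_map, mem_univ, true_and, Fintype.mem_piFinset, mem_Ico]
  constructor
  · rintro ⟨x, rfl⟩ i
    have := x.2 i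
    simp only [Fin.lt_def, Fin.val_last, Fin.val_zero] at this
    exact this
  · intro h
    refine ⟨⟨fun i => ⟨k i, by have := h i; lia⟩, fun i => ?_⟩, rfl⟩
    have := h i
    simp only [Fin.lt_def, Fin.val_last, Fin.val_zero]
    exact this

theorem interiorVertex_mem_Ico (x : InteriorVertex n) (i : Fin d) : (x.1 i : ℕ) ∈ Ico 1 (n i) := by
  have := x.2 i
  simp only [Fin.lt_def, Fin.val_last, Fin.val_zero] at this
  rw [mem_Ico]
  exact this

theorem sum_interiorVertex (F : (Fin d → ℕ) → ℝ) :
    ∑ x : InteriorVertex n, F (fun i => (x.1 i : ℕ)) =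
      ∑ k ∈ Fintype.piFinset fun i => Ico 1 (n i), F k := by
  rw [← map_univ_interiorVertex, sum_map]; rfl

theorem prod_interiorVertex (F : (Fin d → ℕ) → ℝ) :
    ∏ x : InteriorVertex n, F (fun i => (x.1 i : ℕ)) =
      ∏ k ∈ Fintype.piFinset fun i => Ico 1 (n i), F k := by
  rw [← map_univ_interiorVertex, prod_map]; rfl

/-- The eigenvalue of the discrete Dirichlet Laplacian with wave numbers `k`. -/
def discreteEigenvalue (n k : Fin d → ℕ) : ℝ := ∑ i, (2 - 2 * cos (π * k i / n i))

/-- The eigenfunction of the discrete Dirichlet Laplacian with wave numbers `k`. -/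
def discreteEigenfunction (n k x : Fin d → ℕ) : ℝ := ∏ i, sin (π * x i / n i * k i)

/-- The two neighbours of an interior vertex in a given direction. -/
def shiftVertex (x : InteriorVertex n) (i : Fin d) (b : Bool) : (i : Fin d) → Fin (n i + 1) :=
  Function.update x.1 i (if b then ⟨x.1 i + 1, by
    have := mem_Ico.1 (interiorVertex_mem_Ico x i); lia⟩ else ⟨x.1 i - 1, by
    have := mem_Ico.1 (interiorVertex_mem_Ico x i); lia⟩)

theorem shiftVertex_self (x : InteriorVertex n) (i : Fin d) (b : Bool) :
    (shiftVertex x i b i : ℕ) = if b then (x.1 i : ℕ) + 1 else x.1 i - 1 := by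
  rw [shiftVertex, Function.update_self]
  split_ifs <;> rfl

theorem shiftVertex_of_ne (x : InteriorVertex n) {i j : Fin d} (h : j ≠ i) (b : Bool) :
    shiftVertex x i b j = x.1 j := by
  rw [shiftVertex, Function.update_of_ne h]

theorem sum_neighborFinset (x : InteriorVertex n) (f : ((i : Fin d) → Fin (n i + 1)) → ℝ) :
    ∑ y ∈ (latticeGraph n).neighborFinset x.1, f y =
      ∑ i, (f (shiftVertex x i true) + f (shiftVertex x i false)) := by
  have h1 : ∀ i, f (shiftVertex x i true) + f (shiftVertex x i false) =
      ∑ b : Bool, f (shiftVertex x i b) := fun i => by simp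
  rw [sum_congr rfl fun i _ => h1 i, ← sum_product']
  symm
  have hx := fun i => mem_Ico.1 (interiorVertex_mem_Ico x i)
  refine sum_bij (fun p _ => shiftVertex x p.1 p.2) ?_ ?_ ?_ (fun _ _ => rfl)
  · rintro ⟨i, b⟩ -
    rw [SimpleGraph.mem_neighborFinset]
    refine ⟨i, ?_, fun j hj => (shiftVertex_of_ne x hj b).symm⟩
    rw [SimpleGraph.pathGraph_adj, shiftVertex_self]
    have := hx i
    cases b <;> simp; lia
  · rintro ⟨i, b⟩ - ⟨j, c⟩ - h
    have hxi := hx i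
    have e : (shiftVertex x i b i : ℕ) = shiftVertex x j c i := by
      simp only at h; rw [h]
    have hij : i = j := by
      by_contra hne
      rw [shiftVertex_self, shiftVertex_of_ne x hne] at e
      split_ifs at e <;> lia
    subst hij
    rw [shiftVertex_self, shiftVertex_self] at e
    cases b <;> cases c <;> simp at e ⊢; lia
  · intro y hy
    rw [SimpleGraph.mem_neighborFinset] at hy
    obtain ⟨i, hi, hne⟩ := hy
    rw [SimpleGraph.pathGraph_adj] at hi
    rcases hi with hi | hi
    · refine ⟨(i, true), by simp, funext fun j => Fin.ext ?_⟩
      rcases eq_or_ne j i with rfl | hj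
      · rw [shiftVertex_self]; simp; lia
      · rw [shiftVertex_of_ne x hj, hne j hj]
    · refine ⟨(i, false), by simp, funext fun j => Fin.ext ?_⟩
      rcases eq_or_ne j i with rfl | hj
      · rw [shiftVertex_self]; simp; lia
      · rw [shiftVertex_of_ne x hj, hne j hj]

theorem discreteEigenfunction_shiftVertex_add (x : InteriorVertex n) (k : Fin d → ℕ) (i : Fin d) :
    discreteEigenfunction n k (fun j => shiftVertex x i true j) +
      discreteEigenfunction n k (fun j => shiftVertex x i false j) =
      2 * cos (π * k i / n i) * discreteEigenfunction n k (fun j => x.1 j) := by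
  have hx := mem_Ico.1 (interiorVertex_mem_Ico x i)
  have h : ∀ b, discreteEigenfunction n k (fun j => shiftVertex x i b j) =
      sin (π * (shiftVertex x i b i : ℕ) / n i * k i) *
        ∏ j ∈ univ.erase i, sin (π * (x.1 j : ℕ) / n j * k j) := by
    intro b
    rw [discreteEigenfunction, ← mul_prod_erase univ _ (mem_univ i)]
    congr 1
    refine prod_congr rfl fun j hj => ?_
    rw [shiftVertex_of_ne x (ne_of_mem_erase hj)]
  rw [h, h, discreteEigenfunction, ← mul_prod_erase univ _ (mem_univ i), shiftVertex_self,
    shiftVertex_self, if_pos rfl, if_neg (by simp), Nat.cast_sub hx.1]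
  have e1 : π * (((x.1 i : ℕ) + 1 : ℕ) : ℝ) / n i * k i =
      π * (x.1 i : ℕ) / n i * k i + π * k i / n i := by push_cast; ring
  have e2 : π * (((x.1 i : ℕ) : ℝ) - (1 : ℕ)) / n i * k i =
      π * (x.1 i : ℕ) / n i * k i - π * k i / n i := by push_cast; ring
  rw [e1, e2, sin_add, sin_sub]
  ring

theorem discreteEigenfunction_eq_zero (hn : ∀ i, 1 ≤ n i) (k : Fin d → ℕ)
    {x : (i : Fin d) → Fin (n i + 1)} (hx : ¬ ∀ i, 0 < x i ∧ x i < Fin.last (n i)) :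
    discreteEigenfunction n k (fun i => x i) = 0 := by
  push Not at hx
  obtain ⟨i, hi⟩ := hx
  refine prod_eq_zero (mem_univ i) ?_
  have hn0 : (n i : ℝ) ≠ 0 := by have := hn i; positivity
  beta_reduce
  rcases eq_or_ne (x i) 0 with h | h
  · rw [h]; simp
  · have h2 : x i = Fin.last (n i) :=
      le_antisymm (Fin.le_last _) (hi (Fin.pos_iff_ne_zero.2 h))
    rw [h2, Fin.val_last, mul_div_assoc, div_self hn0, mul_one, mul_comm, sin_nat_mul_pi]

/-- The sine products vanish on the boundary, so the truncated matrix acts on them like the full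
graph Laplacian; the addition formula in each direction then gives the eigenvalue. -/
theorem discreteDirichletLaplacian_mulVec (hn : ∀ i, 1 ≤ n i) (k : Fin d → ℕ)
    (x : InteriorVertex n) :
    ∑ y : InteriorVertex n, discreteDirichletLaplacian n x y *
      discreteEigenfunction n k (fun i => y.1 i) =
      discreteEigenvalue n k * discreteEigenfunction n k (fun i => x.1 i) := by
  have h1 : ∑ y : InteriorVertex n, discreteDirichletLaplacian n x y *
      discreteEigenfunction n k (fun i => y.1 i) =
      Matrix.mulVec ((latticeGraph n).lapMatrix ℝ)
        (fun y => discreteEigenfunction n k (fun i => y i)) x.1 := by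
    rw [Matrix.mulVec, dotProduct]
    rw [← Fintype.sum_subtype_add_sum_subtype (fun y : (i : Fin d) → Fin (n i + 1) =>
      ∀ i, 0 < y i ∧ y i < Fin.last (n i))]
    refine (add_eq_left.2 (sum_eq_zero fun y _ => ?_)).symm
    rw [discreteEigenfunction_eq_zero hn k y.2, mul_zero]
  have hdeg : ((latticeGraph n).degree x.1 : ℝ) = ∑ _i : Fin d, (1 + 1 : ℝ) := by
    rw [← sum_neighborFinset x fun _ => 1]; simp
  rw [h1, SimpleGraph.lapMatrix_mulVec_apply, sum_neighborFinset, hdeg, discreteEigenvalue, sum_mul,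
    sum_mul, ← sum_sub_distrib]
  refine sum_congr rfl fun i _ => ?_
  rw [discreteEigenfunction_shiftVertex_add]
  ring

/-- The matrix `S` of eigenfunctions is invertible because orthogonality makes `Sᵀ S` a nonzero
scalar matrix, so the determinant is cancelled out of `Δ S = S D`. -/
theorem det_discreteDirichletLaplacian (hn : ∀ i, 1 ≤ n i) :
    (discreteDirichletLaplacian n).det =
      ∏ k ∈ Fintype.piFinset fun i => Ico 1 (n i), discreteEigenvalue n k := by
  set S : Matrix (InteriorVertex n) (InteriorVertex n) ℝ :=
    Matrix.of fun x k => discreteEigenfunction n (fun i => k.1 i) (fun i => x.1 i) with hS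
  set D : InteriorVertex n → ℝ := fun k => discreteEigenvalue n (fun i => k.1 i) with hD
  have h1 : discreteDirichletLaplacian n * S = S * Matrix.diagonal D := by
    ext x k
    rw [Matrix.mul_apply, Matrix.mul_diagonal]
    simp only [hS, Matrix.of_apply, hD]
    rw [discreteDirichletLaplacian_mulVec hn, mul_comm]
  have h2 : S.transpose * S = Matrix.diagonal fun _ => ∏ i, (n i : ℝ) / 2 := by
    ext k l
    rw [Matrix.mul_apply]
    simp only [hS, Matrix.of_apply, Matrix.transpose_apply, discreteEigenfunction]
    simp only [← prod_mul_distrib]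
    rw [sum_interiorVertex (n := n) fun x => ∏ i, (sin (π * x i / n i * (k.1 i : ℕ)) *
      sin (π * x i / n i * (l.1 i : ℕ))),
      ← prod_univ_sum (fun i => Ico 1 (n i)) fun i x => sin (π * x / n i * (k.1 i : ℕ)) *
      sin (π * x / n i * (l.1 i : ℕ)),
      prod_congr rfl fun i _ => sum_sin_mul_sin (interiorVertex_mem_Ico k i)
        (interiorVertex_mem_Ico l i), Matrix.diagonal_apply]
    split_ifs with hkl
    · subst hkl; simp
    · obtain ⟨i, hi⟩ : ∃ i, k.1 i ≠ l.1 i := by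
        by_contra! h; exact hkl (Subtype.ext (funext h))
      exact prod_eq_zero (mem_univ i) (if_neg fun h => hi (Fin.ext h))
  have hS0 : S.det ≠ 0 := by
    intro h0
    have h3 := congrArg Matrix.det h2
    rw [Matrix.det_mul, h0, mul_zero, Matrix.det_diagonal] at h3
    refine prod_ne_zero_iff.2 (fun _ _ => prod_ne_zero_iff.2 fun i _ => ?_) h3.symm
    have := hn i
    positivity
  have h4 := congrArg Matrix.det h1
  rw [Matrix.det_mul, Matrix.det_mul, mul_comm S.det, Matrix.det_diagonal] at h4
  rw [mul_right_cancel₀ hS0 h4, hD, prod_interiorVertex (n := n) (discreteEigenvalue n)]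

theorem discreteEigenvalue_pos (hd : 1 ≤ d) {k : Fin d → ℕ}
    (hk : k ∈ Fintype.piFinset fun i => Ico 1 (n i)) : 0 < discreteEigenvalue n k := by
  have : Nonempty (Fin d) := ⟨⟨0, hd⟩⟩
  refine sum_pos (fun i _ => ?_) univ_nonempty
  have h := mem_Ico.1 (Fintype.mem_piFinset.1 hk i)
  have h1 := four_mul_sq_le_two_sub_cos (n := n i) (k := k i) (by lia) h.2.le
  have : (0 : ℝ) < k i := by exact_mod_cast h.1
  have : (0 : ℝ) < n i := by exact_mod_cast (by lia : 0 < n i)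
  have : 0 < 4 * ((k i : ℝ) / n i) ^ 2 := by positivity
  linarith

theorem sum_exp_discreteEigenvalue (n : Fin d → ℕ) (t : ℝ) :
    ∑ k ∈ Fintype.piFinset fun i => Ico 1 (n i), exp (-discreteEigenvalue n k * t) =
      ∏ i, pathTheta (n i) t := by
  simp only [pathTheta, prod_univ_sum]
  refine sum_congr rfl fun k _ => ?_
  rw [discreteEigenvalue, ← exp_sum, ← sum_neg_distrib, sum_mul]

end

end DirichletBox

end

noncomputable section

namespace DirichletBox

open Real Finset Filter Topology MeasureTheory

/-! ### The spectrum of the continuous Dirichlet Laplacian -/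

section

variable {d : ℕ}

/-- The product `∏ sin (π k_i x_i / a_i)`. -/
def sineMode (a : Fin d → ℝ) (k : Fin d → ℤ) (x : Fin d → ℝ) : ℝ := ∏ i, sin (π * k i / a i * x i)

/-- The `i`-th partial derivative of `sineMode a k`. -/
def sineModeDeriv (a : Fin d → ℝ) (k : Fin d → ℤ) (i : Fin d) (x : Fin d → ℝ) : ℝ :=
  π * k i / a i * cos (π * k i / a i * x i) * ∏ j ∈ univ.erase i, sin (π * k j / a j * x j)

/-- The eigenvalue of `sineMode a k`. -/
def boxEigenvalue (a : Fin d → ℝ) (k : Fin d → ℤ) : ℝ := ∑ i, (π * k i / a i) ^ 2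

/-- The sine coefficients of a function on the box. -/
def sineCoeff (a : Fin d → ℝ) (k : Fin d → ℤ) (f : EuclideanSpace ℝ (Fin d) → ℝ) : ℝ :=
  ∫ x in Set.Icc 0 a, f (WithLp.toLp 2 x) * sineMode a k x

theorem toLp_mem_closedBox {a x : Fin d → ℝ} : WithLp.toLp 2 x ∈ closedBox a ↔ x ∈ Set.Icc 0 a := by
  simp only [closedBox, Set.mem_ofPred_eq, Set.mem_Icc, Pi.le_def, Pi.zero_apply, forall_and]

theorem continuous_sineMode (a : Fin d → ℝ) (k : Fin d → ℤ) : Continuous (sineMode a k) := by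
  unfold sineMode; fun_prop

theorem contDiff_sineMode (a : Fin d → ℝ) (k : Fin d → ℤ) {n : WithTop ℕ∞} :
    ContDiff ℝ n fun y : EuclideanSpace ℝ (Fin d) => sineMode a k y.ofLp := by
  unfold sineMode; fun_prop

theorem contDiff_sineModeDeriv (a : Fin d → ℝ) (k : Fin d → ℤ) (i : Fin d) {n : WithTop ℕ∞} :
    ContDiff ℝ n fun y : EuclideanSpace ℝ (Fin d) => sineModeDeriv a k i y.ofLp := by
  unfold sineModeDeriv; fun_prop

theorem hasLineDerivAt_mul_prod_erase (a : Fin d → ℝ) (k : Fin d → ℤ) (i : Fin d) {g : ℝ → ℝ}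
    {g' : ℝ} {y : EuclideanSpace ℝ (Fin d)} (hg : HasDerivAt g g' (y i)) :
    HasLineDerivAt ℝ (fun y : EuclideanSpace ℝ (Fin d) =>
      g (y i) * ∏ j ∈ univ.erase i, sin (π * k j / a j * y j))
      (g' * ∏ j ∈ univ.erase i, sin (π * k j / a j * y j)) y (EuclideanSpace.single i 1) := by
  rw [HasLineDerivAt]
  have h : HasDerivAt (fun t : ℝ => g (y i + t)) g' 0 :=
    HasDerivAt.comp_const_add (y i) 0 (by rwa [add_zero])
  refine (h.mul_const _).congr_of_eventuallyEq (Eventually.of_forall fun t => ?_)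
  simp only [PiLp.add_apply, PiLp.smul_apply, PiLp.single_apply, if_true, smul_eq_mul,
    mul_one]
  congr 1
  refine prod_congr rfl fun j hj => ?_
  rw [if_neg (ne_of_mem_erase hj), mul_zero, add_zero]

theorem sineMode_eq_mul_prod_erase (a : Fin d → ℝ) (k : Fin d → ℤ) (i : Fin d) (x : Fin d → ℝ) :
    sineMode a k x = sin (π * k i / a i * x i) * ∏ j ∈ univ.erase i, sin (π * k j / a j * x j) :=
  (mul_prod_erase univ _ (mem_univ i)).symm

theorem fderiv_sineMode (a : Fin d → ℝ) (k : Fin d → ℤ) (i : Fin d) (y : EuclideanSpace ℝ (Fin d)) :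
    fderiv ℝ (fun y : EuclideanSpace ℝ (Fin d) => sineMode a k y.ofLp) y (EuclideanSpace.single i 1)
      = sineModeDeriv a k i y.ofLp := by
  have hd : DifferentiableAt ℝ (fun y : EuclideanSpace ℝ (Fin d) => sineMode a k y.ofLp) y :=
    (contDiff_sineMode a k (n := 1)).differentiable one_ne_zero y
  rw [← hd.lineDeriv_eq_fderiv]
  simp only [sineMode_eq_mul_prod_erase a k i]
  refine (hasLineDerivAt_mul_prod_erase a k i
    (((hasDerivAt_id (y i)).const_mul (π * k i / a i)).sin)).lineDeriv.trans ?_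
  simp only [sineModeDeriv, id]
  ring

theorem fderiv_sineModeDeriv (a : Fin d → ℝ) (k : Fin d → ℤ) (i : Fin d)
    (y : EuclideanSpace ℝ (Fin d)) :
    fderiv ℝ (fun y : EuclideanSpace ℝ (Fin d) => sineModeDeriv a k i y.ofLp) y
      (EuclideanSpace.single i 1) = -((π * k i / a i) ^ 2 * sineMode a k y.ofLp) := by
  have hd : DifferentiableAt ℝ (fun y : EuclideanSpace ℝ (Fin d) => sineModeDeriv a k i y.ofLp) y :=
    (contDiff_sineModeDeriv a k i (n := 1)).differentiable one_ne_zero y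
  rw [← hd.lineDeriv_eq_fderiv]
  refine (hasLineDerivAt_mul_prod_erase a k i (g := fun s => π * k i / a i *
    cos (π * k i / a i * s)) ((((hasDerivAt_id (y i)).const_mul (π * k i / a i)).cos).const_mul
    (π * k i / a i))).lineDeriv.trans ?_
  rw [sineMode_eq_mul_prod_erase a k i]
  simp only [id]
  ring

theorem laplacian_eq_sum (f : EuclideanSpace ℝ (Fin d) → ℝ) {y : EuclideanSpace ℝ (Fin d)}
    (hf : ContDiffAt ℝ 2 f y) :
    Laplacian.laplacian f y = ∑ i, fderiv ℝ (fun z => fderiv ℝ f z (EuclideanSpace.single i 1)) y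
      (EuclideanSpace.single i 1) := by
  rw [InnerProductSpace.laplacian_eq_iteratedFDeriv_orthonormalBasis f
    (EuclideanSpace.basisFun (Fin d) ℝ)]
  refine sum_congr rfl fun i _ => ?_
  have hd : DifferentiableAt ℝ (fderiv ℝ f) y :=
    (hf.fderiv_right (m := 1) le_rfl).differentiableAt one_ne_zero
  rw [iteratedFDeriv_two_apply, fderiv_clm_apply hd (differentiableAt_const _)]
  simp

theorem laplacian_sineMode (a : Fin d → ℝ) (k : Fin d → ℤ) (y : EuclideanSpace ℝ (Fin d)) :
    Laplacian.laplacian (fun y : EuclideanSpace ℝ (Fin d) => sineMode a k y.ofLp) y =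
      -(boxEigenvalue a k * sineMode a k y.ofLp) := by
  rw [laplacian_eq_sum _ (contDiff_sineMode a k).contDiffAt]
  simp only [fderiv_sineMode, fderiv_sineModeDeriv]
  rw [boxEigenvalue, sum_neg_distrib, sum_mul]

theorem sineMode_eq_zero {a : Fin d → ℝ} (ha : ∀ i, 0 < a i) (k : Fin d → ℤ) {x : Fin d → ℝ}
    (i : Fin d) (hi : x i = 0 ∨ x i = a i) : sineMode a k x = 0 := by
  refine prod_eq_zero (mem_univ i) ?_
  rcases hi with h | h
  · rw [h, mul_zero, sin_zero]
  · rw [h, div_mul_cancel₀ _ (ha i).ne', mul_comm, sin_int_mul_pi]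

theorem convex_closedBox (a : Fin d → ℝ) : Convex ℝ (closedBox a) := by
  intro x hx y hy s t hs ht hst i
  simp only [PiLp.add_apply, PiLp.smul_apply, smul_eq_mul]
  have h1 := hx i
  have h2 := hy i
  constructor
  · exact add_nonneg (mul_nonneg hs h1.1) (mul_nonneg ht h2.1)
  · calc s * x i + t * y i ≤ s * a i + t * a i :=
        add_le_add (mul_le_mul_of_nonneg_left h1.2 hs) (mul_le_mul_of_nonneg_left h2.2 ht)
      _ = a i := by rw [← add_mul, hst, one_mul]

theorem openBox_subset_interior (a : Fin d → ℝ) : openBox a ⊆ interior (closedBox a) :=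
  interior_maximal (fun _ hx i => ⟨(hx i).1.le, (hx i).2.le⟩) (isOpen_openBox a)

theorem uniqueDiffOn_closedBox {a : Fin d → ℝ} (ha : ∀ i, 0 < a i) :
    UniqueDiffOn ℝ (closedBox a) := by
  refine uniqueDiffOn_convex (convex_closedBox a) ⟨WithLp.toLp 2 fun i => a i / 2, ?_⟩
  refine openBox_subset_interior a fun i => ?_
  have := ha i
  exact ⟨by simpa using this, by simpa using this⟩

theorem integrableOn_mul_sineMode {a : Fin d → ℝ} {f : EuclideanSpace ℝ (Fin d) → ℝ}
    (hf : ContinuousOn f (closedBox a)) (k : Fin d → ℤ) :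
    IntegrableOn (fun x => f (WithLp.toLp 2 x) * sineMode a k x) (Set.Icc 0 a) := by
  refine ContinuousOn.integrableOn_compact isCompact_Icc ?_
  refine ContinuousOn.mul ?_ (continuous_sineMode a k).continuousOn
  exact hf.comp (PiLp.continuous_toLp 2 _).continuousOn fun x hx => toLp_mem_closedBox.2 hx

theorem not_mem_openBox_of_face {a x : Fin d → ℝ} (i : Fin d) (hi : x i = 0 ∨ x i = a i) :
    WithLp.toLp 2 x ∉ openBox a := by
  intro h
  have := h i
  simp only at this
  rcases hi with hi | hi <;> rw [hi] at this <;> simp at this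

/-- Green's identity: the field `φ ∇f - f ∇φ`, with `φ` a sine mode, has divergence `(λ_k - μ) f φ`
and no flux through the faces, where `f` and `φ` both vanish. Hence an eigenfunction has sine
coefficients only at its own eigenvalue. -/
theorem sub_mul_sineCoeff_eq_zero {m : ℕ} {a : Fin (m + 1) → ℝ} (ha : ∀ i, 0 < a i) {μ : ℝ}
    {f : EuclideanSpace ℝ (Fin (m + 1)) → ℝ} (hf : f ∈ dirichletEigenspace a μ)
    (k : Fin (m + 1) → ℤ) : (boxEigenvalue a k - μ) * sineCoeff a k f = 0 := by
  obtain ⟨hsm, hzero, heig⟩ := hf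
  set e : Fin (m + 1) → EuclideanSpace ℝ (Fin (m + 1)) := fun i => EuclideanSpace.single i 1 with he
  -- The derivative within the closed box is used because the extension of `f` by zero need not be
  -- differentiable at the boundary.
  set H : Fin (m + 1) → EuclideanSpace ℝ (Fin (m + 1)) → ℝ := fun i y =>
    sineMode a k y.ofLp * fderivWithin ℝ f (closedBox a) y (e i) -
      f y * sineModeDeriv a k i y.ofLp with hH
  have hud := uniqueDiffOn_closedBox ha
  have hD : ContDiffOn ℝ 1 (fderivWithin ℝ f (closedBox a)) (closedBox a) :=
    hsm.fderivWithin hud (by rw [one_add_one_eq_two]; exact WithTop.coe_le_coe.2 le_top)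
  have hHc : ∀ i, ContDiffOn ℝ 1 (H i) (closedBox a) := by
    intro i
    refine ContDiffOn.sub ?_ ?_
    · exact (contDiff_sineMode a k).contDiffOn.mul (hD.clm_apply contDiffOn_const)
    · exact (hsm.of_le (by exact_mod_cast le_top)).mul (contDiff_sineModeDeriv a k i).contDiffOn
  have hmaps : Set.MapsTo (WithLp.toLp 2) (Set.Icc 0 a) (closedBox a) :=
    fun x hx => toLp_mem_closedBox.2 hx
  have hopen : ∀ x ∈ (Set.univ.pi fun i => Set.Ioo ((0 : Fin (m + 1) → ℝ) i) (a i)),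
      WithLp.toLp 2 x ∈ openBox a := by
    intro x hx i
    exact hx i (Set.mem_univ i)
  have hnhds : ∀ y ∈ openBox a, closedBox a ∈ 𝓝 y := fun y hy =>
    mem_interior_iff_mem_nhds.1 (openBox_subset_interior a hy)
  have hdiff : ∀ i, ∀ y ∈ openBox a, DifferentiableAt ℝ (H i) y := fun i y hy =>
    ((hHc i).contDiffAt (hnhds y hy)).differentiableAt one_ne_zero
  have hdiv : ∀ y ∈ openBox a, ∑ i, fderiv ℝ (H i) y (e i) =
      (boxEigenvalue a k - μ) * (f y * sineMode a k y.ofLp) := by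
    intro y hy
    have hf2 := contDiffAt_of_mem_openBox hsm hy
    have hfd : DifferentiableAt ℝ f y := hf2.differentiableAt two_ne_zero
    have hDd : DifferentiableAt ℝ (fderiv ℝ f) y :=
      (hf2.fderiv_right (m := 1) le_rfl).differentiableAt one_ne_zero
    have hsd : DifferentiableAt ℝ (fun y : EuclideanSpace ℝ (Fin (m + 1)) => sineMode a k y.ofLp) y :=
      (contDiff_sineMode a k (n := 1)).differentiable one_ne_zero y
    have h1 : ∀ i, fderiv ℝ (H i) y (e i) = sineMode a k y.ofLp *
        fderiv ℝ (fun z => fderiv ℝ f z (e i)) y (e i) +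
          (π * k i / a i) ^ 2 * (f y * sineMode a k y.ofLp) := by
      intro i
      have hev : H i =ᶠ[𝓝 y] fun y => sineMode a k y.ofLp * fderiv ℝ f y (e i) -
          f y * sineModeDeriv a k i y.ofLp := by
        filter_upwards [(isOpen_openBox a).mem_nhds hy] with z hz
        simp only [hH]
        rw [fderivWithin_of_mem_nhds (hnhds z hz)]
      have hde : DifferentiableAt ℝ (fun z => fderiv ℝ f z (e i)) y :=
        hDd.clm_apply (differentiableAt_const _)
      have hcd : DifferentiableAt ℝ
          (fun y : EuclideanSpace ℝ (Fin (m + 1)) => sineModeDeriv a k i y.ofLp) y :=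
        (contDiff_sineModeDeriv a k i (n := 1)).differentiable one_ne_zero y
      rw [hev.fderiv_eq, fderiv_fun_sub (hsd.fun_mul hde) (hfd.fun_mul hcd), fderiv_fun_mul hsd hde,
        fderiv_fun_mul hfd hcd]
      simp only [_root_.sub_apply, _root_.add_apply,
        _root_.smul_apply, smul_eq_mul]
      simp only [he, fderiv_sineMode, fderiv_sineModeDeriv]
      ring
    rw [sum_congr rfl fun i _ => h1 i, sum_add_distrib, ← mul_sum, ← laplacian_eq_sum f hf2,
      ← sum_mul, boxEigenvalue]
    linear_combination (-sineMode a k y.ofLp) * heig y hy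
  set L : (Fin (m + 1) → ℝ) →L[ℝ] EuclideanSpace ℝ (Fin (m + 1)) :=
    ((PiLp.continuousLinearEquiv 2 ℝ fun _ : Fin (m + 1) => ℝ).symm :
      (Fin (m + 1) → ℝ) →L[ℝ] PiLp 2 fun _ : Fin (m + 1) => ℝ) with hL
  have hae : (fun x => ∑ i, ((fderiv ℝ (H i) (WithLp.toLp 2 x)).comp L) (Pi.single i 1))
      =ᵐ[volume.restrict (Set.Icc 0 a)]
      fun x => (boxEigenvalue a k - μ) * (f (WithLp.toLp 2 x) * sineMode a k x) := by
    have hset : (Set.univ.pi fun i => Set.Ioo ((0 : Fin (m + 1) → ℝ) i) (a i)) =ᵐ[volume]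
        Set.Icc 0 a := Measure.univ_pi_Ioo_ae_eq_Icc
    rw [← Measure.restrict_congr_set hset]
    refine (ae_restrict_iff' (MeasurableSet.univ_pi fun i => measurableSet_Ioo)).2
      (Eventually.of_forall fun x hx => ?_)
    exact hdiv _ (hopen x hx)
  have hint := (integrableOn_mul_sineMode hsm.continuousOn k).const_mul (boxEigenvalue a k - μ)
  have hthm := integral_divergence_of_hasFDerivAt_off_countable' 0 a (fun i => (ha i).le)
    (fun i x => H i (WithLp.toLp 2 x))
    (fun i x => (fderiv ℝ (H i) (WithLp.toLp 2 x)).comp L) ∅ Set.countable_empty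
    (fun i => (hHc i).continuousOn.comp (PiLp.continuous_toLp 2 _).continuousOn hmaps)
    (fun x hx i => (hdiff i _ (hopen x hx.1)).hasFDerivAt.comp x (PiLp.hasFDerivAt_toLp 2 x))
    (hint.congr hae.symm)
  have hface : ∀ i, ∀ x : Fin (m + 1) → ℝ, (x i = 0 ∨ x i = a i) → H i (WithLp.toLp 2 x) = 0 := by
    intro i x hx
    simp only [hH]
    rw [sineMode_eq_zero ha k i hx, hzero _ (not_mem_openBox_of_face i hx), zero_mul, zero_mul,
      sub_zero]
  rw [integral_congr_ae hae, integral_const_mul] at hthm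
  rw [sineCoeff, hthm]
  refine sum_eq_zero fun i _ => ?_
  have h1 : ∀ x : Fin m → ℝ, H i (WithLp.toLp 2 (i.insertNth (a i) x)) = 0 := fun x =>
    hface i _ (Or.inr (by simp))
  have h2 : ∀ x : Fin m → ℝ,
      H i (WithLp.toLp 2 (i.insertNth ((0 : Fin (m + 1) → ℝ) i) x)) = 0 := fun x =>
    hface i _ (Or.inl (by simp))
  simp only [h1, h2, integral_zero, sub_self]

end

end DirichletBox

end

noncomputable section

namespace DirichletBox

open Real Finset Filter Topology MeasureTheory

/-! ### Completeness of the sine products and multiplicities of eigenvalues -/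

section

variable {d : ℕ}

theorem sineMode_eq_prod_sign_mul (a : Fin d → ℝ) (k : Fin d → ℤ) (x : Fin d → ℝ) :
    sineMode a k x = (∏ i, ((k i).sign : ℝ)) * sineMode a (fun i => |k i|) x := by
  rw [sineMode, sineMode, ← prod_mul_distrib]
  refine prod_congr rfl fun i _ => ?_
  rcases lt_trichotomy (k i) 0 with h | h | h
  · rw [abs_of_neg h, Int.sign_eq_neg_one_of_neg h]
    push_cast
    rw [show π * -(k i : ℝ) / a i * x i = -(π * k i / a i * x i) by ring, sin_neg]
    ring
  · simp [h]
  · rw [abs_of_pos h, Int.sign_eq_one_of_pos h]; simp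

/-- The modes are odd in each wave number and vanish when one is zero. All integers are needed
because the completeness argument shifts wave numbers by `±1`. -/
theorem sineCoeff_eq_zero_of_forall_nat {a : Fin d → ℝ} {f : EuclideanSpace ℝ (Fin d) → ℝ}
    (h : ∀ k : Fin d → ℕ, sineCoeff a (fun i => (k i : ℤ) + 1) f = 0) (k : Fin d → ℤ) :
    sineCoeff a k f = 0 := by
  have e : ∀ x, f (WithLp.toLp 2 x) * sineMode a k x =
      (∏ i, ((k i).sign : ℝ)) * (f (WithLp.toLp 2 x) * sineMode a (fun i => |k i|) x) := fun x => by
    rw [sineMode_eq_prod_sign_mul]; ring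
  rw [sineCoeff]
  simp only [e]
  rw [integral_const_mul]
  by_cases h0 : ∃ i, k i = 0
  · obtain ⟨i, hi⟩ := h0
    rw [prod_eq_zero (mem_univ i) (by simp [hi]), zero_mul]
  · push Not at h0
    have hk : (fun i => |k i|) = fun i => (((k i).natAbs - 1 : ℕ) : ℤ) + 1 := by
      funext i
      have := h0 i
      rw [Int.abs_eq_natAbs]
      lia
    have := h fun i => (k i).natAbs - 1
    rw [sineCoeff, ← hk] at this
    rw [this, mul_zero]

theorem cos_mul_sineMode (a : Fin d → ℝ) (k : Fin d → ℤ) (i : Fin d) (x : Fin d → ℝ) :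
    cos (π / a i * x i) * sineMode a k x = (1 / 2) * (sineMode a (Function.update k i (k i + 1)) x +
      sineMode a (Function.update k i (k i - 1)) x) := by
  have h : ∀ c : ℤ, ∏ j ∈ univ.erase i, sin (π * (Function.update k i c j : ℤ) / a j * x j) =
      ∏ j ∈ univ.erase i, sin (π * k j / a j * x j) := fun c =>
    prod_congr rfl fun j hj => by rw [Function.update_of_ne (ne_of_mem_erase hj)]
  rw [sineMode_eq_mul_prod_erase a _ i, sineMode_eq_mul_prod_erase a _ i,
    sineMode_eq_mul_prod_erase a _ i, h, h, Function.update_self, Function.update_self]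
  push_cast
  rw [show π * ((k i : ℝ) + 1) / a i * x i = π * k i / a i * x i + π / a i * x i by ring,
    show π * ((k i : ℝ) - 1) / a i * x i = π * k i / a i * x i - π / a i * x i by ring,
    sin_add, sin_sub]
  ring

/-- The coordinate cosines on the box. -/
def boxCos (a : Fin d → ℝ) (i : Fin d) : C(Set.Icc (0 : Fin d → ℝ) a, ℝ) :=
  ⟨fun x => cos (π / a i * x.1 i),
    continuous_cos.comp (continuous_const.mul ((continuous_apply i).comp continuous_subtype_val))⟩

theorem separatesPoints_boxCos {a : Fin d → ℝ} (ha : ∀ i, 0 < a i) :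
    (Algebra.adjoin ℝ (Set.range (boxCos a))).SeparatesPoints := by
  intro x y hxy
  obtain ⟨i, hi⟩ : ∃ i, x.1 i ≠ y.1 i := by
    by_contra! h; exact hxy (Subtype.ext (funext h))
  refine ⟨_, ⟨boxCos a i, Algebra.subset_adjoin ⟨i, rfl⟩, rfl⟩, fun h => hi ?_⟩
  have hm : ∀ z : Set.Icc (0 : Fin d → ℝ) a, π / a i * z.1 i ∈ Set.Icc 0 π := by
    intro z
    have h0 : 0 ≤ z.1 i := z.2.1 i
    have h1 := z.2.2 i
    have h2 := ha i
    refine ⟨by positivity, ?_⟩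
    rw [div_mul_eq_mul_div, div_le_iff₀ h2]
    exact mul_le_mul_of_nonneg_left h1 pi_pos.le
  have h3 := injOn_cos (hm x) (hm y) h
  have h4 : π / a i ≠ 0 := (div_pos pi_pos (ha i)).ne'
  exact mul_left_cancel₀ h4 h3

/-- By Stone–Weierstrass some `p ∈ A` is uniformly within `ε` of `G`, so `∫ G² = ∫ (G - p) G ≤ ε ∫
|G|`. -/
theorem integral_mul_self_eq_zero_of_separatesPoints {X : Type*} [TopologicalSpace X]
    [CompactSpace X] [MeasurableSpace X] [BorelSpace X] {ν : Measure X} [IsFiniteMeasure ν]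
    {A : Subalgebra ℝ C(X, ℝ)} (hA : A.SeparatesPoints) {G : C(X, ℝ)}
    (h : ∀ p ∈ A, ∫ x, (p * G) x ∂ν = 0) : ∫ x, (G * G) x ∂ν = 0 := by
  have hint : ∀ p : C(X, ℝ), Integrable p ν := fun p =>
    p.continuous.integrable_of_hasCompactSupport (HasCompactSupport.of_compactSpace _)
  have hnn : 0 ≤ ∫ x, (G * G) x ∂ν := integral_nonneg fun x => mul_self_nonneg (G x)
  have hM : 0 ≤ ∫ x, |G x| ∂ν := integral_nonneg fun x => abs_nonneg (G x)
  have hle : ∀ ε > 0, ∫ x, (G * G) x ∂ν ≤ ε * ∫ x, |G x| ∂ν := by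
    intro ε hε
    obtain ⟨⟨p, hpA⟩, hp⟩ :=
      ContinuousMap.exists_mem_subalgebra_near_continuousMap_of_separatesPoints A hA G ε hε
    have e : ∫ x, (G * G) x ∂ν = ∫ x, ((G - p) * G) x ∂ν := by
      rw [sub_mul]
      simp only [ContinuousMap.sub_apply]
      rw [integral_sub (hint _) (hint _), h p hpA, sub_zero]
    rw [e, ← integral_const_mul]
    refine integral_mono (hint _) ((hint G).abs.const_mul ε) fun x => ?_
    have h1 : |G x - p x| ≤ ε := by
      rw [norm_sub_rev] at hp
      exact (ContinuousMap.norm_coe_le_norm (G - p) x).trans hp.le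
    calc ((G - p) * G) x ≤ |(G x - p x) * G x| := le_abs_self _
      _ ≤ ε * |G x| := by rw [abs_mul]; gcongr
  by_contra hne
  have hpos : 0 < ∫ x, (G * G) x ∂ν := lt_of_le_of_ne hnn (Ne.symm hne)
  have := hle ((∫ x, (G * G) x ∂ν) / (2 * ((∫ x, |G x| ∂ν) + 1))) (by positivity)
  rw [div_mul_eq_mul_div, le_div_iff₀ (by positivity)] at this
  nlinarith

/-- Multiplication by a coordinate cosine sends a sine mode to the mean of its two neighbours. So a
function with no sine coefficients, times the lowest mode, is orthogonal to the whole algebra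
generated by these cosines, and that algebra separates points. The product therefore vanishes, and
the lowest mode is positive inside the box. -/
theorem eq_zero_of_sineCoeff_eq_zero {a : Fin d → ℝ} (ha : ∀ i, 0 < a i)
    {f : EuclideanSpace ℝ (Fin d) → ℝ} (hf : ContinuousOn f (closedBox a))
    (h : ∀ k : Fin d → ℕ, sineCoeff a (fun i => (k i : ℤ) + 1) f = 0) :
    ∀ x ∈ openBox a, f x = 0 := by
  set K := Set.Icc (0 : Fin d → ℝ) a with hK
  have hmK : MeasurableSet K := measurableSet_Icc
  let _ : MeasureSpace K := Measure.Subtype.measureSpace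
  have hfin : IsFiniteMeasure (volume : Measure K) :=
    ⟨by rw [Measure.Subtype.volume_univ hmK.nullMeasurableSet]; exact isCompact_Icc.measure_lt_top⟩
  have hint : ∀ p : C(K, ℝ), Integrable p := fun p =>
    p.continuous.integrable_of_hasCompactSupport (HasCompactSupport.of_compactSpace _)
  have hgc : ContinuousOn (fun x : Fin d → ℝ => f (WithLp.toLp 2 x)) K :=
    hf.comp (PiLp.continuous_toLp 2 _).continuousOn fun x hx => toLp_mem_closedBox.2 hx
  let g : C(K, ℝ) := ⟨fun x => f (WithLp.toLp 2 x.1), continuousOn_iff_continuous_domRestrict.1 hgc⟩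
  let φ : (Fin d → ℤ) → C(K, ℝ) := fun k =>
    ⟨fun x => sineMode a k x.1, (continuous_sineMode a k).comp continuous_subtype_val⟩
  let W : C(K, ℝ) → Prop := fun p => ∀ k, ∫ x, (p * (g * φ k)) x = 0
  have hW1 : W 1 := by
    intro k
    have := sineCoeff_eq_zero_of_forall_nat h k
    rw [sineCoeff, ← integral_subtype hmK] at this
    rw [one_mul]
    exact this
  have hWmul : ∀ p ∈ Algebra.adjoin ℝ (Set.range (boxCos a)), ∀ q, W q → W (p * q) := by
    intro p hp
    induction hp using Algebra.adjoin_induction with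
    | mem p hp =>
      obtain ⟨i, rfl⟩ := hp
      intro q hq k
      have e : boxCos a i * q * (g * φ k) = (1 / 2 : ℝ) •
          (q * (g * φ (Function.update k i (k i + 1))) +
            q * (g * φ (Function.update k i (k i - 1)))) := by
        ext x
        have := cos_mul_sineMode a k i x.1
        simp only [boxCos, φ, ContinuousMap.mul_apply, ContinuousMap.smul_apply,
          ContinuousMap.add_apply, ContinuousMap.coe_mk, smul_eq_mul]
        linear_combination (q x * g x) * this
      rw [e]
      simp only [ContinuousMap.smul_apply, ContinuousMap.add_apply]
      rw [integral_smul, integral_add (hint _) (hint _), hq, hq, add_zero, smul_zero]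
    | algebraMap r =>
      intro q hq k
      have e : algebraMap ℝ C(K, ℝ) r * q * (g * φ k) = r • (q * (g * φ k)) := by
        rw [mul_assoc, Algebra.smul_def]
      rw [e]
      simp only [ContinuousMap.smul_apply]
      rw [integral_smul, hq, smul_zero]
    | add p p' _ _ hp hp' =>
      intro q hq k
      rw [add_mul, add_mul]
      simp only [ContinuousMap.add_apply]
      rw [integral_add (hint _) (hint _), hp q hq, hp' q hq, add_zero]
    | mul p p' _ _ hp hp' =>
      intro q hq
      rw [mul_assoc]
      exact hp _ (hp' q hq)
  have hsq : ∫ x, ((g * φ fun _ => 1) * (g * φ fun _ => 1)) x = 0 := by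
    refine integral_mul_self_eq_zero_of_separatesPoints (separatesPoints_boxCos ha) fun p hp => ?_
    have := hWmul p hp 1 hW1 fun _ => 1
    rwa [mul_one] at this
  set F : (Fin d → ℝ) → ℝ := fun x => f (WithLp.toLp 2 x) * sineMode a (fun _ => 1) x with hF
  have hFc : ContinuousOn F K := hgc.mul (continuous_sineMode a _).continuousOn
  have hF2 : ∫ x in K, F x * F x = 0 := by
    rw [← integral_subtype hmK]
    exact hsq
  have hae := (setIntegral_eq_zero_iff_of_nonneg_ae
    (Eventually.of_forall fun x => mul_self_nonneg (F x))
    ((hFc.mul hFc).integrableOn_compact isCompact_Icc)).1 hF2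
  set U := Set.univ.pi fun i => Set.Ioo (0 : ℝ) (a i) with hU
  have hUK : U ⊆ K := fun x hx =>
    ⟨fun i => (hx i (Set.mem_univ i)).1.le, fun i => (hx i (Set.mem_univ i)).2.le⟩
  have hEq := Measure.eqOn_open_of_ae_eq (ae_restrict_of_ae_restrict_of_subset hUK hae)
    (isOpen_set_pi Set.finite_univ fun i _ => isOpen_Ioo) ((hFc.mul hFc).mono hUK)
    continuousOn_const
  intro x hx
  have hxU : x.ofLp ∈ U := fun i _ => hx i
  have h1 : F x.ofLp * F x.ofLp = 0 := hEq hxU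
  have h2 : f x * sineMode a (fun _ => 1) x.ofLp = 0 := mul_self_eq_zero.1 h1
  refine (mul_eq_zero.1 h2).resolve_right (prod_pos fun i _ => ?_).ne'
  have h3 := hx i
  have h4 := ha i
  refine sin_pos_of_pos_of_lt_pi ?_ ?_
  · have := h3.1; push_cast; positivity
  · push_cast
    rw [mul_one, div_mul_eq_mul_div, div_lt_iff₀ h4]
    exact mul_lt_mul_of_pos_left h3.2 pi_pos

theorem integral_cos_int_mul {a : ℝ} (ha : 0 < a) {m : ℤ} (hm : m ≠ 0) :
    ∫ x in (0 : ℝ)..a, cos (π * m / a * x) = 0 := by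
  have hm' : (m : ℝ) ≠ 0 := by exact_mod_cast hm
  have hc : π * m / a ≠ 0 := by positivity
  rw [intervalIntegral.integral_comp_mul_left (fun x => cos x) hc, integral_cos, mul_zero, sin_zero,
    div_mul_cancel₀ _ ha.ne', mul_comm π, sin_int_mul_pi, sub_zero, smul_zero]

theorem integral_sin_mul_sin {a : ℝ} (ha : 0 < a) (k l : ℕ) :
    ∫ x in Set.Icc 0 a, sin (π * ((k : ℤ) + 1 : ℤ) / a * x) * sin (π * ((l : ℤ) + 1 : ℤ) / a * x) =
      if k = l then a / 2 else 0 := by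
  have hsum : ∫ x in (0 : ℝ)..a, cos (π * ((k + l + 2 : ℤ) : ℝ) / a * x) = 0 :=
    integral_cos_int_mul ha (by lia)
  have e : ∀ x : ℝ, sin (π * ((k : ℤ) + 1 : ℤ) / a * x) * sin (π * ((l : ℤ) + 1 : ℤ) / a * x) =
      (1 / 2) * (cos (π * ((k - l : ℤ) : ℝ) / a * x) - cos (π * ((k + l + 2 : ℤ) : ℝ) / a * x)) := by
    intro x
    rw [show π * ((k - l : ℤ) : ℝ) / a * x = π * ((k : ℤ) + 1 : ℤ) / a * x -
      π * ((l : ℤ) + 1 : ℤ) / a * x by push_cast; ring,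
      show π * ((k + l + 2 : ℤ) : ℝ) / a * x = π * ((k : ℤ) + 1 : ℤ) / a * x +
      π * ((l : ℤ) + 1 : ℤ) / a * x by push_cast; ring, cos_sub, cos_add]
    ring
  rw [integral_Icc_eq_integral_Ioc, ← intervalIntegral.integral_of_le ha.le]
  simp only [e]
  rw [intervalIntegral.integral_const_mul, intervalIntegral.integral_sub
    (Continuous.intervalIntegrable (by fun_prop) _ _)
    (Continuous.intervalIntegrable (by fun_prop) _ _), hsum, sub_zero]
  split_ifs with hkl
  · simp [hkl]; ring
  · rw [integral_cos_int_mul ha (by lia), mul_zero]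

theorem integral_sineMode_mul_sineMode {a : Fin d → ℝ} (ha : ∀ i, 0 < a i) (k l : Fin d → ℕ) :
    ∫ x in Set.Icc 0 a, sineMode a (fun i => (k i : ℤ) + 1) x * sineMode a (fun i => (l i : ℤ) + 1) x
      = if k = l then ∏ i, a i / 2 else 0 := by
  have e : (volume : Measure (Fin d → ℝ)).restrict (Set.Icc 0 a) =
      Measure.pi fun i => (volume : Measure ℝ).restrict (Set.Icc 0 (a i)) := by
    rw [← Measure.restrict_pi_pi]
    rw [Set.pi_univ_Icc (fun _ => (0 : ℝ)) a]
    rfl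
  simp only [sineMode, ← prod_mul_distrib]
  rw [e, integral_fintype_prod_eq_prod (𝕜 := ℝ) fun i x => sin (π * ((k i : ℤ) + 1 : ℤ) / a i * x) *
    sin (π * ((l i : ℤ) + 1 : ℤ) / a i * x)]
  rw [prod_congr rfl fun i _ => integral_sin_mul_sin (ha i) (k i) (l i)]
  split_ifs with h
  · subst h; simp
  · obtain ⟨i, hi⟩ := Function.ne_iff.1 h
    exact prod_eq_zero (mem_univ i) (if_neg hi)

/-- The Dirichlet eigenfunctions of the box, extended by zero. -/
def boxEigenfunction (a : Fin d → ℝ) (k : Fin d → ℤ) (y : EuclideanSpace ℝ (Fin d)) : ℝ :=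
  (openBox a).indicator (fun y => sineMode a k y.ofLp) y

theorem boxEigenfunction_eq {a : Fin d → ℝ} (ha : ∀ i, 0 < a i) (k : Fin d → ℤ)
    {y : EuclideanSpace ℝ (Fin d)} (hy : y ∈ closedBox a) :
    boxEigenfunction a k y = sineMode a k y.ofLp := by
  by_cases h : y ∈ openBox a
  · exact Set.indicator_of_mem h _
  · rw [boxEigenfunction, Set.indicator_of_notMem h]
    simp only [openBox, Set.mem_ofPred_eq, not_forall] at h
    obtain ⟨i, hi⟩ := h
    have h1 := hy i
    refine (sineMode_eq_zero ha k i ?_).symm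
    by_contra! h2
    exact hi ⟨lt_of_le_of_ne h1.1 (Ne.symm h2.1), lt_of_le_of_ne h1.2 h2.2⟩

theorem boxEigenfunction_mem {a : Fin d → ℝ} (ha : ∀ i, 0 < a i) (k : Fin d → ℤ) :
    boxEigenfunction a k ∈ dirichletEigenspace a (boxEigenvalue a k) := by
  refine ⟨(contDiff_sineMode a k).contDiffOn.congr fun y hy => boxEigenfunction_eq ha k hy,
    fun y hy => Set.indicator_of_notMem hy _, fun y hy => ?_⟩
  have hev : boxEigenfunction a k =ᶠ[𝓝 y] fun y => sineMode a k y.ofLp := by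
    filter_upwards [(isOpen_openBox a).mem_nhds hy] with z hz using Set.indicator_of_mem hz _
  rw [(InnerProductSpace.laplacian_congr_nhds hev).self_of_nhds, laplacian_sineMode, neg_neg,
    hev.self_of_nhds]

theorem sineCoeff_boxEigenfunction {a : Fin d → ℝ} (ha : ∀ i, 0 < a i) (k l : Fin d → ℕ) :
    sineCoeff a (fun i => (k i : ℤ) + 1) (boxEigenfunction a fun i => (l i : ℤ) + 1) =
      if l = k then ∏ i, a i / 2 else 0 := by
  rw [← integral_sineMode_mul_sineMode ha, sineCoeff]
  refine setIntegral_congr_fun measurableSet_Icc fun x hx => ?_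
  simp only
  rw [boxEigenfunction_eq ha _ (toLp_mem_closedBox.2 hx)]

/-- The wave numbers of the eigenvalue `μ`. -/
abbrev waveNumbers (a : Fin d → ℝ) (μ : ℝ) : Type :=
  {k : Fin d → ℕ // boxEigenvalue a (fun i => (k i : ℤ) + 1) = μ}

/-- The sine coefficients of an eigenfunction. -/
def sineCoeffMap (a : Fin d → ℝ) (μ : ℝ) :
    dirichletEigenspace a μ →ₗ[ℝ] (waveNumbers a μ → ℝ) where
  toFun f k := sineCoeff a (fun i => (k.1 i : ℤ) + 1) f
  map_add' f g := by
    funext k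
    simp only [sineCoeff, Submodule.coe_add, Pi.add_apply, add_mul]
    exact integral_add (integrableOn_mul_sineMode f.2.1.continuousOn _)
      (integrableOn_mul_sineMode g.2.1.continuousOn _)
  map_smul' c f := by
    funext k
    simp only [sineCoeff, Submodule.coe_smul, Pi.smul_apply, smul_eq_mul, mul_assoc, RingHom.id_apply]
    exact integral_const_mul _ _

/-- Injectivity combines Green's identity, which kills the coefficients at other eigenvalues, with
completeness; surjectivity is orthogonality of the modes. -/
theorem bijective_sineCoeffMap (hd : 1 ≤ d) {a : Fin d → ℝ} (ha : ∀ i, 0 < a i) (μ : ℝ)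
    [Finite (waveNumbers a μ)] : Function.Bijective (sineCoeffMap a μ) := by
  constructor
  · rw [← LinearMap.ker_eq_bot, LinearMap.ker_eq_bot']
    intro f hf
    obtain ⟨m, rfl⟩ : ∃ m, d = m + 1 := ⟨d - 1, by lia⟩
    have h0 := eq_zero_of_sineCoeff_eq_zero ha f.2.1.continuousOn fun k => by
      by_cases hk : boxEigenvalue a (fun i => (k i : ℤ) + 1) = μ
      · exact congrFun hf ⟨k, hk⟩
      · exact (mul_eq_zero.1 (sub_mul_sineCoeff_eq_zero ha f.2 _)).resolve_left (sub_ne_zero.2 hk)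
    refine Subtype.ext (funext fun x => ?_)
    by_cases hx : x ∈ openBox a
    · exact h0 x hx
    · exact f.2.2.1 x hx
  · classical
    have := Fintype.ofFinite (waveNumbers a μ)
    intro v
    let φ : waveNumbers a μ → dirichletEigenspace a μ := fun l =>
      ⟨boxEigenfunction a fun i => (l.1 i : ℤ) + 1, by
        have := boxEigenfunction_mem ha fun i => (l.1 i : ℤ) + 1
        rwa [l.2] at this⟩
    refine ⟨∑ l, (v l / ∏ i, a i / 2) • φ l, ?_⟩
    rw [map_sum]
    funext k
    rw [Finset.sum_apply, sum_eq_single k]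
    · have : (sineCoeffMap a μ) (φ k) k = ∏ i, a i / 2 := by
        refine (sineCoeff_boxEigenfunction ha k.1 k.1).trans (if_pos rfl)
      rw [map_smul, Pi.smul_apply, this, smul_eq_mul, div_mul_cancel₀]
      exact prod_ne_zero_iff.2 fun i _ => (half_pos (ha i)).ne'
    · intro l _ hl
      have : (sineCoeffMap a μ) (φ l) k = 0 :=
        (sineCoeff_boxEigenfunction ha k.1 l.1).trans (if_neg fun h => hl (Subtype.ext h))
      rw [map_smul, Pi.smul_apply, this, smul_zero]
    · simp

theorem finiteDimensional_dirichletEigenspace (hd : 1 ≤ d) {a : Fin d → ℝ} (ha : ∀ i, 0 < a i)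
    (μ : ℝ) [Finite (waveNumbers a μ)] : FiniteDimensional ℝ (dirichletEigenspace a μ) :=
  (LinearEquiv.ofBijective _ (bijective_sineCoeffMap hd ha μ)).symm.finiteDimensional

theorem dirichletMultiplicity_eq_card (hd : 1 ≤ d) {a : Fin d → ℝ} (ha : ∀ i, 0 < a i)
    (μ : ℝ) [Finite (waveNumbers a μ)] : dirichletMultiplicity a μ = Nat.card (waveNumbers a μ) := by
  have := Fintype.ofFinite (waveNumbers a μ)
  rw [dirichletMultiplicity, (LinearEquiv.ofBijective _ (bijective_sineCoeffMap hd ha μ)).finrank_eq,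
    Module.finrank_fintype_fun_eq_card, Nat.card_eq_fintype_card]

end

end DirichletBox

end

noncomputable section

namespace DirichletBox

open Real Finset Filter Topology MeasureTheory

/-! ### The theta function of the box -/

theorem hasSum_pi_prod {d : ℕ} {f : Fin d → ℕ → ℝ} {s : Fin d → ℝ} (hf : ∀ i k, 0 ≤ f i k)
    (h : ∀ i, HasSum (f i) (s i)) :
    HasSum (fun k : Fin d → ℕ => ∏ i, f i (k i)) (∏ i, s i) := by
  induction d with
  | zero => simp
  | succ d ih =>
    have h1 := ih (f := fun i => f i.succ) (s := fun i => s i.succ) (fun i => hf i.succ)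
      fun i => h i.succ
    have hs := (h 0).summable.mul_of_nonneg h1.summable (hf 0)
      (fun k => prod_nonneg fun i _ => hf i.succ (k i))
    have h2 := (h 0).mul h1 hs
    rw [Fin.prod_univ_succ, ← (Fin.consEquiv fun _ => ℕ).hasSum_iff]
    refine h2.congr_fun ?_
    intro p
    simp [Fin.prod_univ_succ, Fin.consEquiv]

section

variable {d : ℕ}

/-- The product of the heat traces of the sides of the box. -/
def boxHeat (a : Fin d → ℝ) (τ : ℝ) : ℝ := ∏ i, intervalHeat (a i) τ

theorem hasSum_exp_boxEigenvalue {a : Fin d → ℝ} (ha : ∀ i, 0 < a i) {t : ℝ} (ht : 0 < t) :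
    HasSum (fun k : Fin d → ℕ => exp (-boxEigenvalue a (fun i => (k i : ℤ) + 1) * t))
      (boxHeat a t) := by
  have h := hasSum_pi_prod (f := fun i (k : ℕ) => exp (-((π / a i) ^ 2 * t) * ((k : ℝ) + 1) ^ 2))
    (fun _ _ => (exp_pos _).le) fun i => (summable_gaussSum (c := (π / a i) ^ 2 * t)
      (by have := ha i; positivity)).hasSum
  have e : (fun k : Fin d → ℕ => exp (-boxEigenvalue a (fun i => (k i : ℤ) + 1) * t)) =
      fun k => ∏ i, exp (-((π / a i) ^ 2 * t) * ((k i : ℝ) + 1) ^ 2) := by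
    funext k
    rw [← exp_sum, boxEigenvalue, ← sum_neg_distrib, sum_mul]
    congr 1
    refine sum_congr rfl fun i _ => ?_
    push_cast
    ring
  rw [e]
  exact h

/-- On the fibre over `μ` the summable heat trace is a positive constant. -/
theorem finite_waveNumbers {a : Fin d → ℝ} (ha : ∀ i, 0 < a i) (μ : ℝ) :
    Finite (waveNumbers a μ) := by
  have h := (hasSum_exp_boxEigenvalue ha one_pos).summable.comp_injective
    (i := (Subtype.val : waveNumbers a μ → (Fin d → ℕ))) Subtype.val_injective
  have e : ((fun k : Fin d → ℕ => exp (-boxEigenvalue a (fun i => (k i : ℤ) + 1) * 1)) ∘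
      (Subtype.val : waveNumbers a μ → (Fin d → ℕ))) = fun _ => exp (-μ * 1) := by
    funext k
    simp only [Function.comp]
    rw [k.2]
  rw [e] at h
  by_contra hinf
  have := not_finite_iff_infinite.1 hinf
  exact (exp_pos _).ne' ((summable_const_iff _).1 h)

/-- The sum over wave numbers is regrouped along the fibres of the eigenvalue map, whose
cardinalities are the multiplicities. -/
theorem hasSum_dirichletMultiplicity (hd : 1 ≤ d) {a : Fin d → ℝ} (ha : ∀ i, 0 < a i) {t : ℝ}
    (ht : 0 < t) :
    HasSum (fun μ : ℝ => (dirichletMultiplicity a μ : ℝ) * exp (-μ * t)) (boxHeat a t) := by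
  have h := (Equiv.sigmaFiberEquiv fun k : Fin d → ℕ =>
    boxEigenvalue a (fun i => (k i : ℤ) + 1)).hasSum_iff.2 (hasSum_exp_boxEigenvalue ha ht)
  refine h.sigma fun μ => ?_
  have := finite_waveNumbers ha μ
  have := Fintype.ofFinite (waveNumbers a μ)
  have h1 : HasSum (fun _ : waveNumbers a μ => exp (-μ * t))
      ((dirichletMultiplicity a μ : ℝ) * exp (-μ * t)) := by
    rw [dirichletMultiplicity_eq_card hd ha, Nat.card_eq_fintype_card]
    convert hasSum_fintype (fun _ : waveNumbers a μ => exp (-μ * t)) using 1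
    simp
  refine h1.congr_fun ?_
  rintro ⟨k, hk⟩
  simp only [Function.comp, Equiv.sigmaFiberEquiv, Equiv.coe_fn_mk]
  rw [hk]

theorem theta_eq_boxHeat (hd : 1 ≤ d) {a : Fin d → ℝ} (ha : ∀ i, 0 < a i) {t : ℝ} (ht : 0 < t) :
    theta a t = boxHeat a t :=
  (hasSum_dirichletMultiplicity hd ha ht).tsum_eq

/-! ### The difference of the heat trace of the lattice and its main term -/

/-- Telescoping, one factor at a time. The bound is wasteful by powers of `X`, which the smallness
of `ε` absorbs later. -/
theorem abs_prod_sub_prod_le {ι : Type*} (s : Finset ι) {x y : ι → ℝ} {X ε : ℝ} (hX : 1 ≤ X)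
    (hx : ∀ i ∈ s, |x i| ≤ X) (hy : ∀ i ∈ s, |y i| ≤ X) (hxy : ∀ i ∈ s, |x i - y i| ≤ ε) :
    |∏ i ∈ s, x i - ∏ i ∈ s, y i| ≤ s.card * (X ^ s.card * ε) := by
  classical
  induction s using Finset.induction_on with
  | empty => simp
  | insert j s hj ih =>
    have ih := ih (fun i hi => hx i (mem_insert_of_mem hi)) (fun i hi => hy i (mem_insert_of_mem hi))
      fun i hi => hxy i (mem_insert_of_mem hi)
    have hX0 : 0 ≤ X := by linarith
    have hε : 0 ≤ ε := (abs_nonneg _).trans (hxy j (mem_insert_self j s))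
    have hp : |∏ i ∈ s, x i| ≤ X ^ s.card := by
      rw [abs_prod, ← prod_const]
      exact prod_le_prod (fun _ _ => abs_nonneg _) fun i hi => hx i (mem_insert_of_mem hi)
    rw [prod_insert hj, prod_insert hj, card_insert_of_notMem hj,
      show x j * ∏ i ∈ s, x i - y j * ∏ i ∈ s, y i =
        (x j - y j) * ∏ i ∈ s, x i + y j * (∏ i ∈ s, x i - ∏ i ∈ s, y i) by ring]
    refine (abs_add_le _ _).trans ?_
    rw [abs_mul, abs_mul]
    have h1 : |x j - y j| * |∏ i ∈ s, x i| ≤ ε * X ^ (s.card + 1) := by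
      refine mul_le_mul (hxy j (mem_insert_self j s)) (hp.trans ?_) (abs_nonneg _) hε
      exact pow_le_pow_right₀ hX (Nat.le_succ _)
    have h2 : |y j| * |∏ i ∈ s, x i - ∏ i ∈ s, y i| ≤ X * (s.card * (X ^ s.card * ε)) :=
      mul_le_mul (hy j (mem_insert_self j s)) ih (abs_nonneg _) hX0
    push_cast
    rw [pow_succ] at h1 ⊢
    linarith

theorem abs_pathMain_le {n : ℕ} (hn : 1 ≤ n) {t : ℝ} (ht : 0 ≤ t) :
    |pathMain n t| ≤ 1 + pathTheta n t := by
  have h1 := pathMain_le_pathTheta hn ht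
  have h2 := pathTheta_nonneg n t
  have h3 : exp (-4 * t) ≤ 1 := exp_le_one_iff.2 (by linarith)
  have h4 : 0 ≤ n * besselKernel t := mul_nonneg n.cast_nonneg (besselKernel_nonneg t)
  rw [abs_le]
  constructor
  · rw [pathMain]; linarith
  · linarith

/-- Since `n ≤ B u`, the variable `4 u² τ / n²` is at least `4 τ / B²`, which makes the decay
uniform in `u`. -/
theorem pathTheta_le_div_pow {n : ℕ} (hn : 1 ≤ n) {B u τ : ℝ} (hu : 1 ≤ u)
    (hB : (n : ℝ) ≤ B * u) (hτ : 0 < τ) {K : ℕ} (hK : 1 ≤ K) :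
    pathTheta n (u ^ 2 * τ) ≤ K.factorial * (B ^ 2 / (4 * τ)) ^ K := by
  have hu0 : 0 < u := by linarith
  have hn0 : (0 : ℝ) < n := by exact_mod_cast hn
  have hB0 : 0 < B := pos_of_mul_pos_left (hn0.trans_le hB) hu0.le
  refine (pathTheta_le hn (by positivity)).trans ?_
  refine (one_div_exp_sub_one_le (by positivity) hK).trans ?_
  rw [div_eq_mul_inv, ← inv_pow]
  gcongr
  rw [inv_div, div_le_div_iff₀ (by positivity) (by positivity)]
  have : (n : ℝ) ^ 2 ≤ (B * u) ^ 2 := by gcongr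
  nlinarith

theorem exp_neg_le_factorial_div {x : ℝ} (hx : 0 < x) (m : ℕ) :
    exp (-x) ≤ m.factorial / x ^ m := by
  rw [exp_neg, ← inv_div]
  exact inv_anti₀ (by positivity) (pow_div_factorial_le_exp x hx.le m)

theorem pathTheta_sub_pathMain_le_pow {n : ℕ} (hn : 1 ≤ n) {b B u τ : ℝ} (hb : 0 < b) (hu : 1 ≤ u)
    (hbn : b * u ≤ n) (hB : (n : ℝ) ≤ B * u) (hτ : 0 < τ) (hτ1 : τ ≤ 1) (huτ : 1 ≤ u ^ 2 * τ)
    (K : ℕ) :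
    pathTheta n (u ^ 2 * τ) - pathMain n (u ^ 2 * τ) ≤
      exp 1 * ((2 * (K + 1)).factorial / b ^ (2 * (K + 1))) * (2 + B ^ 2 / 2) * τ ^ K := by
  have hu0 : 0 < u := by linarith
  have hs : 0 < √τ := sqrt_pos.2 hτ
  have hsq : (u * √τ) ^ 2 = u ^ 2 * τ := by rw [mul_pow, sq_sqrt hτ.le]
  have h1 : 1 ≤ u * √τ := by
    rw [← hsq] at huτ
    exact (one_le_sq_iff₀ (by positivity)).1 huτ
  have h := pathTheta_sub_pathMain_le_exp hn h1
  rw [hsq] at h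
  have hth := pathTheta_le_div_pow hn hu hB hτ (K := 1) le_rfl
  rw [Nat.factorial_one, Nat.cast_one, one_mul, pow_one] at hth
  have hth0 := pathTheta_nonneg n (u ^ 2 * τ)
  -- The exponential beats the power `2 (K + 1)` of `b / √τ`, giving `τ ^ (K + 1)`; one factor `τ`
  -- is spent on the bound of order `1 / τ` for the trace.
  have h2 : exp (1 - n / (u * √τ)) ≤
      exp 1 * ((2 * (K + 1)).factorial / b ^ (2 * (K + 1)) * τ ^ (K + 1)) := by
    rw [sub_eq_add_neg, exp_add]
    gcongr
    have h3 : b / √τ ≤ n / (u * √τ) := by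
      rw [div_le_div_iff₀ hs (by positivity)]
      nlinarith
    calc exp (-(n / (u * √τ))) ≤ exp (-(b / √τ)) := exp_le_exp.2 (neg_le_neg h3)
      _ ≤ (2 * (K + 1)).factorial / (b / √τ) ^ (2 * (K + 1)) :=
          exp_neg_le_factorial_div (by positivity) _
      _ = _ := by
          rw [div_pow, pow_mul (√τ), sq_sqrt hτ.le]
          field_simp
  have h4 : 2 + 2 * pathTheta n (u ^ 2 * τ) ≤ (2 + B ^ 2 / 2) / τ := by
    rw [le_div_iff₀ hτ]
    rw [le_div_iff₀ (by positivity)] at hth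
    nlinarith
  calc _ ≤ _ := h
    _ ≤ exp 1 * ((2 * (K + 1)).factorial / b ^ (2 * (K + 1)) * τ ^ (K + 1)) *
        ((2 + B ^ 2 / 2) / τ) := by gcongr
    _ = _ := by field_simp; ring

/-- The heat trace of the lattice box. -/
def latticeHeat (n : Fin d → ℕ) (t : ℝ) : ℝ := ∏ i, pathTheta (n i) t

/-- The main term of the heat trace of the lattice box. -/
def latticeMain (n : Fin d → ℕ) (t : ℝ) : ℝ := ∏ i, pathMain (n i) t

theorem one_le_of_mul_le {b u : ℝ} (hb : 0 < b) (hu : 1 ≤ u) {n : ℕ} (h : b * u ≤ n) : 1 ≤ n := by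
  have : (0 : ℝ) < n := lt_of_lt_of_le (by positivity) h
  exact_mod_cast this

theorem exists_abs_latticeHeat_sub_latticeMain_le_pow (d : ℕ) {b B : ℝ} (hb : 0 < b) (K : ℕ) :
    ∃ C, ∀ (n : Fin d → ℕ) (u τ : ℝ), 1 ≤ u → (∀ i, b * u ≤ n i ∧ n i ≤ B * u) → 0 < τ → τ ≤ 1 →
      1 ≤ u ^ 2 * τ → |latticeHeat n (u ^ 2 * τ) - latticeMain n (u ^ 2 * τ)| ≤ C * τ ^ K := by
  -- The one-dimensional estimate is applied with `K + d`: the extra `τ ^ d` cancels the factor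
  -- bound `((1 + B² / 4) / τ) ^ d`.
  refine ⟨d * ((1 + B ^ 2 / 4) ^ d * (exp 1 * ((2 * (K + d + 1)).factorial /
    b ^ (2 * (K + d + 1))) * (2 + B ^ 2 / 2))), fun n u τ hu hn hτ hτ1 huτ => ?_⟩
  have hn1 : ∀ i, 1 ≤ n i := fun i => one_le_of_mul_le hb hu (hn i).1
  have ht : 0 ≤ u ^ 2 * τ := by positivity
  have hθ : ∀ i, 1 + pathTheta (n i) (u ^ 2 * τ) ≤ (1 + B ^ 2 / 4) / τ := by
    intro i
    have h := pathTheta_le_div_pow (hn1 i) hu (hn i).2 hτ (K := 1) le_rfl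
    rw [Nat.factorial_one, Nat.cast_one, one_mul, pow_one, le_div_iff₀ (by positivity)] at h
    rw [le_div_iff₀ hτ]
    nlinarith
  have h := abs_prod_sub_prod_le (univ : Finset (Fin d)) (X := (1 + B ^ 2 / 4) / τ)
    (by rw [le_div_iff₀ hτ]; nlinarith [sq_nonneg B])
    (fun i _ => show |pathTheta (n i) (u ^ 2 * τ)| ≤ _ by
      rw [abs_of_nonneg (pathTheta_nonneg _ _)]; linarith [hθ i])
    (fun i _ => (abs_pathMain_le (hn1 i) ht).trans (hθ i))
    (fun i _ => show |pathTheta (n i) (u ^ 2 * τ) - pathMain (n i) (u ^ 2 * τ)| ≤ _ by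
      rw [abs_of_nonneg (sub_nonneg.2 (pathMain_le_pathTheta (hn1 i) ht))]
      exact pathTheta_sub_pathMain_le_pow (hn1 i) hb hu (hn i).1 (hn i).2 hτ hτ1 huτ (K + d))
  refine h.trans (le_of_eq ?_)
  rw [card_univ, Fintype.card_fin, div_pow, pow_add τ]
  field_simp

/-- For `u² τ ≥ 1` this is the previous estimate. In the microscopic range `u² τ ≤ 1` the factor `4
^ (-n)` beats all powers of `u` and one factor `τ` remains, enough for a bounded integrand against
`dτ/τ`. -/
theorem exists_abs_latticeHeat_sub_latticeMain_le (d : ℕ) {b B : ℝ} (hb : 0 < b) (hB : 1 ≤ B) :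
    ∃ C, ∀ (n : Fin d → ℕ) (u τ : ℝ), 1 ≤ u → (∀ i, b * u ≤ n i ∧ n i ≤ B * u) → 0 < τ → τ ≤ 1 →
      |latticeHeat n (u ^ 2 * τ) - latticeMain n (u ^ 2 * τ)| ≤ C * τ := by
  obtain ⟨C, hC⟩ := exists_abs_latticeHeat_sub_latticeMain_le_pow d (B := B) hb 1
  -- The powers of `u` to absorb are `u ^ d` from the other factors, `u ^ 2` from the time and `u`
  -- from the number of modes.
  set m := d + 3 with hm
  set C' := d * ((2 * B) ^ d * (exp 3 * (m.factorial / b ^ m) * (4 * B))) with hC'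
  refine ⟨max C C', fun n u τ hu hn hτ hτ1 => ?_⟩
  rcases le_total 1 (u ^ 2 * τ) with huτ | huτ
  · refine (hC n u τ hu hn hτ hτ1 huτ).trans ?_
    rw [pow_one]
    gcongr
    exact le_max_left _ _
  have hu0 : 0 < u := by linarith
  have hn1 : ∀ i, 1 ≤ n i := fun i => one_le_of_mul_le hb hu (hn i).1
  have ht : 0 < u ^ 2 * τ := by positivity
  have hBu : 1 ≤ B * u := one_le_mul_of_one_le_of_one_le hB hu
  have hθ : ∀ i, 1 + pathTheta (n i) (u ^ 2 * τ) ≤ 2 * B * u := by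
    intro i
    have h := pathTheta_le_natCast (n i) ht.le
    linarith [(hn i).2]
  have hε : ∀ i, pathTheta (n i) (u ^ 2 * τ) - pathMain (n i) (u ^ 2 * τ) ≤
      u ^ 2 * τ * (exp 3 * (m.factorial / (b * u) ^ m) * (4 * B * u)) := by
    intro i
    refine (pathTheta_sub_pathMain_le_of_le_one (hn1 i) ht huτ).trans ?_
    have h1 : ((4 : ℝ) ^ n i)⁻¹ ≤ m.factorial / (b * u) ^ m := by
      refine le_trans ?_ (exp_neg_le_factorial_div (by positivity) m)
      rw [exp_neg]
      apply inv_anti₀ (exp_pos _)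
      calc exp (b * u) ≤ exp (n i) := exp_le_exp.2 (hn i).1
        _ = exp 1 ^ n i := by rw [← exp_nat_mul, mul_one]
        _ ≤ 4 ^ n i := by
          gcongr
          linarith [exp_one_lt_d9]
    have h2 : (2 + 2 * n i : ℝ) ≤ 4 * B * u := by linarith [(hn i).2]
    gcongr
  have h := abs_prod_sub_prod_le (univ : Finset (Fin d)) (X := 2 * B * u) (by linarith)
    (fun i _ => show |pathTheta (n i) (u ^ 2 * τ)| ≤ _ by
      rw [abs_of_nonneg (pathTheta_nonneg _ _)]; linarith [hθ i])
    (fun i _ => (abs_pathMain_le (hn1 i) ht.le).trans (hθ i))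
    (fun i _ => show |pathTheta (n i) (u ^ 2 * τ) - pathMain (n i) (u ^ 2 * τ)| ≤ _ by
      rw [abs_of_nonneg (sub_nonneg.2 (pathMain_le_pathTheta (hn1 i) ht.le))]
      exact hε i)
  refine h.trans ?_
  have e : ((univ : Finset (Fin d)).card : ℝ) * ((2 * B * u) ^ (univ : Finset (Fin d)).card *
      (u ^ 2 * τ * (exp 3 * (m.factorial / (b * u) ^ m) * (4 * B * u)))) = C' * τ := by
    rw [card_univ, Fintype.card_fin, hC', mul_pow, mul_pow b u, hm, pow_add u d 3]
    field_simp
  rw [e]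
  gcongr
  exact le_max_right _ _

/-- The main term of the heat trace of the box. -/
def boxMain (a : Fin d → ℝ) (τ : ℝ) : ℝ := ∏ i, (a i / (2 * √(π * τ)) - 1 / 2)

theorem tendsto_latticeHeat {n : ℝ → Fin d → ℕ} {a : Fin d → ℝ} (ha : ∀ i, 0 < a i)
    (hn : ∀ i, Tendsto (fun u : ℝ => (n u i : ℝ) / u) atTop (𝓝 (a i))) {τ : ℝ} (hτ : 0 < τ) :
    Tendsto (fun u => latticeHeat (n u) (u ^ 2 * τ)) atTop (𝓝 (boxHeat a τ)) :=
  tendsto_finsetProd _ fun i _ => tendsto_pathTheta (ha i) (hn i) hτ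

theorem tendsto_latticeMain {n : ℝ → Fin d → ℕ} {a : Fin d → ℝ}
    (hn : ∀ i, Tendsto (fun u : ℝ => (n u i : ℝ) / u) atTop (𝓝 (a i))) {τ : ℝ} (hτ : 0 < τ) :
    Tendsto (fun u => latticeMain (n u) (u ^ 2 * τ)) atTop (𝓝 (boxMain a τ)) :=
  tendsto_finsetProd _ fun i _ => tendsto_pathMain (hn i) hτ

theorem exists_eventually_bounds {n : ℝ → Fin d → ℕ} {a : Fin d → ℝ} (ha : ∀ i, 0 < a i)
    (hn : ∀ i, Tendsto (fun u : ℝ => (n u i : ℝ) / u) atTop (𝓝 (a i))) :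
    ∃ b B : ℝ, 0 < b ∧ 1 ≤ B ∧ ∀ᶠ u : ℝ in atTop, ∀ i, b * u ≤ n u i ∧ n u i ≤ B * u := by
  obtain ⟨b, hb, hb'⟩ : ∃ b : ℝ, 0 < b ∧ ∀ i, b < a i := by
    have h : ∀ᶠ b : ℝ in 𝓝[>] 0, ∀ i, b < a i := eventually_all.2 fun i =>
      (nhdsWithin_le_nhds (eventually_lt_nhds (ha i)))
    obtain ⟨b, h1, h2⟩ := (h.and self_mem_nhdsWithin).exists
    exact ⟨b, h2, h1⟩
  obtain ⟨B, hB, hB'⟩ : ∃ B : ℝ, 1 ≤ B ∧ ∀ i, a i < B := by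
    have h : ∀ᶠ B : ℝ in atTop, ∀ i, a i < B := eventually_all.2 fun i => eventually_gt_atTop (a i)
    obtain ⟨B, h1, h2⟩ := (h.and (eventually_ge_atTop 1)).exists
    exact ⟨B, h2, h1⟩
  refine ⟨b, B, hb, hB, ?_⟩
  have h1 := eventually_all.2 fun i => (hn i).eventually_const_lt (hb' i)
  have h2 := eventually_all.2 fun i => (hn i).eventually_lt_const (hB' i)
  filter_upwards [h1, h2, eventually_gt_atTop 0] with u h1 h2 hu i
  exact ⟨((lt_div_iff₀ hu).1 (h1 i)).le, ((div_lt_iff₀ hu).1 (h2 i)).le⟩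

/-- The lattice estimate is uniform in `u`, so it passes to the limit `u → ∞` along the lattices
with sides `⌊a_i u⌋`. -/
theorem exists_abs_boxHeat_sub_boxMain_le {a : Fin d → ℝ} (ha : ∀ i, 0 < a i) (K : ℕ) :
    ∃ C, ∀ τ, 0 < τ → τ ≤ 1 → |boxHeat a τ - boxMain a τ| ≤ C * τ ^ K := by
  have hn : ∀ i, Tendsto (fun u : ℝ => ((⌊a i * u⌋₊ : ℕ) : ℝ) / u) atTop (𝓝 (a i)) := fun i =>
    tendsto_nat_floor_mul_div_atTop (ha i).le
  obtain ⟨b, B, hb, -, hbB⟩ := exists_eventually_bounds (n := fun u i => ⌊a i * u⌋₊) ha hn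
  obtain ⟨C, hC⟩ := exists_abs_latticeHeat_sub_latticeMain_le_pow d (B := B) hb K
  refine ⟨C, fun τ hτ hτ1 => ?_⟩
  have hlim := ((tendsto_latticeHeat (n := fun u i => ⌊a i * u⌋₊) ha hn hτ).sub
    (tendsto_latticeMain hn hτ)).abs
  refine le_of_tendsto hlim ?_
  have hbig : Tendsto (fun u : ℝ => u ^ 2 * τ) atTop atTop :=
    (tendsto_pow_atTop two_ne_zero).atTop_mul_const hτ
  filter_upwards [hbB, eventually_ge_atTop 1, hbig.eventually_ge_atTop 1] with u h1 h2 h3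
  exact hC _ u τ h2 h1 hτ hτ1 h3

theorem boxHeat_nonneg (a : Fin d → ℝ) (τ : ℝ) : 0 ≤ boxHeat a τ :=
  prod_nonneg fun _ _ => gaussSum_nonneg _

theorem exists_boxHeat_le (hd : 1 ≤ d) {a : Fin d → ℝ} (ha : ∀ i, 0 < a i) {K : ℕ} (hK : 1 ≤ K) :
    ∃ C, ∀ τ, 1 ≤ τ → boxHeat a τ ≤ C / τ ^ K := by
  refine ⟨∏ i, (K.factorial / ((π / a i) ^ 2) ^ K), fun τ hτ => ?_⟩
  have hτ0 : 0 < τ := by linarith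
  calc boxHeat a τ ≤ ∏ i, (K.factorial / ((π / a i) ^ 2) ^ K) / τ ^ K := by
        refine prod_le_prod (fun _ _ => gaussSum_nonneg _) fun i _ => ?_
        have := ha i
        refine (gaussSum_le_factorial_div (by positivity) hK).trans (le_of_eq ?_)
        rw [mul_pow]
        field_simp
    _ = (∏ i, (K.factorial / ((π / a i) ^ 2) ^ K)) / (τ ^ K) ^ d := by
        rw [prod_div_distrib, prod_const, card_univ, Fintype.card_fin]
    _ ≤ _ := by
        have : 0 ≤ ∏ i, ((K.factorial : ℝ) / ((π / a i) ^ 2) ^ K) :=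
          prod_nonneg fun i _ => by positivity
        gcongr
        exact le_self_pow₀ (one_le_pow₀ hτ) (by lia)

end

end DirichletBox

end

noncomputable section

namespace DirichletBox

open Real Finset Filter Topology MeasureTheory

/-! ### Mellin transforms -/

theorem mellin_of_bounds {f : ℝ → ℝ} (hf : LocallyIntegrableOn f (Set.Ioi 0)) {K K' : ℕ} {C C' : ℝ}
    (h0 : ∀ τ, 0 < τ → τ ≤ 1 → |f τ| ≤ C * τ ^ K) (h1 : ∀ τ, 1 ≤ τ → |f τ| ≤ C' / τ ^ K') {s : ℂ}
    (hs : -(K : ℝ) < s.re) (hs' : s.re < K') :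
    MellinConvergent (fun t => (f t : ℂ)) s ∧
      DifferentiableAt ℂ (mellin fun t => (f t : ℂ)) s := by
  have hl : LocallyIntegrableOn (fun t => (f t : ℂ)) (Set.Ioi 0) := fun x hx =>
    let ⟨u, hu, hi⟩ := hf x hx
    ⟨u, hu, hi.ofReal⟩
  have htop : (fun t => (f t : ℂ)) =O[atTop] fun t : ℝ => t ^ (-(K' : ℝ)) := by
    refine Asymptotics.IsBigO.of_bound C' ?_
    filter_upwards [eventually_ge_atTop 1] with t ht
    have ht0 : 0 < t := by linarith
    rw [Complex.norm_real, norm_eq_abs, rpow_neg ht0.le, rpow_natCast, norm_of_nonneg (by positivity)]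
    exact h1 t ht
  have hbot : (fun t => (f t : ℂ)) =O[𝓝[>] 0] fun t : ℝ => t ^ (-(-(K : ℝ))) := by
    refine Asymptotics.IsBigO.of_bound C ?_
    filter_upwards [Ioc_mem_nhdsGT zero_lt_one] with t ht
    have ht0 := ht.1
    rw [Complex.norm_real, norm_eq_abs, neg_neg, rpow_natCast, norm_of_nonneg (by positivity)]
    exact h0 t ht.1 ht.2
  exact ⟨mellinConvergent_of_isBigO_rpow hl htop hs' hbot hs,
    mellin_differentiableAt_of_isBigO_rpow hl htop hs' hbot hs⟩

theorem mellin_ofReal_zero {f : ℝ → ℝ} (hf : MellinConvergent (fun t => (f t : ℂ)) 0) :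
    IntegrableOn (fun t => f t / t) (Set.Ioi 0) ∧
      mellin (fun t => (f t : ℂ)) 0 = ((∫ t in Set.Ioi 0, f t / t : ℝ) : ℂ) := by
  have e : ∀ t : ℝ, (t : ℂ) ^ ((0 : ℂ) - 1) • (f t : ℂ) = ((f t / t : ℝ) : ℂ) := by
    intro t
    rw [zero_sub, Complex.cpow_neg_one, smul_eq_mul]
    push_cast
    ring
  simp only [MellinConvergent, e] at hf
  refine ⟨?_, ?_⟩
  · have h : Integrable (fun t => f t / t) (volume.restrict (Set.Ioi 0)) := by simpa using hf.re
    exact h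
  · simp only [mellin, e]
    exact integral_ofReal

theorem locallyIntegrableOn_indicator_Ioc {f : ℝ → ℝ} (hf : LocallyIntegrableOn f (Set.Ioi 0)) :
    LocallyIntegrableOn ((Set.Ioc 0 1).indicator f) (Set.Ioi 0) := fun x hx =>
  let ⟨u, hu, hi⟩ := hf x hx
  ⟨u, hu, Integrable.indicator hi measurableSet_Ioc⟩

/-- The exponential function, with its value at `0` removed on `(0, 1]`. -/
def cutExp (t : ℝ) : ℝ := exp (-t) - (Set.Ioc 0 1).indicator (fun _ => 1) t

theorem mellin_cutExp {s : ℂ} (hs : -1 < s.re) :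
    MellinConvergent (fun t => (cutExp t : ℂ)) s ∧
      DifferentiableAt ℂ (mellin fun t => (cutExp t : ℂ)) s := by
  have hloc : LocallyIntegrableOn cutExp (Set.Ioi 0) := by
    refine LocallyIntegrableOn.sub ?_ (locallyIntegrableOn_indicator_Ioc ?_)
    · exact (Continuous.continuousOn (by fun_prop)).locallyIntegrableOn measurableSet_Ioi
    · exact continuousOn_const.locallyIntegrableOn measurableSet_Ioi
  obtain ⟨K', hK'⟩ := exists_nat_gt s.re
  refine mellin_of_bounds hloc (K := 1) (K' := K') (C := 1) (C' := K'.factorial) ?_ ?_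
    (by simpa using hs) hK'
  · intro t h0 h1
    rw [cutExp, Set.indicator_of_mem (show t ∈ Set.Ioc 0 1 from ⟨h0, h1⟩), abs_le]
    have := add_one_le_exp (-t)
    have : exp (-t) ≤ 1 := exp_le_one_iff.2 (by linarith)
    constructor <;> linarith
  · intro t ht
    have ht0 : 0 < t := by linarith
    rcases eq_or_lt_of_le ht with h | h
    · rw [cutExp, Set.indicator_of_mem (show t ∈ Set.Ioc 0 1 from ⟨ht0, h.ge⟩), ← h, one_pow, div_one,
        abs_le]
      have := exp_pos (-1)
      have : exp (-1) ≤ 1 := exp_le_one_iff.2 (by linarith)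
      have : (1 : ℝ) ≤ K'.factorial := by exact_mod_cast K'.factorial_pos
      constructor <;> linarith
    · rw [cutExp, Set.indicator_of_notMem (fun h' => absurd h'.2 (not_le.2 h)), sub_zero,
        abs_of_pos (exp_pos _)]
      exact exp_neg_le_factorial_div ht0 K'

theorem Gamma_eq_mellin_cutExp_add {s : ℂ} (hs : 0 < s.re) :
    Complex.Gamma s = mellin (fun t => (cutExp t : ℂ)) s + 1 / s := by
  rw [Complex.Gamma_eq_integral hs, Complex.GammaIntegral_eq_mellin]
  have h1 := hasMellin_one_Ioc hs
  rw [← h1.2, ← (hasMellin_add (mellin_cutExp (by linarith)).1 h1.1).2]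
  congr 1
  funext t
  rw [cutExp]
  by_cases h : t ∈ Set.Ioc (0 : ℝ) 1
  · simp [Set.indicator_of_mem h]
  · simp [Set.indicator_of_notMem h]

/-- Expresses `Γ'(1)` as the integral of `cutExp t / t`, so that it can be merged with the heat
integral without naming Euler's constant. -/
theorem hasDerivAt_Gamma_add_one :
    HasDerivAt (fun s : ℂ => Complex.Gamma (s + 1)) (mellin (fun t => (cutExp t : ℂ)) 0) 0 := by
  have hF : HasDerivAt (fun s : ℂ => Complex.Gamma (s + 1)) (deriv Complex.Gamma 1) 0 := by
    have h1 : HasDerivAt Complex.Gamma (deriv Complex.Gamma 1) (0 + 1) := by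
      rw [zero_add]
      refine (Complex.differentiableAt_Gamma 1 fun m hm => ?_).hasDerivAt
      have := congrArg Complex.re hm
      simp at this
      linarith [(Nat.cast_nonneg m : (0 : ℝ) ≤ m)]
    exact h1.comp_add_const 0 1
  have hG : HasDerivAt (fun s : ℂ => s * mellin (fun t => (cutExp t : ℂ)) s + 1)
      (mellin (fun t => (cutExp t : ℂ)) 0) 0 := by
    have := ((hasDerivAt_id (0 : ℂ)).mul
      (mellin_cutExp (s := 0) (by simp)).2.hasDerivAt).add_const 1
    simpa using this
  have heq : ∀ x : ℝ, 0 < x → Complex.Gamma ((x : ℂ) + 1) =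
      (x : ℂ) * mellin (fun t => (cutExp t : ℂ)) x + 1 := by
    intro x hx
    have hx0 : (x : ℂ) ≠ 0 := by exact_mod_cast hx.ne'
    rw [Complex.Gamma_add_one _ hx0, Gamma_eq_mellin_cutExp_add (by simpa using hx)]
    field_simp
  -- The identity `Γ(s + 1) = s M(s) + 1`, with `M` the Mellin transform of `cutExp`, is used only
  -- on the positive reals and at `0`; the one-sided derivative along that ray determines the
  -- complex one.
  have hF' := (HasDerivAt.comp_ofReal (z := 0) (by rw [Complex.ofReal_zero]; exact hF)).hasDerivWithinAt
    (s := Set.Ioi 0)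
  have hG' := (HasDerivAt.comp_ofReal (z := 0) (by rw [Complex.ofReal_zero]; exact hG)).hasDerivWithinAt
    (s := Set.Ioi 0)
  have hF'' := hF'.congr (f₁ := fun x : ℝ => (x : ℂ) * mellin (fun t => (cutExp t : ℂ)) x + 1)
    (fun x hx => (heq x hx).symm) (by simp)
  have := (uniqueDiffWithinAt_Ioi (0 : ℝ)).eq_deriv _ hF'' hG'
  rwa [this] at hF

/-! ### The zeta function of the box -/

theorem continuousOn_gaussSum : ContinuousOn gaussSum (Set.Ioi 0) := by
  intro c hc
  have hc' : 0 < c / 2 := half_pos hc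
  have h : ContinuousOn gaussSum (Set.Ioi (c / 2)) := by
    refine continuousOn_tsum (u := fun k : ℕ => exp (-(c / 2) * ((k : ℝ) + 1) ^ 2))
      (fun k => Continuous.continuousOn (by fun_prop)) (summable_gaussSum hc') fun k x hx => ?_
    rw [norm_of_nonneg (exp_pos _).le, exp_le_exp]
    have : c / 2 < x := hx
    nlinarith [sq_nonneg ((k : ℝ) + 1)]
  exact (h.continuousAt (Ioi_mem_nhds (half_lt_self hc))).continuousWithinAt

section

variable {d : ℕ}

theorem continuousOn_boxHeat {a : Fin d → ℝ} (ha : ∀ i, 0 < a i) :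
    ContinuousOn (boxHeat a) (Set.Ioi 0) := by
  refine continuousOn_finsetProd _ fun i _ => ?_
  refine continuousOn_gaussSum.comp (f := fun τ => (π / a i) ^ 2 * τ)
    (Continuous.continuousOn (by fun_prop)) fun τ hτ => ?_
  have := ha i
  have : 0 < τ := hτ
  exact Set.mem_Ioi.2 (by positivity)

theorem continuousOn_boxMain (a : Fin d → ℝ) : ContinuousOn (boxMain a) (Set.Ioi 0) := by
  refine continuousOn_finsetProd _ fun i _ => ?_
  refine ContinuousOn.sub (ContinuousOn.div continuousOn_const ?_ fun τ hτ => ?_) continuousOn_const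
  · exact Continuous.continuousOn (by fun_prop)
  · have : 0 < τ := hτ
    positivity

/-- The sum over the `k`-element sets `S` of the products of the sides in `S`, divided by
`2 ^ (d - k)`. -/
def boxVolume (a : Fin d → ℝ) (k : ℕ) : ℝ :=
  1 / 2 ^ (d - k) * ∑ S ∈ powersetCard k (univ : Finset (Fin d)), ∏ j ∈ S, a j

theorem prod_mul_add_half (a : Fin d → ℝ) (x y : ℝ) :
    ∏ i, (a i * x + y / 2) = ∑ k ∈ range (d + 1), boxVolume a k * x ^ k * y ^ (d - k) := by
  classical
  rw [prod_add, sum_powerset, card_univ, Fintype.card_fin]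
  refine sum_congr rfl fun k _ => ?_
  rw [boxVolume, mul_assoc, mul_assoc, mul_comm, sum_mul, sum_mul]
  refine sum_congr rfl fun S hS => ?_
  have hS' := (mem_powersetCard.1 hS).2
  rw [prod_mul_distrib, prod_const, prod_const, card_sdiff_of_subset (subset_univ S), card_univ,
    Fintype.card_fin, hS', div_pow]
  ring

/-- The coefficient of `τ ^ (-k / 2)` in the small time expansion of the heat trace. -/
def boxCoeff (a : Fin d → ℝ) (k : ℕ) : ℝ :=
  boxVolume a k * (1 / (2 * √π)) ^ k * (-1) ^ (d - k)

theorem boxMain_eq_sum (a : Fin d → ℝ) (τ : ℝ) :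
    boxMain a τ = ∑ k ∈ range (d + 1), boxCoeff a k * (√τ)⁻¹ ^ k := by
  have h := prod_mul_add_half a (1 / (2 * √π) * (√τ)⁻¹) (-1)
  rw [boxMain]
  convert h using 1
  · refine prod_congr rfl fun i _ => ?_
    rw [sqrt_mul pi_pos.le]
    ring
  · refine sum_congr rfl fun k _ => ?_
    rw [boxCoeff, mul_pow]
    ring

theorem boxCoeff_zero (a : Fin d → ℝ) : boxCoeff a 0 = (-1) ^ d / 2 ^ d := by
  simp only [boxCoeff, boxVolume, powersetCard_zero, sum_singleton, prod_empty, tsub_zero, pow_zero]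
  ring

/-- The heat trace of the box minus its main term for `τ ≤ 1`. -/
def cutHeat (a : Fin d → ℝ) (τ : ℝ) : ℝ := boxHeat a τ - (Set.Ioc 0 1).indicator (boxMain a) τ

/-- Removing `boxMain` on `(0, 1]` leaves decay faster than any power at both ends, so the transform
is entire. -/
theorem mellin_cutHeat (hd : 1 ≤ d) {a : Fin d → ℝ} (ha : ∀ i, 0 < a i) (s : ℂ) :
    MellinConvergent (fun t => (cutHeat a t : ℂ)) s ∧
      DifferentiableAt ℂ (mellin fun t => (cutHeat a t : ℂ)) s := by
  have hloc : LocallyIntegrableOn (cutHeat a) (Set.Ioi 0) :=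
    LocallyIntegrableOn.sub ((continuousOn_boxHeat ha).locallyIntegrableOn measurableSet_Ioi)
      (locallyIntegrableOn_indicator_Ioc
        ((continuousOn_boxMain a).locallyIntegrableOn measurableSet_Ioi))
  obtain ⟨K, hK⟩ := exists_nat_gt (-s.re)
  obtain ⟨K', hK'⟩ := exists_nat_gt s.re
  obtain ⟨C, hC⟩ := exists_abs_boxHeat_sub_boxMain_le ha K
  obtain ⟨C', hC'⟩ := exists_boxHeat_le hd ha (K := K' + 1) (by lia)
  refine mellin_of_bounds hloc (K := K) (K' := K' + 1) (C := C) (C' := max C C') ?_ ?_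
    (by linarith) (by push_cast; linarith)
  · intro t h0 h1
    rw [cutHeat, Set.indicator_of_mem (show t ∈ Set.Ioc 0 1 from ⟨h0, h1⟩)]
    exact hC t h0 h1
  · intro t ht
    have ht0 : 0 < t := by linarith
    rcases eq_or_lt_of_le ht with h | h
    · rw [cutHeat, Set.indicator_of_mem (show t ∈ Set.Ioc 0 1 from ⟨ht0, h.ge⟩), ← h, one_pow,
        div_one]
      exact (hC 1 one_pos le_rfl).trans (by rw [one_pow, mul_one]; exact le_max_left _ _)
    · rw [cutHeat, Set.indicator_of_notMem (fun h' => absurd h'.2 (not_le.2 h)), sub_zero,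
        abs_of_nonneg (boxHeat_nonneg a t)]
      refine (hC' t ht).trans ?_
      gcongr
      exact le_max_right _ _

theorem hasMellin_finset_sum {ι : Type*} (S : Finset ι) {f : ι → ℝ → ℂ} {s : ℂ} {m : ι → ℂ}
    (h : ∀ i ∈ S, HasMellin (f i) s (m i)) : HasMellin (fun t => ∑ i ∈ S, f i t) s (∑ i ∈ S, m i) := by
  simp only [HasMellin, MellinConvergent, mellin, smul_sum]
  refine ⟨integrable_finsetSum _ fun i hi => (h i hi).1, ?_⟩
  rw [integral_finsetSum _ fun i hi => (h i hi).1]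
  exact sum_congr rfl fun i hi => (h i hi).2

/-- The term `τ ^ (-k/2)` removed on `(0, 1]` contributes the simple pole `1 / (s - k/2)`. -/
theorem hasMellin_boxHeat (hd : 1 ≤ d) {a : Fin d → ℝ} (ha : ∀ i, 0 < a i) {s : ℂ}
    (hs : (d : ℝ) / 2 < s.re) :
    HasMellin (fun t => (boxHeat a t : ℂ)) s (mellin (fun t => (cutHeat a t : ℂ)) s +
      ∑ k ∈ range (d + 1), (boxCoeff a k : ℂ) * (1 / (s - k / 2))) := by
  have h1 : ∀ k ∈ range (d + 1), HasMellin (fun t => (boxCoeff a k : ℂ) •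
      (Set.Ioc 0 1).indicator (fun t : ℝ => (t : ℂ) ^ (-(k / 2 : ℂ))) t) s
      ((boxCoeff a k : ℂ) • (1 / (s + -(k / 2 : ℂ)))) := by
    intro k hk
    have hk' : (k : ℝ) ≤ d := by exact_mod_cast Nat.lt_succ_iff.1 (mem_range.1 hk)
    have hre : ((k : ℂ) / 2).re = (k : ℝ) / 2 := by
      rw [show (k : ℂ) / 2 = ((k / 2 : ℝ) : ℂ) by push_cast; rfl, Complex.ofReal_re]
    have := hasMellin_cpow_Ioc (-(k / 2 : ℂ)) (s := s) (by rw [Complex.neg_re, hre]; linarith)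
    have h2 := hasMellin_const_smul this.1 (boxCoeff a k : ℂ)
    rwa [this.2] at h2
  have h2 := hasMellin_finset_sum _ h1
  have h3 := hasMellin_add (mellin_cutHeat hd ha s).1 h2.1
  rw [h2.2] at h3
  simp only [smul_eq_mul, ← sub_eq_add_neg] at h3
  have hcongr : ∀ t ∈ Set.Ioi (0 : ℝ), (cutHeat a t : ℂ) + ∑ k ∈ range (d + 1), (boxCoeff a k : ℂ) *
      (Set.Ioc 0 1).indicator (fun t : ℝ => (t : ℂ) ^ (-(k / 2 : ℂ))) t = (boxHeat a t : ℂ) := by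
    intro t ht
    have ht0 : 0 < t := ht
    by_cases h : t ∈ Set.Ioc (0 : ℝ) 1
    · simp only [cutHeat, Set.indicator_of_mem h]
      rw [boxMain_eq_sum]
      push_cast
      rw [sub_add, sub_eq_self, sub_eq_zero]
      refine sum_congr rfl fun k _ => ?_
      congr 1
      rw [show -(k / 2 : ℂ) = ((-(k / 2) : ℝ) : ℂ) by push_cast; rfl, ← Complex.ofReal_cpow ht0.le,
        ← Complex.ofReal_inv, ← Complex.ofReal_pow]
      congr 1
      rw [rpow_neg ht0.le, inv_pow, sqrt_eq_rpow, ← rpow_natCast, ← rpow_mul ht0.le]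
      congr 2
      ring
    · simp [cutHeat, Set.indicator_of_notMem h]
  refine ⟨?_, ?_⟩
  · refine (integrableOn_congr_fun (fun t ht => ?_) measurableSet_Ioi).1 h3.1
    simp only
    rw [hcongr t ht]
  · rw [← h3.2]
    refine setIntegral_congr_fun measurableSet_Ioi fun t ht => ?_
    simp only
    rw [hcongr t ht]

/-- The continuation of the zeta function of the box. -/
def boxZeta (a : Fin d → ℝ) (s : ℂ) : ℂ :=
  (Complex.Gamma (s + 1))⁻¹ * (s * (mellin (fun t => (cutHeat a t : ℂ)) s +
    ∑ k ∈ Icc 1 d, (boxCoeff a k : ℂ) / (s - k / 2)) + boxCoeff a 0)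

theorem boxZeta_eq (hd : 1 ≤ d) {a : Fin d → ℝ} (ha : ∀ i, 0 < a i) {s : ℂ}
    (hs : (d : ℝ) / 2 < s.re) :
    boxZeta a s = (Complex.Gamma s)⁻¹ * mellin (fun t => (boxHeat a t : ℂ)) s := by
  have hs0 : s ≠ 0 := by
    rintro rfl
    simp only [Complex.zero_re] at hs
    linarith [(Nat.cast_nonneg d : (0 : ℝ) ≤ d)]
  rw [(hasMellin_boxHeat hd ha hs).2, boxZeta, Complex.Gamma_add_one s hs0, range_eq_Ico,
    sum_eq_sum_Ico_succ_bot (Nat.succ_pos d)]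
  have : Ico (0 + 1) (d + 1) = Icc 1 d := by ext; simp
  rw [this]
  simp only [Nat.cast_zero, zero_div, sub_zero, mul_one_div]
  generalize ∑ k ∈ Icc 1 d, (boxCoeff a k : ℂ) / (s - k / 2) = S
  rw [mul_inv]
  field_simp
  ring

/-- The integrand of the formula for the logarithm of the zeta determinant. -/
def limitIntegrand (a : Fin d → ℝ) (τ : ℝ) : ℝ :=
  (boxHeat a τ - boxMain a τ + boxCoeff a 0 * (1 - exp (-τ))) / τ

/-- On `(0, 1]` the integrand is assembled from `cutHeat` and `cutExp`. On `(1, ∞)` the term `k = 0`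
of `boxMain` cancels against `boxCoeff a 0`, and the powers `τ ^ (-k/2)` with `k ≥ 1` integrate to
`2 / k`. -/
theorem integral_limitIntegrand (hd : 1 ≤ d) {a : Fin d → ℝ} (ha : ∀ i, 0 < a i) :
    ((∫ τ in Set.Ioi 0, limitIntegrand a τ : ℝ) : ℂ) =
      mellin (fun t => (cutHeat a t : ℂ)) 0 - boxCoeff a 0 * mellin (fun t => (cutExp t : ℂ)) 0 -
        ∑ k ∈ Icc 1 d, (boxCoeff a k : ℂ) * (2 / k) := by
  obtain ⟨i1, e1⟩ := mellin_ofReal_zero (mellin_cutHeat hd ha 0).1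
  obtain ⟨i2, e2⟩ := mellin_ofReal_zero (mellin_cutExp (s := 0) (by simp)).1
  have hpow : ∀ k ∈ Icc 1 d, IntegrableOn (fun t : ℝ => boxCoeff a k * t ^ (-(k / 2 : ℝ) - 1))
      (Set.Ioi 1) ∧ ∫ t in Set.Ioi (1 : ℝ), boxCoeff a k * t ^ (-(k / 2 : ℝ) - 1) =
        boxCoeff a k * (2 / k) := by
    intro k hk
    have hk0 : (0 : ℝ) < k := by exact_mod_cast (mem_Icc.1 hk).1
    have hlt : -(k / 2 : ℝ) - 1 < -1 := by linarith
    refine ⟨(integrableOn_Ioi_rpow_of_lt hlt one_pos).const_mul _, ?_⟩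
    rw [integral_const_mul, integral_Ioi_rpow_of_lt hlt one_pos, one_rpow, sub_add_cancel,
      neg_div_neg_eq, one_div_div]
  have i3 : IntegrableOn ((Set.Ioi 1).indicator fun t : ℝ => ∑ k ∈ Icc 1 d,
      boxCoeff a k * t ^ (-(k / 2 : ℝ) - 1)) (Set.Ioi 0) := by
    refine (integrable_indicator_iff measurableSet_Ioi).2 ?_ |>.integrableOn
    exact integrable_finsetSum _ fun k hk => (hpow k hk).1
  have e3 : ∫ t in Set.Ioi (0 : ℝ), (Set.Ioi 1).indicator (fun t : ℝ => ∑ k ∈ Icc 1 d,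
      boxCoeff a k * t ^ (-(k / 2 : ℝ) - 1)) t = ∑ k ∈ Icc 1 d, boxCoeff a k * (2 / k) := by
    rw [setIntegral_indicator measurableSet_Ioi, Set.inter_eq_right.2 (Set.Ioi_subset_Ioi zero_le_one),
      integral_finsetSum _ fun k hk => (hpow k hk).1]
    exact sum_congr rfl fun k hk => (hpow k hk).2
  rw [e1, e2]
  have i12 : IntegrableOn (fun t => cutHeat a t / t - boxCoeff a 0 * (cutExp t / t)) (Set.Ioi 0) :=
    i1.sub (i2.const_mul _)
  have key : ∫ τ in Set.Ioi 0, limitIntegrand a τ = (∫ t in Set.Ioi 0, cutHeat a t / t) -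
      boxCoeff a 0 * (∫ t in Set.Ioi 0, cutExp t / t) - ∑ k ∈ Icc 1 d, boxCoeff a k * (2 / k) := by
    rw [← e3, ← integral_const_mul, ← integral_sub i1 (i2.const_mul _),
      ← integral_sub i12 i3]
    refine setIntegral_congr_fun measurableSet_Ioi fun t ht => ?_
    have ht0 : 0 < t := ht
    simp only [limitIntegrand, cutHeat, cutExp]
    by_cases h : t ≤ 1
    · rw [Set.indicator_of_mem (show t ∈ Set.Ioc 0 1 from ⟨ht0, h⟩),
        Set.indicator_of_mem (show t ∈ Set.Ioc 0 1 from ⟨ht0, h⟩),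
        Set.indicator_of_notMem (show t ∉ Set.Ioi 1 from not_lt.2 h)]
      ring
    · rw [Set.indicator_of_notMem (fun h' => h h'.2), Set.indicator_of_notMem (fun h' => h h'.2),
        Set.indicator_of_mem (show t ∈ Set.Ioi 1 from not_le.1 h), boxMain_eq_sum, range_eq_Ico,
        sum_eq_sum_Ico_succ_bot (Nat.succ_pos d)]
      have : Ico (0 + 1) (d + 1) = Icc 1 d := by ext; simp
      have e : ∀ k : ℕ, boxCoeff a k * t ^ (-(k / 2 : ℝ) - 1) = boxCoeff a k * (√t)⁻¹ ^ k / t := by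
        intro k
        rw [rpow_sub_one ht0.ne', rpow_neg ht0.le, inv_pow, sqrt_eq_rpow, ← rpow_natCast,
          ← rpow_mul ht0.le, mul_div_assoc]
        congr 4
        ring
      rw [this, sum_congr rfl fun k _ => e k, ← sum_div]
      simp only [pow_zero]
      ring
  rw [key]
  push_cast
  rfl

theorem hasDerivAt_boxZeta (hd : 1 ≤ d) {a : Fin d → ℝ} (ha : ∀ i, 0 < a i) :
    HasDerivAt (boxZeta a) ((∫ τ in Set.Ioi 0, limitIntegrand a τ : ℝ) : ℂ) 0 := by
  have hΓ : HasDerivAt (fun s : ℂ => (Complex.Gamma (s + 1))⁻¹)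
      (-mellin (fun t => (cutExp t : ℂ)) 0) 0 := by
    have := hasDerivAt_Gamma_add_one.fun_inv (by simp)
    simpa using this
  have hM := (mellin_cutHeat hd ha 0).2.hasDerivAt
  have hS : DifferentiableAt ℂ (fun s : ℂ => ∑ k ∈ Icc 1 d, (boxCoeff a k : ℂ) / (s - k / 2)) 0 := by
    refine DifferentiableAt.fun_sum fun k hk => ?_
    have hk0 : (k : ℂ) ≠ 0 := by exact_mod_cast (by have := (mem_Icc.1 hk).1; lia : k ≠ 0)
    refine DifferentiableAt.div (differentiableAt_const _) (by fun_prop) ?_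
    simpa using hk0
  have h1 := ((hasDerivAt_id (0 : ℂ)).fun_mul (hM.fun_add hS.hasDerivAt)).add_const
    (boxCoeff a 0 : ℂ)
  have h2 := hΓ.fun_mul h1
  rw [integral_limitIntegrand hd ha]
  have e : ∑ k ∈ Icc 1 d, (boxCoeff a k : ℂ) * (2 / k) =
      -∑ k ∈ Icc 1 d, (boxCoeff a k : ℂ) / (0 - k / 2) := by
    rw [← sum_neg_distrib]
    refine sum_congr rfl fun k hk => ?_
    rw [zero_sub, div_neg, neg_neg, div_div_eq_mul_div, mul_div_assoc]
  have hv : ∀ M D : ℂ, mellin (fun t => (cutHeat a t : ℂ)) 0 -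
      boxCoeff a 0 * mellin (fun t => (cutExp t : ℂ)) 0 - -M =
      -mellin (fun t => (cutExp t : ℂ)) 0 *
        (id 0 * (mellin (fun t => (cutHeat a t : ℂ)) 0 + M) + boxCoeff a 0) +
      (Complex.Gamma (0 + 1))⁻¹ *
        (1 * (mellin (fun t => (cutHeat a t : ℂ)) 0 + M) + id 0 * D) := by
    intro M D
    simp only [id, zero_mul, zero_add, Complex.Gamma_one, inv_one]
    ring
  rw [e, hv]
  exact h2

theorem analyticAt_boxZeta (hd : 1 ≤ d) {a : Fin d → ℝ} (ha : ∀ i, 0 < a i) :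
    AnalyticAt ℂ (boxZeta a) 0 := by
  have hΓ : AnalyticAt ℂ (fun s : ℂ => (Complex.Gamma (s + 1))⁻¹) 0 :=
    (Complex.differentiable_one_div_Gamma.comp (differentiable_id.add_const 1)).analyticAt 0
  have hM : AnalyticAt ℂ (mellin fun t => (cutHeat a t : ℂ)) 0 :=
    Differentiable.analyticAt (fun s => (mellin_cutHeat hd ha s).2) 0
  have hS : AnalyticAt ℂ (fun s : ℂ => ∑ k ∈ Icc 1 d, (boxCoeff a k : ℂ) / (s - k / 2)) 0 := by
    refine Finset.analyticAt_fun_sum _ fun k hk => ?_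
    have hk0 : (k : ℂ) ≠ 0 := by exact_mod_cast (by have := (mem_Icc.1 hk).1; lia : k ≠ 0)
    exact analyticAt_const.fun_div (analyticAt_id.fun_sub analyticAt_const) (by simpa using hk0)
  exact hΓ.fun_mul ((analyticAt_id.fun_mul (hM.fun_add hS)).fun_add analyticAt_const)

theorem meromorphic_boxZeta (hd : 1 ≤ d) {a : Fin d → ℝ} (ha : ∀ i, 0 < a i) :
    Meromorphic (boxZeta a) := by
  intro s
  have hΓ : MeromorphicAt (fun s : ℂ => (Complex.Gamma (s + 1))⁻¹) s :=
    ((Complex.differentiable_one_div_Gamma.comp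
      (differentiable_id.add_const 1)).analyticAt s).meromorphicAt
  have hM : MeromorphicAt (mellin fun t => (cutHeat a t : ℂ)) s :=
    (Differentiable.analyticAt (fun s => (mellin_cutHeat hd ha s).2) s).meromorphicAt
  have hS : MeromorphicAt (fun s : ℂ => ∑ k ∈ Icc 1 d, (boxCoeff a k : ℂ) / (s - k / 2)) s := by
    refine MeromorphicAt.fun_sum fun k _ => ?_
    exact (MeromorphicAt.const _ _).fun_div ((MeromorphicAt.id s).fun_sub (MeromorphicAt.const _ _))
  exact hΓ.fun_mul (((MeromorphicAt.id s).fun_mul (hM.fun_add hS)).fun_add (MeromorphicAt.const _ _))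

theorem mellin_theta_eq (hd : 1 ≤ d) {a : Fin d → ℝ} (ha : ∀ i, 0 < a i) (s : ℂ) :
    mellin (fun t => (theta a t : ℂ)) s = mellin (fun t => (boxHeat a t : ℂ)) s :=
  setIntegral_congr_fun measurableSet_Ioi fun t ht => by
    simp only [theta_eq_boxHeat hd ha ht]

theorem hasLogZetaDet (hd : 1 ≤ d) {a : Fin d → ℝ} (ha : ∀ i, 0 < a i) :
    HasLogZetaDet a (-∫ τ in Set.Ioi 0, limitIntegrand a τ) where
  finiteDimensional μ :=
    have := finite_waveNumbers ha μ
    finiteDimensional_dirichletEigenspace hd ha μ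
  summable_theta _ ht := (hasSum_dirichletMultiplicity hd ha ht).summable
  mellinConvergent s hs := by
    refine (integrableOn_congr_fun (fun t ht => ?_) measurableSet_Ioi).1 (hasMellin_boxHeat hd ha hs).1
    simp only [theta_eq_boxHeat hd ha ht]
  exists_continuation := by
    refine ⟨boxZeta a, meromorphic_boxZeta hd ha, analyticAt_boxZeta hd ha, fun s hs => ?_, ?_⟩
    · rw [mellin_theta_eq hd ha, boxZeta_eq hd ha hs]
    · rw [(hasDerivAt_boxZeta hd ha).deriv]
      push_cast
      rw [neg_neg]

/-! ### Uniqueness of the continued zeta function -/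

theorem Meromorphic.eventuallyEq_of_eqOn_halfPlane {f g : ℂ → ℂ} (hf : Meromorphic f)
    (hg : Meromorphic g) {c : ℝ} (h : ∀ s : ℂ, c < s.re → f s = g s) {z : ℂ}
    (hfz : AnalyticAt ℂ f z) (hgz : AnalyticAt ℂ g z) : f =ᶠ[𝓝 z] g := by
  have hm : Meromorphic (f - g) := hf.sub hg
  have htop : meromorphicOrderAt (f - g) ((c + 1 : ℝ) : ℂ) = ⊤ := by
    rw [meromorphicOrderAt_eq_top_iff]
    refine nhdsWithin_le_nhds ?_
    have ho : IsOpen {s : ℂ | c < s.re} := isOpen_lt continuous_const Complex.continuous_re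
    filter_upwards [ho.mem_nhds (show c < (((c + 1 : ℝ) : ℂ)).re by simp)] with s hs
    rw [Pi.sub_apply, h s hs, sub_self]
  -- Infinite order at one point of the connected plane propagates to every point.
  have hz : meromorphicOrderAt (f - g) z = ⊤ := by
    by_contra hne
    exact (hm.exists_meromorphicOrderAt_ne_top_iff_forall.1 ⟨z, hne⟩) _ htop
  rw [meromorphicOrderAt_eq_top_iff] at hz
  have h1 : ∃ᶠ s in 𝓝[≠] z, f s = g s :=
    (hz.mono fun s hs => sub_eq_zero.1 hs).frequently
  exact (hfz.frequently_eq_iff_eventually_eq hgz).1 h1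

theorem HasLogZetaDet.eq_neg_integral (hd : 1 ≤ d) {a : Fin d → ℝ} (ha : ∀ i, 0 < a i) {L : ℝ}
    (hL : HasLogZetaDet a L) : L = -∫ τ in Set.Ioi 0, limitIntegrand a τ := by
  obtain ⟨Z, hZ, hZ0, hZs, hZd⟩ := hL.exists_continuation
  have h := Meromorphic.eventuallyEq_of_eqOn_halfPlane hZ (meromorphic_boxZeta hd ha)
    (c := (d : ℝ) / 2) (fun s hs => by rw [hZs s hs, mellin_theta_eq hd ha, boxZeta_eq hd ha hs])
    hZ0 (analyticAt_boxZeta hd ha)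
  rw [h.deriv_eq, (hasDerivAt_boxZeta hd ha).deriv] at hZd
  have : (∫ τ in Set.Ioi 0, limitIntegrand a τ) = -L := by exact_mod_cast hZd
  rw [this, neg_neg]

end

end DirichletBox

end

noncomputable section

namespace DirichletBox

open Real Finset Filter Topology MeasureTheory

/-! ### Integrability -/

theorem measurable_besselI0 : Measurable besselI0 := by
  have hs : ∀ x : ℝ, Summable fun k : ℕ => (x / 2) ^ (2 * k) / (k.factorial : ℝ) ^ 2 := by
    intro x
    refine Summable.of_nonneg_of_le (fun k => ?_) (fun k => ?_)
      (Real.summable_pow_div_factorial ((x / 2) ^ 2))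
    · rw [pow_mul]; positivity
    · rw [pow_mul]
      have h1 : (1 : ℝ) ≤ k.factorial := by exact_mod_cast k.factorial_pos
      exact div_le_div_of_nonneg_left (by positivity) (by positivity)
        (le_self_pow₀ h1 two_ne_zero)
  refine measurable_of_tendsto_metrizable
    (f := fun m x => ∑ k ∈ range m, (x / 2) ^ (2 * k) / (k.factorial : ℝ) ^ 2)
    (fun m => by fun_prop) ?_
  exact tendsto_pi_nhds.2 fun x => (hs x).hasSum.tendsto_sum_nat

@[fun_prop]
theorem measurable_besselKernel : Measurable besselKernel := by
  unfold besselKernel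
  exact (by fun_prop : Measurable fun t : ℝ => exp (-2 * t)).mul
    (measurable_besselI0.comp (by fun_prop))

@[fun_prop]
theorem measurable_pathTheta (n : ℕ) : Measurable (pathTheta n) := by
  unfold pathTheta
  fun_prop

@[fun_prop]
theorem measurable_pathMain (n : ℕ) : Measurable (pathMain n) := by
  unfold pathMain
  fun_prop

/-- A uniform bound `besselKernel t ≤ C / √t`, used for decay at large time: the limit is less than
`1`, and before it sets in the kernel is at most `1`. -/
theorem exists_mul_besselKernel_sq_le : ∃ C, 0 ≤ C ∧ ∀ u, 0 ≤ u → u * besselKernel (u ^ 2) ≤ C := by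
  have hlt : 1 / (2 * √π) < 1 := by
    rw [div_lt_one (by positivity)]
    have : 1 ≤ √π := one_le_sqrt.2 (by linarith [pi_gt_three])
    linarith
  obtain ⟨v, hv⟩ := eventually_atTop.1 (tendsto_mul_besselKernel_sq.eventually_lt_const hlt)
  refine ⟨max 1 v, by positivity, fun u hu => ?_⟩
  rcases le_total v u with h | h
  · exact (hv u h).le.trans (le_max_left _ _)
  · calc u * besselKernel (u ^ 2) ≤ u * 1 :=
          mul_le_mul_of_nonneg_left (besselKernel_le_one (by positivity)) hu
      _ ≤ max 1 v := by rw [mul_one]; exact h.trans (le_max_right _ _)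

/-- A bounded function on `(0, 1]` continued by a multiple of `t ^ (-3/2)`. -/
def tailBound (C C' t : ℝ) : ℝ :=
  (Set.Ioc 0 1).indicator (fun _ => C) t +
    (Set.Ioi 1).indicator (fun t : ℝ => C' * t ^ (-(3 / 2) : ℝ)) t

theorem integrableOn_tailBound (C C' : ℝ) : IntegrableOn (tailBound C C') (Set.Ioi 0) := by
  refine Integrable.integrableOn (Integrable.add ?_ ?_)
  · exact (integrable_indicator_iff measurableSet_Ioc).2 (by simp)
  · exact (integrable_indicator_iff measurableSet_Ioi).2
      ((integrableOn_Ioi_rpow_of_lt (by norm_num) one_pos).const_mul _)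

theorem abs_le_tailBound {C C' t x : ℝ} (ht : 0 < t) (h0 : t ≤ 1 → |x| ≤ C * t)
    (h1 : 1 ≤ t → |x| ≤ C' * (1 / √t)) : |x / t| ≤ tailBound C C' t := by
  rw [abs_div, abs_of_pos ht, div_le_iff₀ ht, tailBound]
  by_cases h : t ≤ 1
  · rw [Set.indicator_of_mem (show t ∈ Set.Ioc 0 1 from ⟨ht, h⟩),
      Set.indicator_of_notMem (show t ∉ Set.Ioi 1 from not_lt.2 h), add_zero]
    exact h0 h
  · rw [Set.indicator_of_notMem (fun h' => h h'.2),
      Set.indicator_of_mem (show t ∈ Set.Ioi 1 from not_le.1 h), zero_add]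
    refine (h1 (not_le.1 h).le).trans_eq ?_
    rw [mul_assoc, ← rpow_add_one ht.ne', sqrt_eq_rpow, one_div, ← rpow_neg ht.le]
    norm_num

theorem exp_neg_le_one_div_sqrt {t : ℝ} (ht : 1 ≤ t) : exp (-t) ≤ 1 / √t := by
  have h := exp_neg_le_factorial_div (zero_lt_one.trans_le ht) 1
  simp only [Nat.factorial_one, Nat.cast_one, pow_one] at h
  refine h.trans (div_le_div_of_nonneg_left zero_le_one (by positivity) ?_)
  exact sqrt_le_iff.2 ⟨by positivity, le_self_pow₀ ht two_ne_zero⟩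

theorem bulkIntegrand_zero (d i : ℕ) (t : ℝ) : bulkIntegrand d i 0 t =
    ((-1 - exp (-4 * t)) ^ (d - i) * besselKernel t ^ i - (-2) ^ (d - i) * exp (-t)) / t := by
  rw [bulkIntegrand, besselKernel, mul_pow, ← exp_nat_mul, mul_assoc (_ ^ (d - i)),
    mul_assoc (_ ^ (d - i))]
  congr 4
  rw [← mul_assoc, ← exp_add]
  congr 2
  ring

/-- At `t = 0` the numerator vanishes to first order, since the kernel is `1` and `-1 - e^{-4t}` is
`-2` there. At infinity, `i ≥ 1` supplies at least one factor of size `1 / √t`. -/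
theorem integrableOn_bulkIntegrand {d i : ℕ} (hi : 1 ≤ i) :
    IntegrableOn (bulkIntegrand d i 0) (Set.Ioi 0) := by
  obtain ⟨C, hC, hK⟩ := exists_mul_besselKernel_sq_le
  rw [show bulkIntegrand d i 0 = fun t => ((-1 - exp (-4 * t)) ^ (d - i) * besselKernel t ^ i -
    (-2) ^ (d - i) * exp (-t)) / t from funext (bulkIntegrand_zero d i)]
  generalize d - i = m
  refine (integrableOn_tailBound (m * 2 ^ (m - 1) * 4 + 2 ^ m * (2 * i + 1))
    (2 ^ m * (C + 1))).mono' (Measurable.aestronglyMeasurable (by fun_prop)) ?_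
  refine (ae_restrict_iff' measurableSet_Ioi).2 (ae_of_all _ fun t ht => ?_)
  have ht0 : 0 < t := ht
  have hE : exp (-4 * t) ≤ 1 := exp_le_one_iff.2 (by linarith)
  have hE0 : 0 < exp (-4 * t) := exp_pos _
  have hE1 : 1 - 4 * t ≤ exp (-4 * t) := by linarith [add_one_le_exp (-4 * t)]
  have hx : |-1 - exp (-4 * t)| ≤ 2 := abs_le.2 ⟨by linarith, by linarith⟩
  have hK0 := besselKernel_nonneg t
  have hK1 := besselKernel_le_one ht0.le
  refine abs_le_tailBound ht0 (fun h1 => ?_) fun h1 => ?_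
  · have hKi : 1 - 2 * i * t ≤ besselKernel t ^ i := by
      have h2 := one_add_mul_sub_le_pow (a := besselKernel t) (by linarith) i
      have h3 := mul_le_mul_of_nonneg_left (one_sub_two_mul_le_besselKernel t)
        (Nat.cast_nonneg i : (0 : ℝ) ≤ i)
      linarith
    have hKi1 : besselKernel t ^ i ≤ 1 := pow_le_one₀ hK0 hK1
    have hKi0 : 0 ≤ besselKernel t ^ i := pow_nonneg hK0 _
    have e1 : exp (-t) ≤ 1 := exp_le_one_iff.2 (by linarith)
    have e2 : 1 - t ≤ exp (-t) := by linarith [add_one_le_exp (-t)]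
    have hit : 0 ≤ 2 * (i : ℝ) * t := by positivity
    have h2 : |(-1 - exp (-4 * t)) ^ m - (-2) ^ m| ≤ m * 2 ^ (m - 1) * (4 * t) := by
      refine (abs_pow_sub_pow_le _ _ m).trans ?_
      have : max |-1 - exp (-4 * t)| |(-2 : ℝ)| ≤ 2 := max_le hx (by norm_num)
      have h4 : |-1 - exp (-4 * t) - -2| ≤ 4 * t := abs_le.2 ⟨by linarith, by linarith⟩
      calc |-1 - exp (-4 * t) - -2| * m * max |-1 - exp (-4 * t)| |(-2 : ℝ)| ^ (m - 1)
          ≤ (4 * t) * m * 2 ^ (m - 1) := by gcongr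
        _ = _ := by ring
    have h3 : |besselKernel t ^ i - exp (-t)| ≤ (2 * i + 1) * t :=
      abs_le.2 ⟨by linarith, by linarith⟩
    calc |(-1 - exp (-4 * t)) ^ m * besselKernel t ^ i - (-2) ^ m * exp (-t)|
        = |((-1 - exp (-4 * t)) ^ m - (-2) ^ m) * besselKernel t ^ i +
            (-2) ^ m * (besselKernel t ^ i - exp (-t))| := by congr 1; ring
      _ ≤ |(-1 - exp (-4 * t)) ^ m - (-2) ^ m| * besselKernel t ^ i +
            2 ^ m * |besselKernel t ^ i - exp (-t)| := by
          refine (abs_add_le _ _).trans_eq ?_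
          rw [abs_mul, abs_mul, abs_of_nonneg hKi0, abs_pow, abs_neg, abs_two]
      _ ≤ m * 2 ^ (m - 1) * (4 * t) * 1 + 2 ^ m * ((2 * i + 1) * t) := by gcongr
      _ = _ := by ring
  · have hs : 0 < √t := sqrt_pos.2 ht0
    have hKC : besselKernel t ≤ C * (1 / √t) := by
      have := hK (√t) hs.le
      rw [sq_sqrt ht0.le] at this
      rw [mul_one_div, le_div_iff₀ hs]
      linarith
    have hKi : besselKernel t ^ i ≤ C * (1 / √t) :=
      (pow_le_of_le_one hK0 hK1 (by lia)).trans hKC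
    calc |(-1 - exp (-4 * t)) ^ m * besselKernel t ^ i - (-2) ^ m * exp (-t)|
        ≤ |-1 - exp (-4 * t)| ^ m * besselKernel t ^ i + 2 ^ m * exp (-t) := by
          refine (abs_sub _ _).trans_eq ?_
          rw [abs_mul, abs_mul, abs_pow, abs_pow, abs_pow, abs_neg, abs_two, abs_of_nonneg hK0,
            abs_of_pos (exp_pos _)]
      _ ≤ 2 ^ m * (C * (1 / √t)) + 2 ^ m * (1 / √t) := by
          have := exp_neg_le_one_div_sqrt h1
          gcongr
      _ = _ := by ring

/-! ### Frullani integrals -/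

/-- The tangent line inequality bounds the integrand by `|c - 1| (e^{-t} + e^{-ct})`. -/
theorem integrableOn_exp_sub_exp_div {c : ℝ} (hc : 0 < c) :
    IntegrableOn (fun t => (exp (-t) - exp (-c * t)) / t) (Set.Ioi 0) := by
  have h1 : IntegrableOn (fun t => exp (-1 * t)) (Set.Ioi 0) := exp_neg_integrableOn_Ioi 0 one_pos
  have h2 : IntegrableOn (fun t => exp (-c * t)) (Set.Ioi 0) := exp_neg_integrableOn_Ioi 0 hc
  refine ((h1.add h2).const_mul |c - 1|).mono' (Measurable.aestronglyMeasurable (by fun_prop)) ?_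
  refine (ae_restrict_iff' measurableSet_Ioi).2 (ae_of_all _ fun t ht => ?_)
  have ht0 : 0 < t := ht
  have hsub : ∀ x y : ℝ, exp (-x) - exp (-y) ≤ (y - x) * exp (-x) := by
    intro x y
    have h := mul_le_mul_of_nonneg_left (add_one_le_exp (x - y)) (exp_pos (-x)).le
    rw [← exp_add, show -x + (x - y) = -y by ring] at h
    linarith
  have ha := hsub t (c * t)
  have hb := hsub (c * t) t
  simp only [Pi.add_apply, norm_eq_abs]
  rw [abs_div, abs_of_pos ht0, div_le_iff₀ ht0]
  have p1 := exp_pos (-t)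
  have p2 := exp_pos (-(c * t))
  rw [neg_mul, neg_mul, one_mul]
  have q1 : (c - 1) * t * exp (-t) ≤ |c - 1| * t * exp (-t) := by
    gcongr; exact le_abs_self _
  have q2 : (1 - c) * t * exp (-(c * t)) ≤ |c - 1| * t * exp (-(c * t)) := by
    gcongr; rw [abs_sub_comm]; exact le_abs_self _
  have q3 : 0 ≤ |c - 1| * t * exp (-t) := by positivity
  have q4 : 0 ≤ |c - 1| * t * exp (-(c * t)) := by positivity
  exact abs_le.2 ⟨by linarith, by linarith⟩

theorem integral_exp_sub_exp_div {c : ℝ} (hc : 0 < c) :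
    ∫ t in Set.Ioi 0, (exp (-t) - exp (-c * t)) / t = log c := by
  have e : ∀ t : ℝ, (exp (-t) - exp (-c * t)) / t = t⁻¹ • (exp (-(1 * t)) - exp (-(c * t))) := by
    intro t
    rw [smul_eq_mul, one_mul, neg_mul, inv_mul_eq_div]
  have hi := integrableOn_exp_sub_exp_div hc
  simp only [e] at hi ⊢
  have hcont : Continuous fun t : ℝ => exp (-t) := by fun_prop
  have h0 : Tendsto (fun t : ℝ => exp (-t)) (𝓝[>] 0) (𝓝 1) := by
    have := (hcont.tendsto 0).mono_left (nhdsWithin_le_nhds (s := Set.Ioi 0))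
    rwa [neg_zero, exp_zero] at this
  have := Frullani.integral_Ioi_eq (f := fun t : ℝ => exp (-t))
    (hcont.locallyIntegrable.locallyIntegrableOn _) one_pos hc h0 (tendsto_exp_neg_atTop_nhds_zero) hi
  simpa using this

end DirichletBox

end

noncomputable section

namespace DirichletBox

open Real Finset Filter Topology MeasureTheory

variable {d : ℕ}

/-! ### The exact formula for the logarithm of the determinant -/

/-- Frullani's integral summed over the spectrum; the product of the `n i - 1` is the number of
eigenvalues. -/
theorem integral_latticeHeat (hd : 1 ≤ d) {n : Fin d → ℕ} (hn : ∀ i, 1 ≤ n i) :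
    IntegrableOn (fun t => (latticeHeat n t - (∏ i, ((n i : ℝ) - 1)) * exp (-t)) / t) (Set.Ioi 0) ∧
      ∫ t in Set.Ioi 0, (latticeHeat n t - (∏ i, ((n i : ℝ) - 1)) * exp (-t)) / t =
        -log (discreteDirichletLaplacian n).det := by
  have e : ∀ t, (latticeHeat n t - (∏ i, ((n i : ℝ) - 1)) * exp (-t)) / t =
      -∑ k ∈ Fintype.piFinset fun i => Ico 1 (n i),
        (exp (-t) - exp (-discreteEigenvalue n k * t)) / t := by
    intro t
    rw [← sum_div, sum_sub_distrib, sum_exp_discreteEigenvalue, sum_const, Fintype.card_piFinset,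
      nsmul_eq_mul, latticeHeat, Nat.cast_prod,
      prod_congr rfl fun i _ => show ((#(Ico 1 (n i)) : ℕ) : ℝ) = (n i : ℝ) - 1 by
        rw [Nat.card_Ico, Nat.cast_sub (hn i), Nat.cast_one]]
    ring
  have hi : ∀ k ∈ Fintype.piFinset fun i => Ico 1 (n i), IntegrableOn
      (fun t => (exp (-t) - exp (-discreteEigenvalue n k * t)) / t) (Set.Ioi 0) := fun k hk =>
    integrableOn_exp_sub_exp_div (discreteEigenvalue_pos hd hk)
  simp only [e]
  refine ⟨(integrable_finsetSum _ hi).neg, ?_⟩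
  rw [integral_neg, integral_finsetSum _ hi, det_discreteDirichletLaplacian hn,
    log_prod fun k hk => (discreteEigenvalue_pos hd hk).ne']
  congr 1
  exact sum_congr rfl fun k hk => integral_exp_sub_exp_div (discreteEigenvalue_pos hd hk)

theorem sum_faceVolume (n : Fin d → ℕ) (x y : ℝ) : ∏ i, (n i * x + y / 2) =
    y ^ d / 2 ^ d + ∑ k ∈ Icc 1 d, faceVolume n k * x ^ k * y ^ (d - k) := by
  rw [prod_mul_add_half, range_eq_Ico, sum_eq_sum_Ico_succ_bot (Nat.succ_pos d)]
  have : Ico (0 + 1) (d + 1) = Icc 1 d := by ext; simp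
  rw [this]
  congr 1
  simp only [boxVolume, powersetCard_zero, sum_singleton, prod_empty, tsub_zero, pow_zero]
  ring

theorem two_pow_eq_one_add_sum (d : ℕ) : (2 : ℝ) ^ d = 1 + ∑ i ∈ Icc 1 d, (d.choose i : ℝ) := by
  have h : (2 : ℝ) ^ d = ∑ i ∈ range (d + 1), (d.choose i : ℝ) := by
    exact_mod_cast (Nat.sum_range_choose d).symm
  rw [h, range_eq_Ico, sum_eq_sum_Ico_succ_bot (Nat.succ_pos d), Nat.choose_zero_right,
    Nat.cast_one]
  have : Ico (0 + 1) (d + 1) = Icc 1 d := by ext; simp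
  rw [this]

theorem one_add_exp_pow (d : ℕ) (t : ℝ) : (1 + exp (-4 * t)) ^ d =
    1 + ∑ i ∈ Icc 1 d, (d.choose i : ℝ) * exp (-(4 * i) * t) := by
  rw [add_comm, add_pow, range_eq_Ico, sum_eq_sum_Ico_succ_bot (Nat.succ_pos d)]
  have : Ico (0 + 1) (d + 1) = Icc 1 d := by ext; simp
  rw [this]
  congr 1
  · simp
  · refine sum_congr rfl fun i _ => ?_
    rw [one_pow, mul_one, ← exp_nat_mul, mul_comm]
    congr 2
    ring

/-- The integrand of the formula for the logarithm of the determinant after removal of the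
explicit terms. -/
def remainderIntegrand (n : Fin d → ℕ) (c t : ℝ) : ℝ :=
  (latticeHeat n t - latticeMain n t + (-1) ^ d / 2 ^ d * (1 - exp (-c * t))) / t

theorem remainderIntegrand_eq (n : Fin d → ℕ) (c t : ℝ) : remainderIntegrand n c t =
    (latticeHeat n t - (∏ i, ((n i : ℝ) - 1)) * exp (-t)) / t -
      ∑ k ∈ Icc 1 d, faceVolume n k * bulkIntegrand d k 0 t +
      (-1) ^ d / 2 ^ d * (∑ i ∈ Icc 1 d, (d.choose i : ℝ) *
        ((exp (-t) - exp (-(4 * i) * t)) / t) + (exp (-t) - exp (-c * t)) / t) := by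
  have h1 : latticeMain n t = (-1) ^ d / 2 ^ d *
      (1 + ∑ i ∈ Icc 1 d, (d.choose i : ℝ) * exp (-(4 * i) * t)) +
      ∑ k ∈ Icc 1 d, faceVolume n k * besselKernel t ^ k * (-1 - exp (-4 * t)) ^ (d - k) := by
    rw [← one_add_exp_pow, div_mul_eq_mul_div, ← mul_pow,
      show (-1 : ℝ) * (1 + exp (-4 * t)) = -1 - exp (-4 * t) by ring, ← sum_faceVolume]
    simp only [latticeMain, pathMain]
    exact prod_congr rfl fun i _ => add_comm _ _
  have h2 : ∏ i, ((n i : ℝ) - 1) = (-1) ^ d / 2 ^ d * (1 + ∑ i ∈ Icc 1 d, (d.choose i : ℝ)) +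
      ∑ k ∈ Icc 1 d, faceVolume n k * (-2) ^ (d - k) := by
    -- The number of eigenvalues is the main-term polynomial at `t = 0`, where the kernel is `1` and
    -- `-1 - e^{-4t}` is `-2`. Hence it supplies exactly the `e^{-t}` counterterms of the bulk
    -- integrands.
    have h := sum_faceVolume n 1 (-2)
    simp only [one_pow, mul_one] at h
    rw [← two_pow_eq_one_add_sum, div_mul_eq_mul_div, ← mul_pow, neg_one_mul, ← h]
    exact prod_congr rfl fun i _ => by ring
  have h3 : ∑ k ∈ Icc 1 d, faceVolume n k * bulkIntegrand d k 0 t =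
      (∑ k ∈ Icc 1 d, faceVolume n k * besselKernel t ^ k * (-1 - exp (-4 * t)) ^ (d - k) -
        (∑ k ∈ Icc 1 d, faceVolume n k * (-2) ^ (d - k)) * exp (-t)) / t := by
    rw [sum_mul, ← sum_sub_distrib, sum_div]
    refine sum_congr rfl fun k _ => ?_
    rw [bulkIntegrand_zero]
    ring
  have h4 : ∑ i ∈ Icc 1 d, (d.choose i : ℝ) * ((exp (-t) - exp (-(4 * i) * t)) / t) =
      ((∑ i ∈ Icc 1 d, (d.choose i : ℝ)) * exp (-t) -
        ∑ i ∈ Icc 1 d, (d.choose i : ℝ) * exp (-(4 * i) * t)) / t := by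
    rw [sum_mul, ← sum_sub_distrib, sum_div]
    exact sum_congr rfl fun k _ => by ring
  rw [remainderIntegrand, h1, h2, h3, h4]
  ring

theorem log_det_eq (hd : 1 ≤ d) {n : Fin d → ℕ} (hn : ∀ i, 1 ≤ n i) {u : ℝ} (hu : 0 < u) :
    log (discreteDirichletLaplacian n).det =
      (∑ i ∈ Icc 1 d, faceVolume n i * bulkConstant d i 0) - (-1) ^ d / 2 ^ d * log (u ^ 2) +
        (-1) ^ d / 2 ^ d * ∑ i ∈ Icc 1 d, log (4 * (i : ℝ)) * (d.choose i : ℝ) -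
        ∫ t in Set.Ioi 0, remainderIntegrand n (u ^ 2)⁻¹ t := by
  obtain ⟨i1, e1⟩ := integral_latticeHeat hd hn
  have i2 : ∀ k ∈ Icc 1 d, IntegrableOn (fun t => faceVolume n k * bulkIntegrand d k 0 t)
      (Set.Ioi 0) := fun k hk => (integrableOn_bulkIntegrand (mem_Icc.1 hk).1).const_mul _
  have hpos : ∀ i ∈ Icc 1 d, (0 : ℝ) < 4 * i := fun i hi => by
    have : (0 : ℝ) < i := by exact_mod_cast (mem_Icc.1 hi).1
    positivity
  have i3 : ∀ i ∈ Icc 1 d, IntegrableOn (fun t => (d.choose i : ℝ) *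
      ((exp (-t) - exp (-(4 * i) * t)) / t)) (Set.Ioi 0) := fun i hi =>
    (integrableOn_exp_sub_exp_div (hpos i hi)).const_mul _
  have hu2 : 0 < (u ^ 2)⁻¹ := by positivity
  have i4 := integrableOn_exp_sub_exp_div hu2
  have s2 := integrable_finsetSum _ i2
  have s3 := integrable_finsetSum _ i3
  have e2 : ∫ t in Set.Ioi 0, ∑ k ∈ Icc 1 d, faceVolume n k * bulkIntegrand d k 0 t =
      -∑ k ∈ Icc 1 d, faceVolume n k * bulkConstant d k 0 := by
    rw [integral_finsetSum _ i2, ← sum_neg_distrib]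
    refine sum_congr rfl fun k _ => ?_
    rw [integral_const_mul, bulkConstant, mul_neg, neg_neg]
  have e3 : ∫ t in Set.Ioi 0, ∑ i ∈ Icc 1 d, (d.choose i : ℝ) *
      ((exp (-t) - exp (-(4 * i) * t)) / t) = ∑ i ∈ Icc 1 d, log (4 * (i : ℝ)) * d.choose i := by
    rw [integral_finsetSum _ i3]
    refine sum_congr rfl fun i hi => ?_
    rw [integral_const_mul, integral_exp_sub_exp_div (hpos i hi), mul_comm]
  have e4 := integral_exp_sub_exp_div hu2
  rw [log_inv] at e4
  simp only [remainderIntegrand_eq]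
  have i12 : IntegrableOn (fun t => (latticeHeat n t - (∏ i, ((n i : ℝ) - 1)) * exp (-t)) / t -
      ∑ k ∈ Icc 1 d, faceVolume n k * bulkIntegrand d k 0 t) (Set.Ioi 0) := i1.sub s2
  have i34 : IntegrableOn (fun t => (-1 : ℝ) ^ d / 2 ^ d * (∑ i ∈ Icc 1 d, (d.choose i : ℝ) *
      ((exp (-t) - exp (-(4 * i) * t)) / t) + (exp (-t) - exp (-(u ^ 2)⁻¹ * t)) / t))
      (Set.Ioi 0) := (s3.add i4).const_mul _
  rw [integral_add i12 i34, integral_sub i1 s2, integral_const_mul,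
    integral_add s3 i4, e1, e2, e3, e4]
  ring

/-! ### The limit -/

theorem integral_remainderIntegrand (n : Fin d → ℕ) {u : ℝ} (hu : 0 < u) :
    ∫ t in Set.Ioi 0, remainderIntegrand n (u ^ 2)⁻¹ t = ∫ τ in Set.Ioi 0,
      (latticeHeat n (u ^ 2 * τ) - latticeMain n (u ^ 2 * τ) +
        (-1) ^ d / 2 ^ d * (1 - exp (-τ))) / τ := by
  have hu2 : 0 < u ^ 2 := by positivity
  have h := integral_comp_mul_left_Ioi (remainderIntegrand n (u ^ 2)⁻¹) 0 hu2
  rw [mul_zero, smul_eq_mul] at h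
  have h' := (eq_inv_mul_iff_mul_eq₀ hu2.ne').1 h
  rw [← h', ← integral_const_mul]
  refine integral_congr_ae (ae_of_all _ fun τ => ?_)
  simp only [remainderIntegrand]
  rw [neg_mul, inv_mul_cancel_left₀ hu2.ne']
  field_simp

/-- At large rescaled time each factor of the main term approaches `-1/2` at rate `1 / √τ`,
uniformly in `u`. Only the degree-zero constant survives, and the remainder integrand subtracts it.
-/
theorem exists_abs_latticeMain_sub_le (d : ℕ) {B : ℝ} (hB : 1 ≤ B) :
    ∃ C, ∀ (n : Fin d → ℕ) (u τ : ℝ), 1 ≤ u → (∀ i, n i ≤ B * u) → 1 ≤ τ →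
      |latticeMain n (u ^ 2 * τ) - (-1) ^ d / 2 ^ d| ≤ C * (1 / √τ) := by
  obtain ⟨C, hC, hK⟩ := exists_mul_besselKernel_sq_le
  refine ⟨d * ((B * C + 1) ^ d * (B * C + 1)), fun n u τ hu hn hτ => ?_⟩
  have hτ0 : 0 < τ := by linarith
  have hs1 : 1 ≤ √τ := one_le_sqrt.2 hτ
  have hs : 0 < √τ := by linarith
  have hsi : 1 / √τ ≤ 1 := (div_le_one hs).2 hs1
  have hBC : 0 ≤ B * C := by positivity
  have hu2 : 1 ≤ u ^ 2 := one_le_pow₀ hu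
  have hKt : u * besselKernel (u ^ 2 * τ) ≤ C * (1 / √τ) := by
    have h := hK (u * √τ) (by positivity)
    rw [mul_pow, sq_sqrt hτ0.le] at h
    rw [mul_one_div, le_div_iff₀ hs]
    linarith
  have hE : exp (-4 * (u ^ 2 * τ)) ≤ 1 / √τ := by
    refine (exp_le_exp.2 ?_).trans (exp_neg_le_one_div_sqrt hτ)
    nlinarith
  have hnK : ∀ i, n i * besselKernel (u ^ 2 * τ) ≤ B * C * (1 / √τ) := fun i =>
    calc n i * besselKernel (u ^ 2 * τ) ≤ B * u * besselKernel (u ^ 2 * τ) :=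
          mul_le_mul_of_nonneg_right (hn i) (besselKernel_nonneg _)
      _ = B * (u * besselKernel (u ^ 2 * τ)) := by ring
      _ ≤ B * (C * (1 / √τ)) := by gcongr
      _ = _ := by ring
  have hnK0 : ∀ i, 0 ≤ n i * besselKernel (u ^ 2 * τ) := fun i =>
    mul_nonneg (Nat.cast_nonneg _) (besselKernel_nonneg _)
  have hE0 := exp_pos (-4 * (u ^ 2 * τ))
  have hsp : 0 < 1 / √τ := by positivity
  have hBC' : B * C * (1 / √τ) ≤ B * C := mul_le_of_le_one_right hBC hsi
  have h := abs_prod_sub_prod_le (univ : Finset (Fin d)) (X := B * C + 1)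
    (ε := (B * C + 1) * (1 / √τ)) (x := fun i => pathMain (n i) (u ^ 2 * τ))
    (y := fun _ => -1 / 2) (by linarith)
    (fun i _ => by
      have := hnK i; have := hnK0 i
      simp only [pathMain]
      exact abs_le.2 ⟨by linarith, by linarith⟩)
    (fun i _ => abs_le.2 ⟨by linarith, by linarith⟩)
    (fun i _ => by
      have := hnK i; have := hnK0 i
      simp only [pathMain]
      rw [add_mul, one_mul]
      exact abs_le.2 ⟨by linarith, by linarith⟩)
  rw [prod_const, card_univ, Fintype.card_fin, div_pow] at h
  exact h.trans_eq (by ring)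

theorem latticeHeat_le (hd : 1 ≤ d) {B : ℝ} {n : Fin d → ℕ} (hn : ∀ i, 1 ≤ n i) {u τ : ℝ}
    (hu : 1 ≤ u) (hB : ∀ i, n i ≤ B * u) (hτ : 1 ≤ τ) :
    latticeHeat n (u ^ 2 * τ) ≤ (B ^ 2 / 4) ^ d * (1 / √τ) := by
  have hτ0 : 0 < τ := by linarith
  calc latticeHeat n (u ^ 2 * τ) ≤ ∏ _i : Fin d, B ^ 2 / (4 * τ) := by
        refine prod_le_prod (fun i _ => pathTheta_nonneg _ _) fun i _ => ?_
        have := pathTheta_le_div_pow (hn i) hu (hB i) hτ0 le_rfl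
        simpa using this
    _ = (B ^ 2 / 4) ^ d * (1 / τ ^ d) := by
        rw [prod_const, card_univ, Fintype.card_fin, ← div_div, div_pow, mul_one_div]
    _ ≤ (B ^ 2 / 4) ^ d * (1 / √τ) := by
        gcongr
        refine (sqrt_le_iff.2 ⟨by positivity, ?_⟩)
        rw [← pow_mul]
        exact le_self_pow₀ hτ (by lia)

/-- The dominating function is constant on `(0, 1]` and a multiple of `τ ^ (-3/2)` beyond, with
constants depending only on `d` and on bounds for `n u i / u`. -/
theorem tendsto_integral_remainder (hd : 1 ≤ d) {a : Fin d → ℝ} (ha : ∀ i, 0 < a i)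
    {n : ℝ → Fin d → ℕ} (hn : ∀ i, Tendsto (fun u => (n u i : ℝ) / u) atTop (𝓝 (a i))) :
    Tendsto (fun u => ∫ τ in Set.Ioi 0, (latticeHeat (n u) (u ^ 2 * τ) -
      latticeMain (n u) (u ^ 2 * τ) + (-1) ^ d / 2 ^ d * (1 - exp (-τ))) / τ) atTop
      (𝓝 (∫ τ in Set.Ioi 0, limitIntegrand a τ)) := by
  obtain ⟨b, B, hb, hB, hev⟩ := exists_eventually_bounds ha hn
  obtain ⟨C₀, hC₀⟩ := exists_abs_latticeHeat_sub_latticeMain_le d hb hB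
  obtain ⟨C₁, hC₁⟩ := exists_abs_latticeMain_sub_le d hB
  set p : ℝ := (-1) ^ d / 2 ^ d with hp
  refine tendsto_integral_filter_of_dominated_convergence
    (tailBound (C₀ + |p|) ((B ^ 2 / 4) ^ d + C₁ + |p|)) ?_ ?_ (integrableOn_tailBound _ _) ?_
  · refine Eventually.of_forall fun u => Measurable.aestronglyMeasurable ?_
    unfold latticeHeat latticeMain
    have h1 : ∀ m, Measurable fun τ => pathTheta m (u ^ 2 * τ) := fun m =>
      (measurable_pathTheta m).comp (by fun_prop)
    have h2 : ∀ m, Measurable fun τ => pathMain m (u ^ 2 * τ) := fun m =>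
      (measurable_pathMain m).comp (by fun_prop)
    have h3 := Finset.measurable_fun_prod univ fun i _ => h1 (n u i)
    have h4 := Finset.measurable_fun_prod univ fun i _ => h2 (n u i)
    exact ((h3.sub h4).add (by fun_prop)).div measurable_id
  · filter_upwards [hev, eventually_ge_atTop 1] with u hu hu1
    refine (ae_restrict_iff' measurableSet_Ioi).2 (ae_of_all _ fun τ hτ => ?_)
    have hτ0 : 0 < τ := hτ
    have he : 1 - exp (-τ) ≤ τ := by linarith [add_one_le_exp (-τ)]
    have he0 : 0 ≤ 1 - exp (-τ) := by linarith [exp_le_one_iff.2 (by linarith : -τ ≤ 0)]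
    refine abs_le_tailBound hτ0 (fun h1 => ?_) fun h1 => ?_
    · refine (abs_add_le _ _).trans ?_
      rw [abs_mul, abs_of_nonneg he0, add_mul]
      exact add_le_add (hC₀ (n u) u τ hu1 hu hτ0 h1) (by gcongr)
    · have hn1 : ∀ i, 1 ≤ n u i := fun i => one_le_of_mul_le hb hu1 (hu i).1
      have h2 := latticeHeat_le hd hn1 hu1 (fun i => (hu i).2) h1
      have h3 := hC₁ (n u) u τ hu1 (fun i => (hu i).2) h1
      have h4 : 0 ≤ latticeHeat (n u) (u ^ 2 * τ) := prod_nonneg fun i _ => pathTheta_nonneg _ _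
      -- For `τ ≥ 1` the constant `p` is paired with `latticeMain`, which tends to it; the other
      -- pieces decay on their own.
      calc |latticeHeat (n u) (u ^ 2 * τ) - latticeMain (n u) (u ^ 2 * τ) + p * (1 - exp (-τ))|
          = |latticeHeat (n u) (u ^ 2 * τ) + -(latticeMain (n u) (u ^ 2 * τ) - p) +
              -(p * exp (-τ))| := by congr 1; ring
        _ ≤ |latticeHeat (n u) (u ^ 2 * τ)| + |latticeMain (n u) (u ^ 2 * τ) - p| +
              |p| * exp (-τ) := by
            refine (abs_add_three _ _ _).trans_eq ?_
            rw [abs_neg, abs_neg, abs_mul, abs_of_pos (exp_pos _)]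
        _ ≤ (B ^ 2 / 4) ^ d * (1 / √τ) + C₁ * (1 / √τ) + |p| * (1 / √τ) := by
            rw [abs_of_nonneg h4]
            have := exp_neg_le_one_div_sqrt h1
            gcongr
        _ = _ := by ring
  · refine (ae_restrict_iff' measurableSet_Ioi).2 (ae_of_all _ fun τ hτ => ?_)
    rw [limitIntegrand, boxCoeff_zero]
    exact (((tendsto_latticeHeat ha hn hτ).sub (tendsto_latticeMain hn hτ)).add_const _).div_const _

end DirichletBox

end

/-! ### Assembly of the asymptotic formula -/

open DirichletBox in
theorem theorem1p1 (d : ℕ) (hd : 1 ≤ d) (a : Fin d → ℝ) (ha : ∀ i, 0 < a i)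
    (n : ℝ → Fin d → ℕ)
    (hn : ∀ i, Filter.Tendsto (fun u : ℝ => (n u i : ℝ) / u) Filter.atTop (nhds (a i))) :
    (∀ i ∈ Finset.Icc 1 d,
      MeasureTheory.IntegrableOn (bulkIntegrand d i 0) (Set.Ioi (0 : ℝ))) ∧
    (∃ L : ℝ, HasLogZetaDet a L) ∧
    ∀ L : ℝ, HasLogZetaDet a L →
      Filter.Tendsto
        (fun u : ℝ => Real.log (discreteDirichletLaplacian (n u)).det -
          ((∑ i ∈ Finset.Icc 1 d, faceVolume (n u) i * bulkConstant d i 0)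
            - (-1) ^ d / 2 ^ d * Real.log (u ^ 2)
            + L
            + (-1) ^ d / 2 ^ d *
              ∑ i ∈ Finset.Icc 1 d, Real.log (4 * (i : ℝ)) * (d.choose i : ℝ)))
        Filter.atTop (nhds 0) := by
  refine ⟨fun i hi => integrableOn_bulkIntegrand (Finset.mem_Icc.1 hi).1, ⟨_, hasLogZetaDet hd ha⟩,
    fun L hL => ?_⟩
  obtain ⟨b, B, hb, -, hev⟩ := exists_eventually_bounds ha hn
  -- By the exact formula, the quantity to be estimated is eventually equal to the limiting integral
  -- minus the rescaled remainder integral.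
  have h := (tendsto_integral_remainder hd ha hn).const_sub
    (∫ τ in Set.Ioi 0, limitIntegrand a τ)
  rw [sub_self] at h
  refine h.congr' ?_
  filter_upwards [hev, Filter.eventually_ge_atTop 1] with u hu hu1
  have hn1 : ∀ i, 1 ≤ n u i := fun i => one_le_of_mul_le hb hu1 (hu i).1
  rw [log_det_eq hd hn1 (zero_lt_one.trans_le hu1),
    integral_remainderIntegrand (n u) (zero_lt_one.trans_le hu1), hL.eq_neg_integral hd ha]
  ring
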